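/- Write $\dot{\mathbb R}=\mathbb R\setminus\{0\}$. For an open interval $I$ let $\operatorname{AC}(I)$ be the set of functions $f$ on $I$ for which there is $g\in L^1_{\mathrm{loc}}(I)$ with $f(y)-f(x)=\int_x^y g(s)\,ds$ for all $x,y\in I$, and let $\operatorname{AC}(\dot{\mathbb R})$ be the set of $f:\dot{\mathbb R}\to\mathbb C$ whose restrictions to $(-\infty,0)$ and $(0,\infty)$ are in $\operatorname{AC}$. For $T\in(0,\infty]$ let $\operatorname{AC}_{1,2}$ be the set of $\Psi:(0,T)\times\dot{\mathbb R}\to\mathbb C$ with $\Psi(\cdot,x)\in\operatorname{AC}((0,T))$ for all $x\in\dot{\mathbb R}$ and $\Psi(t,\cdot),\Psi_x(t,\cdot)\in\operatorname{AC}(\dot{\mathbb R})$ for all $t\in(0,T)$. Let $V:(0,T)\times\dot{\mathbb R}\to\mathbb C$ and $M,N\in\mathbb C^{2\times2}$. We say that $u:\dot{\mathbb R}\to\mathbb C$ satisfies the transmission condition if $$M\begin{pmatrix}u(0^+)\\u(0^-)\end{pmatrix}=N\begin{pmatrix}u'(0^+)\\-u'(0^-)\end{pmatrix},$$ where the limits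 $u(0^\pm)$ are required to exist if $(M,N)\neq(0,0)$, the limits $u'(0^\pm)$ are required to exist if $N\ne0$, and the condition is empty if $M=N=0$. A solution of the Cauchy problem with initial condition $F:\dot{\mathbb R}\to\mathbb C$ is a $\Psi\in\operatorname{AC}_{1,2}$ such that $i\Psi_t=-\Psi_{xx}+V\Psi$ for almost every $(t,x)\in(0,T)\times\dot{\mathbb R}$, $\Psi(t,\cdot)$ satisfies the transmission condition for every $t\in(0,T)$, and $\lim_{t\to0^+}\Psi(t,x)=F(x)$ for every $x\in\dot{\mathbb R}$. **Assumption on $G$.** Let $\alpha\in(0,\frac\pi2)$ and let $S_\alpha$ be the set of $z\in\mathbb C\setminus\{0\}$ having an argument in $[0,\alpha]\cup[\pi,\pi+\alpha]$. Let $G:(0,T)\times\dot{\mathbb R}\times\dot{\mathbb R}\to\mathbb C$ admit an extension $G:(0,T)\times\dot{\mathbb R}\times S_\alpha\to\mathbb C$ such that for all $t,x$ the map $G(t,x,\cdot)$ is continuous on $S_\alpha$ and holomorphic on $\operatorname{int}(S_\alpha)$, and suppose: (i) For every $z\in S_\alpha$, $G(\cdot,\cdot,z)\in\operatorname{AC}_{1,2}$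 and $iG_t=-G_{xx}+VG$ for almost every $(t,x)\in(0,T)\times\dot{\mathbb R}$; for every $y\in\dot{\mathbb R}$ and $t\in(0,T)$, $G(t,\cdot,y)$ satisfies the transmission condition. (ii) For every $x\in\dot{\mathbb R}$ there is $x_0>|x|$ such that $\lim_{t\to0^+}\int_{-x_0}^{x_0}G(t,x,y)\varphi(y)\,dy=\varphi(x)$ for all $\varphi\in C^\infty([-x_0,x_0])$. (iii) There are $a\in\operatorname{AC}((0,T))$ with $a>0$ and $\lim_{t\to0^+}a(t)=\infty$, $p\in(0,2)$, and continuous $A_j,B_j:(0,T)\times\dot{\mathbb R}\to[0,\infty)$, $j=0,1,2$, such that $\widetilde G$, defined by $G(t,x,z)=e^{ia(t)(z-x)^2}\widetilde G(t,x,z)$, satisfies for all $t\in(0,T)$, $x\in\dot{\mathbb R}$, $z\in S_\alpha$ $$|\widetilde G|\le A_0(t,x)e^{B_0(t,x)|z|^p},\qquad |\widetilde G_x|\le A_1(t,x)e^{B_1(t,x)|z|^p},$$ and moreover $|\widetilde G_{xx}|\le A_2(t,x)e^{B_2(t,x)|z|^p}$ for all $t,z$ and almost every $x$, and $|\widetilde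 G_t|\le A_2(t,x)e^{B_2(t,x)|z|^p}$ for all $x,z$ and almost every $t$. For every $x\in\dot{\mathbb R}$, $A_0(t,x)/\sqrt{a(t)}$ and $B_0(t,x)$ are bounded as $t\to0^+$. For every $t\in(0,T)$: if $(M,N)\ne(0,0)$, then $A_0(t,\cdot),B_0(t,\cdot)$ are bounded as $x\to0^\pm$; if $N\neq0$, then also $A_1(t,\cdot),B_1(t,\cdot)$ are bounded as $x\to0^\pm$. **Initial conditions.** For $q>0$ let $\mathcal A_q(\mathbb C)$ be the set of entire $F$ for which there are $A,B\ge0$ with $|F(z)|\le Ae^{B|z|^q}$ for all $z\in\mathbb C$. Say $F_n\to F$ in $\mathcal A_q(\mathbb C)$ if there is $B\ge0$ with $\lim_{n\to\infty}\sup_{z\in\mathbb C}|F_n(z)-F(z)|e^{-B|z|^q}=0$. **Theorem.** Let $G$ satisfy the assumption above, let $q\in(0,2)$ and $F\in\mathcal A_q(\mathbb C)$. Then for all $t\in(0,T)$, $x\in\dot{\mathbb R}$ the limit $$\Psi(t,x;F):=\lim_{\varepsilon\to0^+}\int_{\mathbb R}e^{-\varepsilon y^2}G(t,x,y)F(y)\,dy$$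 exists, the integrals being absolutely convergent for every $\varepsilon>0$, and $\Psi(\cdot,\cdot;F)\in\operatorname{AC}_{1,2}$ is a solution of the Cauchy problem with initial condition $F|_{\dot{\mathbb R}}$. Moreover, if $F_n\in\mathcal A_q(\mathbb C)$ and $F_n\to F$ in $\mathcal A_q(\mathbb C)$, then for every fixed $t\in(0,T)$, $\Psi(t,x;F_n)\to\Psi(t,x;F)$ as $n\to\infty$, uniformly for $x$ in compact subsets of $\dot{\mathbb R}$. -/

import Mathlib

open Set Filter Topology MeasureTheory
open scoped ENNReal ContDiff

noncomputable section

namespace GreenSchroedinger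

/-- The time interval `(0, T)` for `T ∈ (0, ∞]`. -/
def timeInterval (T : EReal) : Set ℝ := {t : ℝ | 0 < t ∧ (t : EReal) < T}

/-- The punctured line `ℝ \ {0}`. -/
def dotReal : Set ℝ := {0}ᶜ

/-- The closed double sector, without the origin, of all `z ≠ 0` that have an argument in
`[0, α] ∪ [π, π + α]`. -/
def doubleSector (α : ℝ) : Set ℂ :=
  {z : ℂ | z ≠ 0 ∧ ∃ θ ∈ Icc 0 α ∪ Icc Real.pi (Real.pi + α),
    z = (‖z‖ : ℂ) * Complex.exp ((θ : ℂ) * Complex.I)}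

/-- (Locally) absolutely continuous functions on an open interval `I`: the integral functions of
locally integrable functions. -/
def IsAC {E : Type*} [NormedAddCommGroup E] [NormedSpace ℝ E] (f : ℝ → E) (I : Set ℝ) : Prop :=
  ∃ g : ℝ → E, LocallyIntegrableOn g I ∧ ∀ x ∈ I, ∀ y ∈ I, f y - f x = ∫ s in x..y, g s

/-- Absolutely continuous functions on the punctured line. -/
def IsACDot (f : ℝ → ℂ) : Prop := IsAC f (Iio 0) ∧ IsAC f (Ioi 0)

/-- The space `AC_{1,2}((0,T) × (ℝ \ {0}))`. -/
structure MemAC12 (T : EReal) (Ψ : ℝ → ℝ → ℂ) : Prop where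
  time : ∀ x ∈ dotReal, IsAC (fun t => Ψ t x) (timeInterval T)
  space : ∀ t ∈ timeInterval T, IsACDot (Ψ t)
  differentiable : ∀ t ∈ timeInterval T, ∀ x ∈ dotReal, DifferentiableAt ℝ (Ψ t) x
  space_deriv : ∀ t ∈ timeInterval T, IsACDot (deriv (Ψ t))

/-- The equation `i Ψ_t = -Ψ_xx + V Ψ` at almost every `(t, x) ∈ (0,T) × (ℝ \ {0})`. -/
def SatisfiesSchroedinger (T : EReal) (V Ψ : ℝ → ℝ → ℂ) : Prop :=
  ∀ᵐ P : ℝ × ℝ, P.1 ∈ timeInterval T → P.2 ∈ dotReal →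
    Complex.I * deriv (fun t => Ψ t P.2) P.1
      = - deriv (deriv (Ψ P.1)) P.2 + V P.1 P.2 * Ψ P.1 P.2

/-- The condition `M (u(0⁺), u(0⁻)) = N (u'(0⁺), -u'(0⁻))` with the one-sided limits of `u` and
`u'` at `0`. The limits that occur are required to exist: those of `u` unless `M = N = 0`, and
those of `u'` if `N ≠ 0`; for `M = N = 0` the condition is empty. -/
def SatisfiesTransmission (M N : Matrix (Fin 2) (Fin 2) ℂ) (u : ℝ → ℂ) : Prop :=
  ∃ up um dp dm : ℂ,
    (M ≠ 0 ∨ N ≠ 0 → Tendsto u (𝓝[>] 0) (𝓝 up) ∧ Tendsto u (𝓝[<] 0) (𝓝 um)) ∧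
    (N ≠ 0 → Tendsto (deriv u) (𝓝[>] 0) (𝓝 dp) ∧ Tendsto (deriv u) (𝓝[<] 0) (𝓝 dm)) ∧
    M.mulVec ![up, um] = N.mulVec ![dp, -dm]

/-- `Ψ ∈ AC_{1,2}` solves the Cauchy problem with potential `V`, transmission matrices `M`, `N`
and initial condition `F`. -/
structure IsCauchySolution (T : EReal) (V : ℝ → ℝ → ℂ) (M N : Matrix (Fin 2) (Fin 2) ℂ)
    (F : ℝ → ℂ) (Ψ : ℝ → ℝ → ℂ) : Prop where
  mem : MemAC12 T Ψ
  schroedinger : SatisfiesSchroedinger T V Ψ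
  transmission : ∀ t ∈ timeInterval T, SatisfiesTransmission M N (Ψ t)
  initial : ∀ x ∈ dotReal, Tendsto (fun t => Ψ t x) (𝓝[>] 0) (𝓝 (F x))

/-- The assumption on the Green's function `G`. Here `Gext` is the continuation of `G` to the
double sector of angle `α`, `a` the coefficient of the Gaussian factor, `Gt` the remaining factor
`G̃`, and `p`, `A 0, A 1, A 2`, `B 0, B 1, B 2` are the data of its exponential bounds. The
derivatives `G̃_xx` and `G̃_t` of absolutely continuous functions exist only almost everywhere in
the variable of differentiation, and their bounds are required almost everywhere there. -/
structure GreenAssumption (T : EReal) (V : ℝ → ℝ → ℂ) (M N : Matrix (Fin 2) (Fin 2) ℂ)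
    (G : ℝ → ℝ → ℝ → ℂ) (α : ℝ) (Gext : ℝ → ℝ → ℂ → ℂ) (a : ℝ → ℝ) (Gt : ℝ → ℝ → ℂ → ℂ)
    (p : ℝ) (A B : Fin 3 → ℝ → ℝ → ℝ) : Prop where
  angle : α ∈ Ioo 0 (Real.pi / 2)
  extends_G : ∀ t ∈ timeInterval T, ∀ x ∈ dotReal, ∀ y ∈ dotReal, Gext t x (y : ℂ) = G t x y
  continuousOn : ∀ t ∈ timeInterval T, ∀ x ∈ dotReal, ContinuousOn (Gext t x) (doubleSector α)
  holomorphic : ∀ t ∈ timeInterval T, ∀ x ∈ dotReal,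
    DifferentiableOn ℂ (Gext t x) (interior (doubleSector α))
  -- (i) Schroedinger equation and transmission condition
  mem : ∀ z ∈ doubleSector α, MemAC12 T (fun t x => Gext t x z)
  schroedinger : ∀ z ∈ doubleSector α, SatisfiesSchroedinger T V (fun t x => Gext t x z)
  transmission : ∀ y ∈ dotReal, ∀ t ∈ timeInterval T,
    SatisfiesTransmission M N (fun x => G t x y)
  -- (ii) initial condition
  initial : ∀ x ∈ dotReal, ∃ x₀ : ℝ, |x| < x₀ ∧ ∀ φ : ℝ → ℂ, ContDiffOn ℝ ∞ φ (Icc (-x₀) x₀) →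
    Tendsto (fun t => ∫ y in (-x₀)..x₀, G t x y * φ y) (𝓝[>] 0) (𝓝 (φ x))
  -- (iii) Gaussian factorisation and exponential bounds
  a_ac : IsAC a (timeInterval T)
  a_pos : ∀ t ∈ timeInterval T, 0 < a t
  a_lim : Tendsto a (𝓝[>] 0) atTop
  decomposition : ∀ t ∈ timeInterval T, ∀ x ∈ dotReal, ∀ z ∈ doubleSector α,
    Gext t x z = Complex.exp (Complex.I * (a t : ℂ) * (z - (x : ℂ)) ^ 2) * Gt t x z
  order : p ∈ Ioo (0 : ℝ) 2
  A_nonneg : ∀ j, ∀ t ∈ timeInterval T, ∀ x ∈ dotReal, 0 ≤ A j t x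
  B_nonneg : ∀ j, ∀ t ∈ timeInterval T, ∀ x ∈ dotReal, 0 ≤ B j t x
  A_continuous : ∀ j, ContinuousOn (fun P : ℝ × ℝ => A j P.1 P.2) (timeInterval T ×ˢ dotReal)
  B_continuous : ∀ j, ContinuousOn (fun P : ℝ × ℝ => B j P.1 P.2) (timeInterval T ×ˢ dotReal)
  bound : ∀ t ∈ timeInterval T, ∀ x ∈ dotReal, ∀ z ∈ doubleSector α,
    ‖Gt t x z‖ ≤ A 0 t x * Real.exp (B 0 t x * ‖z‖ ^ p)
  bound_x : ∀ t ∈ timeInterval T, ∀ x ∈ dotReal, ∀ z ∈ doubleSector α,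
    ‖deriv (fun ξ => Gt t ξ z) x‖ ≤ A 1 t x * Real.exp (B 1 t x * ‖z‖ ^ p)
  bound_xx : ∀ t ∈ timeInterval T, ∀ z ∈ doubleSector α, ∀ᵐ x : ℝ, x ∈ dotReal →
    ‖deriv (deriv (fun ξ => Gt t ξ z)) x‖ ≤ A 2 t x * Real.exp (B 2 t x * ‖z‖ ^ p)
  bound_t : ∀ x ∈ dotReal, ∀ z ∈ doubleSector α, ∀ᵐ t : ℝ, t ∈ timeInterval T →
    ‖deriv (fun τ => Gt τ x z) t‖ ≤ A 2 t x * Real.exp (B 2 t x * ‖z‖ ^ p)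
  A_bounded_time : ∀ x ∈ dotReal,
    IsBoundedUnder (· ≤ ·) (𝓝[>] 0) (fun t => A 0 t x / √(a t))
  B_bounded_time : ∀ x ∈ dotReal, IsBoundedUnder (· ≤ ·) (𝓝[>] 0) (fun t => B 0 t x)
  bounded_zero : M ≠ 0 ∨ N ≠ 0 → ∀ t ∈ timeInterval T,
    IsBoundedUnder (· ≤ ·) (𝓝[≠] 0) (A 0 t) ∧ IsBoundedUnder (· ≤ ·) (𝓝[≠] 0) (B 0 t)
  bounded_zero_x : N ≠ 0 → ∀ t ∈ timeInterval T,
    IsBoundedUnder (· ≤ ·) (𝓝[≠] 0) (A 1 t) ∧ IsBoundedUnder (· ≤ ·) (𝓝[≠] 0) (B 1 t)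

/-- The space `𝒜_q(ℂ)` of entire functions with exponential growth of order `q`. -/
def expGrowth (q : ℝ) : Set (ℂ → ℂ) :=
  {F | Differentiable ℂ F ∧
    ∃ A B : ℝ, 0 ≤ A ∧ 0 ≤ B ∧ ∀ z : ℂ, ‖F z‖ ≤ A * Real.exp (B * ‖z‖ ^ q)}

/-- Convergence in `𝒜_q(ℂ)`; the supremum is taken in `[0, ∞]`. -/
def ConvergesExpGrowth (q : ℝ) (Fn : ℕ → ℂ → ℂ) (F : ℂ → ℂ) : Prop :=
  ∃ B : ℝ, 0 ≤ B ∧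
    Tendsto (fun n => ⨆ z : ℂ, ENNReal.ofReal (‖Fn n z - F z‖ * Real.exp (-B * ‖z‖ ^ q)))
      atTop (𝓝 0)

/-- The integrand `e^{-ε y²} G(t,x,y) F(y)` of the regularised integral. -/
def regIntegrand (G : ℝ → ℝ → ℝ → ℂ) (F : ℂ → ℂ) (t x ε y : ℝ) : ℂ :=
  (Real.exp (-ε * y ^ 2) : ℂ) * G t x y * F (y : ℂ)

/-- The wave function `Ψ(t,x;F) = lim_{ε → 0⁺} ∫ e^{-ε y²} G(t,x,y) F(y) dy`. -/
def waveFunction (G : ℝ → ℝ → ℝ → ℂ) (F : ℂ → ℂ) (t x : ℝ) : ℂ :=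
  limUnder (𝓝[>] (0 : ℝ)) (fun ε => ∫ y : ℝ, regIntegrand G F t x ε y)

end GreenSchroedinger

end

/-
On the real line the Green function only oscillates, through the factor `e^{ia(t)(z-x)²}`. On the
rotated line `z = e^{iα/2} y` the same factor decays like `e^{-a(t) sin(α) y²}`, which beats the
growth of both `Gt` and `F`. By Cauchy's theorem the regularised integral equals the one over the
rotated line, where the limit `ε → 0⁺` can be taken and the wave function is an absolutely
convergent integral that may be differentiated under the integral sign.

The transmission condition is only known for real `y`. It is carried over to the wave function
through the regularised integrals, since `Gt` and its derivative in `x` are dominated uniformly as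
`x → 0^±`. For the initial condition only the parts of the line outside `[-x₀, x₀]` are rotated,
about `±x₀`: their contribution vanishes as `a(t) → ∞`.
-/

namespace GreenSchroedinger

section AbsolutelyContinuous

variable {E : Type*} [NormedAddCommGroup E] {I : Set ℝ}

lemma exists_Icc_mem_nhds_subset {s : ℝ} (hI : IsOpen I) (hs : s ∈ I) :
    ∃ c ∈ I, ∃ d ∈ I, Icc c d ∈ 𝓝 s := by
  obtain ⟨c, d, hsm, hn, hsub⟩ := exists_Icc_mem_subset_of_mem_nhds (hI.mem_nhds hs)
  have hcd := hsm.1.trans hsm.2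
  exact ⟨c, hsub (left_mem_Icc.2 hcd), d, hsub (right_mem_Icc.2 hcd), hn⟩

lemma ae_of_forall_Icc (hI : IsOpen I) {P : ℝ → Prop}
    (h : ∀ c ∈ I, ∀ d ∈ I, ∀ᵐ s : ℝ, s ∈ Icc c d → P s) : ∀ᵐ s : ℝ, s ∈ I → P s := by
  refine mem_ae_iff.2 (measure_null_of_locally_null _ fun s hs => ?_)
  obtain ⟨c, hc, d, hd, hn⟩ := exists_Icc_mem_nhds_subset hI (Classical.not_imp.1 hs).1
  have hnull := mem_ae_iff.1 (h c hc d hd)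
  refine ⟨_, inter_mem_nhdsWithin _ hn, measure_mono_null ?_ hnull⟩
  exact fun r hr h' => hr.1 fun _ => h' hr.2

lemma locallyIntegrableOn_of_forall_Icc (hI : IsOpen I) {g : ℝ → E}
    (h : ∀ c ∈ I, ∀ d ∈ I, IntegrableOn g (Icc c d)) : LocallyIntegrableOn g I := fun _ hs =>
  let ⟨c, hc, d, hd, hn⟩ := exists_Icc_mem_nhds_subset hI hs
  ⟨Icc c d, mem_nhdsWithin_of_mem_nhds hn, h c hc d hd⟩

lemma intervalIntegrable_of_locallyIntegrableOn {g : ℝ → E} (hI : I.OrdConnected)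
    (hg : LocallyIntegrableOn g I) {c d : ℝ} (hc : c ∈ I) (hd : d ∈ I) :
    IntervalIntegrable g volume c d :=
  (hg.integrableOn_compact_subset (hI.uIcc_subset hc hd) isCompact_uIcc).intervalIntegrable

variable [NormedSpace ℝ E] {f g : ℝ → E}

lemma IsAC.congr (h : IsAC f I) (he : EqOn f g I) : IsAC g I := by
  obtain ⟨k, hk, hfk⟩ := h
  exact ⟨k, hk, fun x hx y hy => by rw [← he hx, ← he hy, hfk x hx y hy]⟩

lemma isAC_const (c : E) : IsAC (fun _ : ℝ => c) I :=
  ⟨fun _ => 0, (locallyIntegrable_const 0).locallyIntegrableOn _, by simp⟩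

lemma IsAC.const_mul {f : ℝ → ℂ} (h : IsAC f I) (c : ℂ) : IsAC (fun s => c * f s) I := by
  obtain ⟨g, hg, hfg⟩ := h
  refine ⟨fun s => c * g s, fun x hx => ?_, fun x hx y hy => ?_⟩
  · obtain ⟨s, hs, hgs⟩ := hg x hx
    exact ⟨s, hs, hgs.const_mul c⟩
  · rw [intervalIntegral.integral_const_mul, ← hfg x hx y hy, mul_sub]

lemma IsAC.continuousOn (h : IsAC f I) (hI : IsOpen I) (hI' : I.OrdConnected) :
    ContinuousOn f I := by
  obtain ⟨g, hg, hfg⟩ := h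
  intro s hs
  obtain ⟨c, hc, d, hd, hn⟩ := exists_Icc_mem_nhds_subset hI hs
  have hprim : ContinuousOn (fun r => f c + ∫ u in c..r, g u) (uIcc c d) :=
    continuousOn_const.add (intervalIntegral.continuousOn_primitive_interval'
      (intervalIntegrable_of_locallyIntegrableOn hI' hg hc hd) left_mem_uIcc)
  have heq : f =ᶠ[𝓝 s] fun r => f c + ∫ u in c..r, g u := by
    filter_upwards [hn] with r hr
    rw [← hfg c hc r (hI'.out hc hd hr), add_sub_cancel]
  exact ((hprim.continuousAt (mem_of_superset hn Icc_subset_uIcc)).congr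
    heq.symm).continuousWithinAt

variable [CompleteSpace E]

lemma ae_hasDerivAt_of_sub_eq_integral (hI : IsOpen I) (hI' : I.OrdConnected)
    (hg : LocallyIntegrableOn g I) (hfg : ∀ x ∈ I, ∀ y ∈ I, f y - f x = ∫ s in x..y, g s) :
    ∀ᵐ s : ℝ, s ∈ I → HasDerivAt f (g s) s := by
  refine ae_of_forall_Icc hI fun c hc d hd => ?_
  filter_upwards [(intervalIntegrable_of_locallyIntegrableOn hI' hg hc hd).ae_hasDerivAt_integral]
    with s hs hsI
  refine ((hs (Icc_subset_uIcc hsI) c left_mem_uIcc).const_add (f c)).congr_of_eventuallyEq ?_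
  filter_upwards [hI.mem_nhds (hI'.out hc hd hsI)] with r hr
  rw [← hfg c hc r hr, add_sub_cancel]

lemma IsAC.ae_differentiableAt (h : IsAC f I) (hI : IsOpen I) (hI' : I.OrdConnected) :
    ∀ᵐ s : ℝ, s ∈ I → DifferentiableAt ℝ f s := by
  obtain ⟨g, hg, hfg⟩ := h
  filter_upwards [ae_hasDerivAt_of_sub_eq_integral hI hI' hg hfg] with s hs hsI
    using (hs hsI).differentiableAt

lemma IsAC.locallyIntegrableOn_deriv (h : IsAC f I) (hI : IsOpen I) (hI' : I.OrdConnected) :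
    LocallyIntegrableOn (deriv f) I := by
  obtain ⟨g, hg, hfg⟩ := h
  refine locallyIntegrableOn_of_forall_Icc hI fun c hc d hd => ?_
  have hsub : Icc c d ⊆ I := hI'.out hc hd
  refine (hg.integrableOn_compact_subset hsub isCompact_Icc).congr_fun_ae ?_
  refine (ae_restrict_iff' measurableSet_Icc).2 ?_
  filter_upwards [ae_hasDerivAt_of_sub_eq_integral hI hI' hg hfg] with s hs hsI
    using (hs (hsub hsI)).deriv.symm

lemma IsAC.sub_eq_integral_deriv (h : IsAC f I) (hI : IsOpen I) (hI' : I.OrdConnected) {c d : ℝ}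
    (hc : c ∈ I) (hd : d ∈ I) : f d - f c = ∫ s in c..d, deriv f s := by
  obtain ⟨g, hg, hfg⟩ := h
  rw [hfg c hc d hd]
  refine intervalIntegral.integral_congr_ae ?_
  filter_upwards [ae_hasDerivAt_of_sub_eq_integral hI hI' hg hfg] with s hs hsI
    using (hs (hI'.uIcc_subset hc hd (uIoc_subset_uIcc hsI))).deriv.symm

end AbsolutelyContinuous

section Measurability

lemma tendsto_nhdsWithin_inter_dense_iff {X Y : Type*} [TopologicalSpace X] [TopologicalSpace Y]
    [RegularSpace Y] {φ : X → Y} {O D : Set X} (hO : IsOpen O) (hD : Dense D)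
    (hφ : ContinuousOn φ O) {x : X} {L : Y} :
    Tendsto φ (𝓝[O ∩ D] x) (𝓝 L) ↔ Tendsto φ (𝓝[O] x) (𝓝 L) := by
  refine ⟨fun h => ?_, fun h => h.mono_left (nhdsWithin_mono _ inter_subset_left)⟩
  refine (closed_nhds_basis L).tendsto_right_iff.2 fun K ⟨hKL, hK⟩ => ?_
  obtain ⟨W, hW, hxW, hWK⟩ := mem_nhdsWithin.1 (h hKL)
  refine mem_nhdsWithin.2 ⟨W, hW, hxW, fun z hz => ?_⟩
  have hcl : z ∈ closure (W ∩ (O ∩ D)) := by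
    rw [← inter_assoc]
    exact hD.open_subset_closure_inter (hW.inter hO) hz
  have himg : φ '' (W ∩ (O ∩ D)) ⊆ K := image_subset_iff.2 hWK
  exact closure_minimal himg hK
    (((hφ z hz.2).mono (inter_subset_right.trans inter_subset_left)).mem_closure_image hcl)

variable {E : Type*} [NormedAddCommGroup E] {U : Set ℝ}

lemma hasDerivAt_iff_tendsto_slope_rat [NormedSpace ℝ E] {g : ℝ → E} (hU : IsOpen U)
    (hg : ContinuousOn g U) {s : ℝ} (hs : s ∈ U) {L : E} :
    HasDerivAt g L s ↔ Tendsto (fun h : ℚ => (h : ℝ)⁻¹ • (g (s + h) - g s)) (𝓝[≠] 0) (𝓝 L) := by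
  set O : Set ℝ := {0}ᶜ ∩ (s + ·) ⁻¹' U
  have hO : IsOpen O := isOpen_compl_singleton.inter (hU.preimage (continuous_const_add s))
  have hcont : ContinuousOn (fun h : ℝ => h⁻¹ • (g (s + h) - g s)) O :=
    (continuousOn_inv₀.mono inter_subset_left).smul
      ((hg.comp (continuous_const_add s).continuousOn inter_subset_right).sub continuousOn_const)
  have hpre : (s + ·) ⁻¹' U ∈ 𝓝 (0 : ℝ) :=
    (continuous_const_add s).continuousAt.preimage_mem_nhds (by simpa using hU.mem_nhds hs)
  have hnhds : 𝓝[O] (0 : ℝ) = 𝓝[≠] 0 :=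
    nhdsWithin_inter_of_mem' (mem_nhdsWithin_of_mem_nhds hpre)
  have hrat : map ((↑) : ℚ → ℝ) (𝓝[≠] 0) = 𝓝[O ∩ range ((↑) : ℚ → ℝ)] 0 := by
    have hpre : ({0}ᶜ : Set ℚ) = (↑) ⁻¹' ({0}ᶜ : Set ℝ) := by ext; simp
    rw [hpre, Rat.isEmbedding_coe_real.map_nhdsWithin_eq,
      image_preimage_eq_inter_range, Rat.cast_zero,
      nhdsWithin_inter', nhdsWithin_inter', hnhds]
  rw [hasDerivAt_iff_tendsto_slope_zero, ← hnhds,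
    ← tendsto_nhdsWithin_inter_dense_iff hO Rat.denseRange_cast hcont, ← hrat, tendsto_map'_iff]
  rfl

variable {P : Type*} [MeasurableSpace P] {f : P → ℝ → E}

lemma stronglyMeasurable_indicator_of_continuousOn (hU : IsOpen U)
    (hm : ∀ s ∈ U, StronglyMeasurable fun p => f p s) (hc : ∀ p, ContinuousOn (f p) U) :
    StronglyMeasurable fun r : P × ℝ => U.indicator (f r.1) r.2 := by
  have hsub : StronglyMeasurable (Function.uncurry fun (s : U) (p : P) => f p s) :=
    stronglyMeasurable_uncurry_of_continuous_of_stronglyMeasurable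
      (fun p => (hc p).domRestrict) (fun s => hm s s.2)
  have hemb : MeasurableEmbedding fun r : U × P => (r.2, (r.1 : ℝ)) :=
    MeasurableEquiv.prodComm.measurableEmbedding.comp
      ((MeasurableEmbedding.subtype_coe hU.measurableSet).prodMap .id)
  convert! hemb.stronglyMeasurable_extend (hsub.comp_measurable measurable_id)
    (stronglyMeasurable_const (b := (0 : E))) with r
  by_cases hr : r.2 ∈ U
  · rw [indicator_of_mem hr]
    exact (hemb.injective.extend_apply (Function.uncurry fun (s : U) p => f p s) (fun _ => 0)
      (⟨r.2, hr⟩, r.1)).symm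
  · rw [indicator_of_notMem hr, Function.extend_apply' _ _ _ fun ⟨x, hx⟩ => hr (hx ▸ x.1.2)]

lemma stronglyMeasurable_indicator_deriv [NormedSpace ℝ E] [CompleteSpace E] (hU : IsOpen U)
    (hm : ∀ s ∈ U, StronglyMeasurable fun p => f p s) (hc : ∀ p, ContinuousOn (f p) U) :
    StronglyMeasurable fun r : P × ℝ => U.indicator (deriv (f r.1)) r.2 := by
  have hf := stronglyMeasurable_indicator_of_continuousOn hU hm hc
  let slope : ℚ → P × ℝ → E := fun h r =>
    (h : ℝ)⁻¹ • (U.indicator (f r.1) (r.2 + h) - U.indicator (f r.1) r.2)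
  have hslope : ∀ h, StronglyMeasurable (slope h) := fun h =>
    ((hf.comp_measurable (measurable_fst.prodMk (measurable_snd.add_const (h : ℝ)))).sub
      hf).const_smul _
  have hderiv : ∀ r : P × ℝ, r.2 ∈ U → ∀ L,
      HasDerivAt (f r.1) L r.2 ↔ Tendsto (slope · r) (𝓝[≠] 0) (𝓝 L) := fun r hr L => by
    have heq : f r.1 =ᶠ[𝓝 r.2] U.indicator (f r.1) := by
      filter_upwards [hU.mem_nhds hr] with s hs using (indicator_of_mem hs _).symm
    rw [heq.hasDerivAt_iff, hasDerivAt_iff_tendsto_slope_rat hU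
      ((hc r.1).congr fun s hs => indicator_of_mem hs _) hr]
  set S : Set (P × ℝ) := {r | r.2 ∈ U ∧ ∃ L, Tendsto (slope · r) (𝓝[≠] 0) (𝓝 L)}
  have hS : MeasurableSet S := (measurable_snd hU.measurableSet).inter
    (StronglyMeasurable.measurableSet_exists_tendsto hslope)
  convert! (StronglyMeasurable.limUnder (l := 𝓝[≠] 0) hslope).indicator hS using 1
  ext r
  by_cases hr : r ∈ S
  · obtain ⟨hrU : r.2 ∈ U, L, hL⟩ := id hr
    rw [indicator_of_mem hrU, indicator_of_mem hr, hL.limUnder_eq, ((hderiv r hrU L).2 hL).deriv]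
  · rw [indicator_of_notMem hr]
    refine indicator_apply_eq_zero.2 fun hrU => deriv_zero_of_not_differentiableAt fun hd => hr ?_
    exact ⟨hrU, _, (hderiv r hrU _).1 hd.hasDerivAt⟩

lemma stronglyMeasurable_deriv_of_continuousOn [NormedSpace ℝ E] [CompleteSpace E] (hU : IsOpen U)
    (hm : ∀ s ∈ U, StronglyMeasurable fun p => f p s) (hc : ∀ p, ContinuousOn (f p) U) {s : ℝ}
    (hs : s ∈ U) : StronglyMeasurable fun p => deriv (f p) s := by
  have := (stronglyMeasurable_indicator_deriv hU hm hc).comp_measurable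
    (measurable_prodMk_right (y := s))
  simpa only [Function.comp_def, indicator_of_mem hs] using this

end Measurability

section ParametricIntegral

variable {Y E : Type*} [MeasurableSpace Y] {μ : Measure Y} [NormedAddCommGroup E]
  [NormedSpace ℝ E] [CompleteSpace E] {I : Set ℝ} {f : Y → ℝ → E}

lemma integrable_uncurry_deriv (hI : IsOpen I) (hI' : I.OrdConnected)
    (hm : ∀ s ∈ I, StronglyMeasurable fun y => f y s) (hAC : ∀ y, IsAC (f y) I) {K : Set ℝ}
    (hK : IsCompact K) (hKI : K ⊆ I) {m : ℝ → ℝ} {b : Y → ℝ} (hmK : IntegrableOn m K)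
    (hb : Integrable b μ) (hbd : ∀ y, ∀ᵐ s, s ∈ K → ‖deriv (f y) s‖ ≤ m s * b y) :
    Integrable (Function.uncurry fun y s => deriv (f y) s) (μ.prod (volume.restrict K)) := by
  have hmeas : AEStronglyMeasurable (Function.uncurry fun y s => deriv (f y) s)
      (μ.prod (volume.restrict K)) := by
    refine (stronglyMeasurable_indicator_deriv hI hm fun y =>
      (hAC y).continuousOn hI hI').aestronglyMeasurable.congr ?_
    filter_upwards [Measure.quasiMeasurePreserving_snd.ae (ae_restrict_mem hK.measurableSet)]
      with r hr using indicator_of_mem (hKI hr) _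
  have hy : ∀ y, IntegrableOn (deriv (f y)) K := fun y =>
    ((hAC y).locallyIntegrableOn_deriv hI hI').integrableOn_compact_subset hKI hK
  refine (integrable_prod_iff hmeas).2 ⟨Eventually.of_forall hy,
    (hb.const_mul (∫ s in K, m s)).mono' hmeas.norm.integral_prod_right'
      (Eventually.of_forall fun y => ?_)⟩
  rw [Real.norm_of_nonneg (integral_nonneg fun _ => norm_nonneg _), ← integral_mul_const]
  exact integral_mono_ae (hy y).norm (hmK.mul_const _)
    ((ae_restrict_iff' hK.measurableSet).2 (hbd y))

variable [SFinite μ]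

lemma integral_sub_integral_eq_integral_integral_deriv (hI : IsOpen I) (hI' : I.OrdConnected)
    (hAC : ∀ y, IsAC (f y) I) (hint : ∀ s ∈ I, Integrable (fun y => f y s) μ)
    (hprod : ∀ c ∈ I, ∀ d ∈ I, Integrable (Function.uncurry fun y s => deriv (f y) s)
      (μ.prod (volume.restrict (Icc c d)))) {c d : ℝ} (hc : c ∈ I) (hd : d ∈ I) :
    ∫ y, f y d ∂μ - ∫ y, f y c ∂μ = ∫ s in c..d, ∫ y, deriv (f y) s ∂μ := by
  wlog hcd : c ≤ d generalizing c d
  · rw [intervalIntegral.integral_symm, ← this hd hc (le_of_not_ge hcd), neg_sub]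
  calc ∫ y, f y d ∂μ - ∫ y, f y c ∂μ = ∫ y, f y d - f y c ∂μ :=
        (integral_sub (hint d hd) (hint c hc)).symm
    _ = ∫ y, (∫ s in Icc c d, deriv (f y) s) ∂μ := by
        congr! 2 with y
        rw [(hAC y).sub_eq_integral_deriv hI hI' hc hd, intervalIntegral.integral_of_le hcd,
          integral_Icc_eq_integral_Ioc]
    _ = ∫ s in Icc c d, ∫ y, deriv (f y) s ∂μ := integral_integral_swap (hprod c hc d hd)
    _ = ∫ s in c..d, ∫ y, deriv (f y) s ∂μ := by
        rw [intervalIntegral.integral_of_le hcd, integral_Icc_eq_integral_Ioc]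

theorem isAC_integral (hI : IsOpen I) (hI' : I.OrdConnected)
    (hm : ∀ s ∈ I, StronglyMeasurable fun y => f y s) (hAC : ∀ y, IsAC (f y) I)
    (hint : ∀ s ∈ I, Integrable (fun y => f y s) μ)
    (hdom : ∀ K ⊆ I, IsCompact K → ∃ (m : ℝ → ℝ) (b : Y → ℝ), IntegrableOn m K ∧
      Integrable b μ ∧ ∀ y, ∀ᵐ s, s ∈ K → ‖deriv (f y) s‖ ≤ m s * b y) :
    IsAC (fun s => ∫ y, f y s ∂μ) I ∧ ∀ᵐ s, s ∈ I → Integrable (fun y => deriv (f y) s) μ ∧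
      HasDerivAt (fun s => ∫ y, f y s ∂μ) (∫ y, deriv (f y) s ∂μ) s := by
  have hprod : ∀ c ∈ I, ∀ d ∈ I, Integrable (Function.uncurry fun y s => deriv (f y) s)
      (μ.prod (volume.restrict (Icc c d))) := fun c hc d hd =>
    let ⟨_, _, hmK, hb, hbd⟩ := hdom _ (hI'.out hc hd) isCompact_Icc
    integrable_uncurry_deriv hI hI' hm hAC isCompact_Icc (hI'.out hc hd) hmK hb hbd
  have hloc : LocallyIntegrableOn (fun s => ∫ y, deriv (f y) s ∂μ) I :=
    locallyIntegrableOn_of_forall_Icc hI fun c hc d hd => (hprod c hc d hd).integral_prod_right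
  have hftc : ∀ c ∈ I, ∀ d ∈ I,
      ∫ y, f y d ∂μ - ∫ y, f y c ∂μ = ∫ s in c..d, ∫ y, deriv (f y) s ∂μ := fun _ hc _ hd =>
    integral_sub_integral_eq_integral_integral_deriv hI hI' hAC hint hprod hc hd
  have hslice : ∀ᵐ s, s ∈ I → Integrable (fun y => deriv (f y) s) μ :=
    ae_of_forall_Icc hI fun c hc d hd =>
      (ae_restrict_iff' measurableSet_Icc).1 (hprod c hc d hd).prod_left_ae
  refine ⟨⟨_, hloc, hftc⟩, ?_⟩
  filter_upwards [hslice, ae_hasDerivAt_of_sub_eq_integral hI hI' hloc hftc] with s h₁ h₂ hs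
    using ⟨h₁ hs, h₂ hs⟩

end ParametricIntegral

section Elementary

lemma exists_mul_rpow_le {p : ℝ} (hp : p ∈ Ioo (0 : ℝ) 2) {B δ : ℝ} (hB : 0 ≤ B) (hδ : 0 < δ) :
    ∃ C : ℝ, ∀ r : ℝ, 0 ≤ r → B * r ^ p ≤ δ * r ^ 2 + C := by
  have hconj : (2 / p).HolderConjugate (2 / p).conjExponent :=
    .conjExponent ((one_lt_div hp.1).2 hp.2)
  set K : ℝ := B * (√δ ^ p)⁻¹
  refine ⟨K ^ (2 / p).conjExponent / (2 / p).conjExponent, fun r hr => ?_⟩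
  have hpow : ((√δ * r) ^ p) ^ (2 / p) = δ * r ^ 2 := by
    rw [← Real.rpow_mul (by positivity), mul_div_cancel₀ _ hp.1.ne', Real.rpow_two, mul_pow,
      Real.sq_sqrt hδ.le]
  calc B * r ^ p = (√δ * r) ^ p * K := by
        rw [Real.mul_rpow (Real.sqrt_nonneg δ) hr]
        have : √δ ^ p ≠ 0 := by positivity
        simp only [K]
        field_simp
    _ ≤ ((√δ * r) ^ p) ^ (2 / p) / (2 / p) + K ^ (2 / p).conjExponent / (2 / p).conjExponent :=
        Real.young_inequality_of_nonneg (by positivity) (by positivity) hconj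
    _ ≤ δ * r ^ 2 + K ^ (2 / p).conjExponent / (2 / p).conjExponent := by
        rw [hpow]
        exact add_le_add_left (div_le_self (by positivity) hconj.lt.le) _

lemma exists_exp_mul_rpow_le {p : ℝ} (hp : p ∈ Ioo (0 : ℝ) 2) (B : ℝ) {δ : ℝ} (hδ : 0 < δ) :
    ∃ C : ℝ, 0 < C ∧ ∀ b ≤ B, ∀ r : ℝ, 0 ≤ r → Real.exp (b * r ^ p) ≤ C * Real.exp (δ * r ^ 2) := by
  obtain ⟨C, hC⟩ := exists_mul_rpow_le hp (abs_nonneg B) hδ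
  refine ⟨Real.exp C, Real.exp_pos C, fun b hb r hr => ?_⟩
  rw [← Real.exp_add, Real.exp_le_exp, add_comm C]
  exact (mul_le_mul_of_nonneg_right (hb.trans (le_abs_self B)) (by positivity)).trans (hC r hr)

lemma gaussian_exponent_le {c : ℝ} (hc : 0 < c) (L s r : ℝ) :
    -c * r ^ 2 + L * |r| + c / 8 * (|s| + |r|) ^ 2
      ≤ (L ^ 2 / c + c / 4 * s ^ 2) + -(c / 2) * r ^ 2 := by
  have hsq : (|s| + |r|) ^ 2 ≤ 2 * (s ^ 2 + r ^ 2) := by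
    simpa only [sq_abs] using add_sq_le (a := |s|) (b := |r|)
  have hcomplete : L * |r| ≤ c / 4 * r ^ 2 + L ^ 2 / c := by
    have : 0 ≤ (c / 2 * |r| - L) ^ 2 / c := by positivity
    have : (c / 2 * |r| - L) ^ 2 / c = c / 4 * r ^ 2 + L ^ 2 / c - L * |r| := by
      rw [← sq_abs r]
      field_simp
      ring
    linarith
  linarith [mul_le_mul_of_nonneg_left hsq (by positivity : 0 ≤ c / 8)]

end Elementary

section Sector

/-- The right half of the double sector, described by linear inequalities. -/
def rightSector (α : ℝ) : Set ℂ :=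
  {z | z ≠ 0 ∧ 0 ≤ z.im ∧ z.im * Real.cos α ≤ z.re * Real.sin α}

/-- The interior of the right half of the double sector. -/
def openRightSector (α : ℝ) : Set ℂ :=
  {z | 0 < z.im ∧ z.im * Real.cos α < z.re * Real.sin α}

/-- The point with parameter `r` on the line through `s` of direction `e^{iθ}`. -/
noncomputable def ray (s θ r : ℝ) : ℂ := s + r * Complex.exp (θ * Complex.I)

variable {α : ℝ} {z : ℂ}

lemma rightSector_subset_doubleSector (hα : 0 < α) : rightSector α ⊆ doubleSector α := by
  rintro z ⟨hz0, him, hre⟩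
  have hn : 0 < ‖z‖ := norm_pos_iff.2 hz0
  refine ⟨hz0, z.arg, Or.inl ⟨Complex.arg_nonneg_iff.2 him, ?_⟩,
    (Complex.norm_mul_exp_arg_mul_I z).symm⟩
  by_contra! hlt
  have hsin : 0 < Real.sin (z.arg - α) :=
    Real.sin_pos_of_pos_of_lt_pi (by linarith) (by linarith [Complex.arg_le_pi z])
  rw [Real.sin_sub, Complex.sin_arg, Complex.cos_arg hz0, div_mul_eq_mul_div,
    div_mul_eq_mul_div, ← sub_div, div_pos_iff_of_pos_right hn] at hsin
  linarith

lemma neg_mem_doubleSector (hz : z ∈ doubleSector α) : -z ∈ doubleSector α := by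
  obtain ⟨hz0, θ, hθ | hθ, hpol⟩ := hz
  · refine ⟨neg_ne_zero.2 hz0, θ + Real.pi, Or.inr ⟨by linarith [hθ.1], by linarith [hθ.2]⟩, ?_⟩
    rw [norm_neg, Complex.ofReal_add, add_mul, Complex.exp_add, Complex.exp_pi_mul_I]
    linear_combination -hpol
  · refine ⟨neg_ne_zero.2 hz0, θ - Real.pi, Or.inl ⟨by linarith [hθ.1], by linarith [hθ.2]⟩, ?_⟩
    rw [norm_neg, Complex.ofReal_sub, sub_mul, Complex.exp_sub, Complex.exp_pi_mul_I]
    linear_combination -hpol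

lemma neg_mem_interior_doubleSector (hz : z ∈ interior (doubleSector α)) :
    -z ∈ interior (doubleSector α) := by
  have hsub : doubleSector α ⊆ Neg.neg ⁻¹' doubleSector α := fun _ => neg_mem_doubleSector
  exact ((Homeomorph.neg ℂ).preimage_interior (doubleSector α)).ge (interior_mono hsub hz)

lemma isOpen_openRightSector : IsOpen (openRightSector α) :=
  (isOpen_lt continuous_const Complex.continuous_im).inter
    (isOpen_lt (Complex.continuous_im.mul_const _) (Complex.continuous_re.mul_const _))

lemma openRightSector_subset_rightSector : openRightSector α ⊆ rightSector α := fun z hz =>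
  ⟨fun h => by simp [h, openRightSector] at hz, hz.1.le, hz.2.le⟩

lemma openRightSector_subset_interior_doubleSector (hα : 0 < α) :
    openRightSector α ⊆ interior (doubleSector α) :=
  interior_maximal (openRightSector_subset_rightSector.trans (rightSector_subset_doubleSector hα))
    isOpen_openRightSector

lemma continuous_ray (s θ : ℝ) : Continuous (ray s θ) := by
  unfold ray
  fun_prop

lemma ray_re (s θ r : ℝ) : (ray s θ r).re = s + r * Real.cos θ := by
  simp [ray, Complex.exp_re, Complex.exp_im]

lemma ray_im (s θ r : ℝ) : (ray s θ r).im = r * Real.sin θ := by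
  simp [ray, Complex.exp_re, Complex.exp_im]

lemma norm_ray_le (s θ r : ℝ) : ‖ray s θ r‖ ≤ |s| + |r| := by
  refine (norm_add_le _ _).trans_eq ?_
  rw [norm_mul, Complex.norm_exp_ofReal_mul_I, mul_one, Complex.norm_real, Complex.norm_real,
    Real.norm_eq_abs, Real.norm_eq_abs]

lemma exp_eq_ray (w : ℂ) : Complex.exp w = ray 0 w.im (Real.exp w.re) := by
  rw [ray, Complex.ofReal_zero, zero_add, Complex.ofReal_exp, ← Complex.exp_add, Complex.re_add_im]

lemma ray_neg (s θ r : ℝ) : ray (-s) θ (-r) = -ray s θ r := by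
  simp only [ray, Complex.ofReal_neg]
  ring

lemma sq_ray_re (s θ r : ℝ) : (ray s θ r ^ 2).re
    = s ^ 2 + 2 * (s * r) * Real.cos θ + r ^ 2 * Real.cos (2 * θ) := by
  rw [sq, Complex.mul_re, ray_re, ray_im, Real.cos_two_mul]
  linear_combination -r ^ 2 * Real.sin_sq_add_cos_sq θ

lemma sq_ray_sub_im (s θ r ξ : ℝ) : ((ray s θ r - ξ) ^ 2).im
    = 2 * (s - ξ) * r * Real.sin θ + r ^ 2 * Real.sin (2 * θ) := by
  rw [sq, Complex.mul_im, Complex.sub_re, Complex.sub_im, ray_re, ray_im, Complex.ofReal_re,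
    Complex.ofReal_im, Real.sin_two_mul]
  ring

lemma ray_mem_rightSector (hα : α ∈ Ioo 0 (Real.pi / 2)) {s r θ : ℝ} (hs : 0 ≤ s) (hr : 0 < r)
    (hθ : θ ∈ Icc 0 α) : ray s θ r ∈ rightSector α := by
  have hπ := Real.pi_pos
  have hcos : 0 < Real.cos θ :=
    Real.cos_pos_of_mem_Ioo ⟨by linarith [hθ.1], by linarith [hθ.2, hα.2]⟩
  have hsin : 0 ≤ Real.sin θ :=
    Real.sin_nonneg_of_nonneg_of_le_pi hθ.1 (by linarith [hθ.2, hα.2])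
  have hsinα : 0 ≤ Real.sin α := Real.sin_nonneg_of_nonneg_of_le_pi hα.1.le (by linarith [hα.2])
  have hsub : 0 ≤ Real.sin (α - θ) :=
    Real.sin_nonneg_of_nonneg_of_le_pi (by linarith [hθ.2]) (by linarith [hθ.1, hα.2])
  rw [Real.sin_sub] at hsub
  refine ⟨fun h => ?_, ?_, ?_⟩
  · have hre := ray_re s θ r
    rw [h, Complex.zero_re] at hre
    linarith [mul_pos hr hcos]
  · rw [ray_im]
    positivity
  · rw [ray_im, ray_re]
    linarith [mul_nonneg hr.le hsub, mul_nonneg hs hsinα]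

lemma ray_mem_openRightSector (hα : α ∈ Ioo 0 (Real.pi / 2)) {s r θ : ℝ} (hs : 0 ≤ s)
    (hr : 0 < r) (hθ : θ ∈ Ioo 0 α) : ray s θ r ∈ openRightSector α := by
  have hπ := Real.pi_pos
  have hsin : 0 < Real.sin θ := Real.sin_pos_of_pos_of_lt_pi hθ.1 (by linarith [hθ.2, hα.2])
  have hsinα : 0 ≤ Real.sin α := Real.sin_nonneg_of_nonneg_of_le_pi hα.1.le (by linarith [hα.2])
  have hsub : 0 < Real.sin (α - θ) :=
    Real.sin_pos_of_pos_of_lt_pi (by linarith [hθ.2]) (by linarith [hθ.1, hα.2])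
  rw [Real.sin_sub] at hsub
  constructor
  · rw [ray_im]
    positivity
  · rw [ray_im, ray_re]
    linarith [mul_pos hr hsub, mul_nonneg hs hsinα]

end Sector

section Rotation

lemma integral_eq_integral_add_mul_I {H : ℂ → ℂ} {β : ℝ} (hβ : 0 < β)
    (hcont : ContinuousOn H {w | w.im ∈ Icc 0 β})
    (hdiff : ∀ w : ℂ, w.im ∈ Ioo 0 β → DifferentiableAt ℂ H w)
    (hint₀ : Integrable fun u : ℝ => H u) (hintβ : Integrable fun u : ℝ => H (u + β * Complex.I))
    {m : ℝ → ℝ} (hm : ∀ u : ℝ, ∀ θ ∈ Icc 0 β, ‖H (u + θ * Complex.I)‖ ≤ m u)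
    (htop : Tendsto m atTop (𝓝 0)) (hbot : Tendsto m atBot (𝓝 0)) :
    ∫ u : ℝ, H u = ∫ u : ℝ, H (u + β * Complex.I) := by
  have hrect : ∀ R : ℝ, (∫ u in (-R)..R, H u) - (∫ u in (-R)..R, H (u + β * Complex.I))
      + Complex.I • (∫ θ in (0 : ℝ)..β, H (R + θ * Complex.I))
      - Complex.I • (∫ θ in (0 : ℝ)..β, H ((-R : ℝ) + θ * Complex.I)) = 0 := fun R => by
    have := Complex.integral_boundary_rect_eq_zero_of_continuousOn_of_differentiableOn H
      ⟨-R, 0⟩ ⟨R, β⟩ (hcont.mono fun w hw => ?_) fun w hw => (hdiff w ?_).differentiableWithinAt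
    · simpa using this
    · simpa [uIcc_of_le hβ.le] using (Complex.mem_reProdIm.1 hw).2
    · simpa [min_eq_left hβ.le, max_eq_right hβ.le] using (Complex.mem_reProdIm.1 hw).2
  have hside : ∀ u : ℝ, ‖∫ θ in (0 : ℝ)..β, H (u + θ * Complex.I)‖ ≤ m u * |β - 0| := fun u =>
    intervalIntegral.norm_integral_le_of_norm_le_const fun θ hθ =>
      hm u θ (Ioc_subset_Icc_self (uIoc_of_le hβ.le ▸ hθ))
  have hright : Tendsto (fun R : ℝ => ∫ θ in (0 : ℝ)..β, H (R + θ * Complex.I)) atTop (𝓝 0) :=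
    squeeze_zero_norm hside (by simpa using htop.mul_const |β - 0|)
  have hleft : Tendsto (fun R : ℝ => ∫ θ in (0 : ℝ)..β, H ((-R : ℝ) + θ * Complex.I)) atTop (𝓝 0) :=
    squeeze_zero_norm (fun R => hside (-R))
      (by simpa using (hbot.comp tendsto_neg_atTop_atBot).mul_const |β - 0|)
  have hlim := (((intervalIntegral_tendsto_integral hint₀ tendsto_neg_atTop_atBot tendsto_id).sub
    (intervalIntegral_tendsto_integral hintβ tendsto_neg_atTop_atBot tendsto_id)).add
    (hright.const_smul Complex.I)).sub (hleft.const_smul Complex.I)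
  have hzero := tendsto_nhds_unique hlim (tendsto_const_nhds.congr fun R => (hrect R).symm)
  rwa [smul_zero, add_zero, sub_zero, sub_eq_zero] at hzero

variable {E : Type*} [NormedAddCommGroup E]

lemma integrableOn_Ioi_of_norm_le_gaussian {g : ℝ → E} (hg : ContinuousOn g (Ioi 0)) {C c : ℝ}
    (hc : 0 < c) (hb : ∀ r : ℝ, 0 < r → ‖g r‖ ≤ C * Real.exp (-c * r ^ 2)) :
    IntegrableOn g (Ioi 0) :=
  ((integrable_exp_neg_mul_sq hc).const_mul C).integrableOn.mono'
    (hg.aestronglyMeasurable measurableSet_Ioi) (ae_restrict_of_forall_mem measurableSet_Ioi hb)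

variable [NormedSpace ℝ E]

lemma integrable_exp_smul_comp_exp_iff {g : ℝ → E} :
    Integrable (fun u => Real.exp u • g (Real.exp u)) ↔ IntegrableOn g (Ioi 0) := by
  rw [← Real.range_exp, ← image_univ, integrableOn_image_iff_integrableOn_abs_deriv_smul
    MeasurableSet.univ (fun x _ => (Real.hasDerivAt_exp x).hasDerivWithinAt)
    Real.exp_injective.injOn, integrableOn_univ]
  simp only [Real.abs_exp]

lemma integral_exp_smul_comp_exp (g : ℝ → E) :
    ∫ u, Real.exp u • g (Real.exp u) = ∫ r in Ioi 0, g r := by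
  rw [← Real.range_exp, ← image_univ, integral_image_eq_integral_abs_deriv_smul
    MeasurableSet.univ (fun x _ => (Real.hasDerivAt_exp x).hasDerivWithinAt)
    Real.exp_injective.injOn, setIntegral_univ]
  simp only [Real.abs_exp]

lemma tendsto_mul_exp_neg_mul_sq_atTop {c : ℝ} (hc : 0 < c) :
    Tendsto (fun r : ℝ => r * Real.exp (-c * r ^ 2)) atTop (𝓝 0) := by
  refine ((tendsto_rpow_abs_mul_exp_neg_mul_sq_cocompact hc 1).mono_left
    atTop_le_cocompact).congr' ?_
  filter_upwards [eventually_ge_atTop 0] with r hr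
  rw [Real.rpow_one, abs_of_nonneg hr]

theorem integral_Ioi_eq_integral_rotated {h : ℂ → ℂ} {β : ℝ} (hβ : 0 < β)
    (hcont : ContinuousOn h (image2 (ray 0) (Icc 0 β) (Ioi 0)))
    (hdiff : ∀ θ ∈ Ioo 0 β, ∀ r : ℝ, 0 < r → DifferentiableAt ℂ h (ray 0 θ r)) {C c : ℝ}
    (hc : 0 < c)
    (hb : ∀ θ ∈ Icc 0 β, ∀ r : ℝ, 0 < r → ‖h (ray 0 θ r)‖ ≤ C * Real.exp (-c * r ^ 2)) :
    ∫ r in Ioi (0 : ℝ), h r = ∫ r in Ioi (0 : ℝ), Complex.exp (β * Complex.I) * h (ray 0 β r) := by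
  let g : ℝ → ℝ → ℂ := fun θ r => Complex.exp (θ * Complex.I) * h (ray 0 θ r)
  have hg : ∀ θ ∈ Icc 0 β, ∀ r : ℝ, 0 < r → ‖g θ r‖ ≤ C * Real.exp (-c * r ^ 2) :=
    fun θ hθ r hr => by
      rw [norm_mul, Complex.norm_exp_ofReal_mul_I, one_mul]
      exact hb θ hθ r hr
  -- In logarithmic coordinates the rotation is a shift of the horizontal line of integration.
  let H : ℂ → ℂ := fun w => Complex.exp w * h (Complex.exp w)
  have hH : ∀ u θ : ℝ, H (u + θ * Complex.I) = Real.exp u • g θ (Real.exp u) := fun u θ => by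
    have hray : Complex.exp (u + θ * Complex.I) = ray 0 θ (Real.exp u) := by
      simpa using exp_eq_ray (u + θ * Complex.I)
    simp only [H, g, hray, Complex.real_smul]
    simp only [ray, Complex.ofReal_zero, zero_add, mul_assoc]
  have hH₀ : ∀ u : ℝ, H u = Real.exp u • g 0 (Real.exp u) := fun u => by simpa using hH u 0
  have hint : ∀ θ ∈ Icc 0 β, Integrable fun u : ℝ => Real.exp u • g θ (Real.exp u) := fun θ hθ =>
    integrable_exp_smul_comp_exp_iff.2 (integrableOn_Ioi_of_norm_le_gaussian
      (continuousOn_const.mul (hcont.comp (continuous_ray 0 θ).continuousOn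
        fun r hr => mem_image2_of_mem hθ hr)) hc (hg θ hθ))
  have hm : ∀ u : ℝ, ∀ θ ∈ Icc 0 β, ‖H (u + θ * Complex.I)‖
      ≤ Real.exp u * Real.exp (-c * Real.exp u ^ 2) * C := fun u θ hθ => by
    rw [hH, norm_smul, Real.norm_eq_abs, Real.abs_exp, mul_assoc, mul_comm _ C]
    exact mul_le_mul_of_nonneg_left (hg θ hθ _ (Real.exp_pos u)) (Real.exp_pos u).le
  have hzero : Tendsto (fun r : ℝ => r * Real.exp (-c * r ^ 2)) (𝓝 0) (𝓝 0) :=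
    Continuous.tendsto' (by fun_prop) 0 0 (by simp)
  have hstrip : ∫ u : ℝ, H u = ∫ u : ℝ, H (u + β * Complex.I) := by
    refine integral_eq_integral_add_mul_I hβ ?_ (fun w hw => ?_) ?_ ?_ hm
      (by simpa using ((tendsto_mul_exp_neg_mul_sq_atTop hc).comp
        Real.tendsto_exp_atTop).mul_const C)
      (by simpa using (hzero.comp Real.tendsto_exp_atBot).mul_const C)
    · exact Complex.continuous_exp.continuousOn.mul
        (hcont.comp Complex.continuous_exp.continuousOn fun w hw =>
          ⟨_, hw, _, Real.exp_pos _, (exp_eq_ray w).symm⟩)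
    · have hw' := hdiff w.im hw _ (Real.exp_pos w.re)
      rw [← exp_eq_ray] at hw'
      exact Complex.differentiableAt_exp.mul (hw'.comp w Complex.differentiableAt_exp)
    · simpa only [hH₀] using hint 0 (left_mem_Icc.2 hβ.le)
    · simpa only [hH] using hint β (right_mem_Icc.2 hβ.le)
  simp only [hH₀, hH, integral_exp_smul_comp_exp] at hstrip
  simpa [g, ray] using hstrip

end Rotation

section Phase

lemma norm_exp_neg_mul_sq (ε : ℝ) (z : ℂ) :
    ‖Complex.exp (-(ε : ℂ) * z ^ 2)‖ = Real.exp (-ε * (z ^ 2).re) := by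
  rw [Complex.norm_exp, ← Complex.ofReal_neg, Complex.re_ofReal_mul]

lemma norm_exp_I_mul_sq (a : ℝ) (w : ℂ) :
    ‖Complex.exp (Complex.I * (a : ℂ) * w ^ 2)‖ = Real.exp (-a * (w ^ 2).im) := by
  rw [Complex.norm_exp, mul_assoc, Complex.I_mul_re, Complex.im_ofReal_mul, neg_mul]

lemma phase_exponent_ray_le {s θ r ξ ε a c : ℝ} (hs : 0 ≤ ε * (s * r) * Real.cos θ)
    (hε : 0 ≤ ε * s ^ 2) (ha : 0 ≤ a) (hc : c ≤ ε * Real.cos (2 * θ) + a * Real.sin (2 * θ)) :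
    -ε * (ray s θ r ^ 2).re + -a * ((ray s θ r - ξ) ^ 2).im
      ≤ -c * r ^ 2 + 2 * a * |s - ξ| * |r| := by
  have hlin : -(a * ((s - ξ) * r * Real.sin θ)) ≤ a * (|s - ξ| * |r|) := by
    rw [← mul_neg]
    refine mul_le_mul_of_nonneg_left ((neg_le_abs _).trans ?_) ha
    rw [abs_mul, abs_mul]
    exact mul_le_of_le_one_right (by positivity) (Real.abs_sin_le_one θ)
  rw [sq_ray_re, sq_ray_sub_im]
  linarith [mul_le_mul_of_nonneg_right hc (sq_nonneg r)]

end Phase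

section SectorGaussian

/-- Functions on the right half of the double sector that grow at most like the Gaussian
`e^{ia(z-ξ)²}`, up to a factor `e^{δ|z|²}` with arbitrarily small `δ > 0`. These are the integrands
to which the rotation of the half-line applies. -/
structure SectorGaussian (α : ℝ) (f : ℂ → ℂ) (a ξ : ℝ) : Prop where
  continuousOn : ContinuousOn f (rightSector α)
  differentiableOn : DifferentiableOn ℂ f (openRightSector α)
  bound : ∀ δ > 0, ∃ C : ℝ, ∀ z ∈ rightSector α,
    ‖f z‖ ≤ C * Real.exp (-a * ((z - ξ) ^ 2).im + δ * ‖z‖ ^ 2)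

/-- The contour integral of `f` along the ray from `s` in the direction `e^{iθ}`. -/
noncomputable def rayIntegral (f : ℂ → ℂ) (s θ : ℝ) : ℂ :=
  ∫ r in Ioi (0 : ℝ), Complex.exp (θ * Complex.I) * f (ray s θ r)

variable {α a ξ s c : ℝ} {f : ℂ → ℂ}

lemma rayIntegral_zero_angle (f : ℂ → ℂ) (s : ℝ) :
    rayIntegral f s 0 = ∫ r in Ioi (0 : ℝ), f ((s : ℂ) + r) := by
  simp [rayIntegral, ray]

lemma SectorGaussian.exists_norm_le (hf : SectorGaussian α f a ξ)
    (hα : α ∈ Ioo 0 (Real.pi / 2)) (ha : 0 ≤ a) (hs : 0 ≤ s) (hc : 0 < c) :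
    ∃ C : ℝ, ∀ ε θ r : ℝ, 0 ≤ ε → θ ∈ Icc 0 (α / 2) → 0 < r →
      c ≤ ε * Real.cos (2 * θ) + a * Real.sin (2 * θ) →
      ‖Complex.exp (-(ε : ℂ) * ray s θ r ^ 2) * f (ray s θ r)‖
        ≤ C * Real.exp (-(c / 2) * r ^ 2) := by
  obtain ⟨C, hC⟩ := hf.bound (c / 8) (by positivity)
  refine ⟨C * Real.exp ((2 * a * |s - ξ|) ^ 2 / c + c / 4 * s ^ 2), fun ε θ r hε hθ hr hrate => ?_⟩
  have hz := hC _ (ray_mem_rightSector hα hs hr ⟨hθ.1, hθ.2.trans (half_le_self hα.1.le)⟩)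
  have hC0 : 0 ≤ C := nonneg_of_mul_nonneg_left ((norm_nonneg _).trans hz) (Real.exp_pos _)
  have hcos : 0 ≤ Real.cos θ := Real.cos_nonneg_of_mem_Icc
    ⟨by linarith [hθ.1, Real.pi_pos], by linarith [hθ.2, hα.1, hα.2]⟩
  have hphase := phase_exponent_ray_le (ξ := ξ) (s := s) (r := r) (by positivity) (by positivity)
    ha hrate
  have hnorm : c / 8 * ‖ray s θ r‖ ^ 2 ≤ c / 8 * (|s| + |r|) ^ 2 := by
    gcongr
    exact norm_ray_le s θ r
  rw [norm_mul, norm_exp_neg_mul_sq, mul_assoc, ← Real.exp_add]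
  refine (mul_le_mul_of_nonneg_left hz (Real.exp_pos _).le).trans ?_
  rw [mul_left_comm, ← Real.exp_add]
  refine mul_le_mul_of_nonneg_left (Real.exp_le_exp.2 ?_) hC0
  linarith [gaussian_exponent_le hc (2 * a * |s - ξ|) s r]

lemma SectorGaussian.rayIntegral_eq (hf : SectorGaussian α f a ξ)
    (hα : α ∈ Ioo 0 (Real.pi / 2)) (ha : 0 ≤ a) (hs : 0 ≤ s) {ε : ℝ} (hε : 0 < ε) :
    rayIntegral (fun z => Complex.exp (-(ε : ℂ) * z ^ 2) * f z) s 0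
      = rayIntegral (fun z => Complex.exp (-(ε : ℂ) * z ^ 2) * f z) s (α / 2) := by
  have hcos : 0 < Real.cos α := Real.cos_pos_of_mem_Ioo ⟨by linarith [hα.1, Real.pi_pos], hα.2⟩
  have hrate : 0 < ε * Real.cos α := by positivity
  have hshift : ∀ θ r : ℝ, (s : ℂ) + ray 0 θ r = ray s θ r := fun θ r => by simp [ray]
  obtain ⟨C, hC⟩ := hf.exists_norm_le hα ha hs hrate
  have hrot := integral_Ioi_eq_integral_rotated (half_pos hα.1)
    (h := fun w => Complex.exp (-(ε : ℂ) * ((s : ℂ) + w) ^ 2) * f ((s : ℂ) + w)) ?_ ?_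
    (half_pos hrate) (C := C) ?_
  · rw [rayIntegral_zero_angle, rayIntegral]
    simpa only [hshift] using hrot
  · refine ContinuousOn.mul (by fun_prop) (hf.continuousOn.comp (by fun_prop) ?_)
    rintro _ ⟨θ, hθ, r, hr, rfl⟩
    rw [hshift]
    exact ray_mem_rightSector hα hs hr ⟨hθ.1, hθ.2.trans (half_le_self hα.1.le)⟩
  · intro θ hθ r hr
    have hmem := ray_mem_openRightSector hα hs hr ⟨hθ.1, hθ.2.trans (half_lt_self hα.1)⟩
    rw [← hshift] at hmem
    exact DifferentiableAt.mul (by fun_prop) <|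
      (hf.differentiableOn.differentiableAt (isOpen_openRightSector.mem_nhds hmem)).comp
        (ray 0 θ r) (by fun_prop)
  · intro θ hθ r hr
    have hle : Real.cos α ≤ Real.cos (2 * θ) := Real.cos_le_cos_of_nonneg_of_le_pi
      (by linarith [hθ.1]) (by linarith [hα.2, Real.pi_pos]) (by linarith [hθ.2])
    have hsin : 0 ≤ Real.sin (2 * θ) := Real.sin_nonneg_of_nonneg_of_le_pi (by linarith [hθ.1])
      (by linarith [hα.2, Real.pi_pos, hθ.2])
    simp only [hshift]
    exact hC ε θ r hε.le hθ hr
      (le_add_of_le_of_nonneg (mul_le_mul_of_nonneg_left hle hε.le) (mul_nonneg ha hsin))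

lemma SectorGaussian.tendsto_rayIntegral (hf : SectorGaussian α f a ξ)
    (hα : α ∈ Ioo 0 (Real.pi / 2)) (ha : 0 < a) (hs : 0 ≤ s) :
    Tendsto (fun ε : ℝ => rayIntegral (fun z => Complex.exp (-(ε : ℂ) * z ^ 2) * f z) s 0) (𝓝[>] 0)
      (𝓝 (rayIntegral f s (α / 2))) := by
  have hsin : 0 < Real.sin α :=
    Real.sin_pos_of_pos_of_lt_pi hα.1 (by linarith [hα.2, Real.pi_pos])
  have hcos : 0 < Real.cos α := Real.cos_pos_of_mem_Ioo ⟨by linarith [hα.1, Real.pi_pos], hα.2⟩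
  have hrate : 0 < a * Real.sin α := by positivity
  obtain ⟨C, hC⟩ := hf.exists_norm_le hα ha.le hs hrate
  have hpos : ∀ᶠ ε : ℝ in 𝓝[>] 0, 0 < ε := self_mem_nhdsWithin
  refine (tendsto_congr' (hpos.mono fun ε hε =>
    hf.rayIntegral_eq hα ha.le hs hε)).2 ?_
  have hcont : ContinuousOn (fun r => f (ray s (α / 2) r)) (Ioi 0) :=
    hf.continuousOn.comp (continuous_ray s _).continuousOn fun r hr =>
      ray_mem_rightSector hα hs hr ⟨(half_pos hα.1).le, half_le_self hα.1.le⟩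
  refine tendsto_integral_filter_of_dominated_convergence
    (fun r => C * Real.exp (-(a * Real.sin α / 2) * r ^ 2)) ?_ ?_
    ((integrable_exp_neg_mul_sq (half_pos hrate)).const_mul C).integrableOn ?_
  · have := continuous_ray s (α / 2)
    exact Eventually.of_forall fun ε => ContinuousOn.aestronglyMeasurable
      (continuousOn_const.mul (ContinuousOn.mul (by fun_prop) hcont)) measurableSet_Ioi
  · filter_upwards [hpos] with ε hε
    refine ae_restrict_of_forall_mem measurableSet_Ioi fun r hr => ?_
    rw [norm_mul, Complex.norm_exp_ofReal_mul_I, one_mul]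
    refine hC ε (α / 2) r hε.le ⟨(half_pos hα.1).le, le_rfl⟩ hr ?_
    rw [mul_div_cancel₀ _ two_ne_zero]
    exact le_add_of_nonneg_left (by positivity)
  · refine Eventually.of_forall fun r => Tendsto.const_mul _ ?_
    refine Tendsto.mono_left ?_ nhdsWithin_le_nhds
    refine Continuous.tendsto' (by fun_prop) _ _ ?_
    simp

end SectorGaussian

section EntireFunctions

/-- The entire functions of order two and minimal type, i.e. those bounded by every Gaussian
`e^{δ|z|²}` with `δ > 0`. They comprise the spaces `𝒜_q(ℂ)` for `q < 2`. -/
structure IsEntireOfMinimalType (F : ℂ → ℂ) : Prop where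
  differentiable : Differentiable ℂ F
  bound : ∀ δ > 0, ∃ C : ℝ, ∀ z, ‖F z‖ ≤ C * Real.exp (δ * ‖z‖ ^ 2)

/-- Convergence in the norms `sup_z |F(z)| e^{-δ|z|²}`, for all `δ > 0`, of the space of entire
functions of order two and minimal type. -/
def ConvergesMinimalType (Fn : ℕ → ℂ → ℂ) (F : ℂ → ℂ) : Prop :=
  ∀ δ > 0, ∀ η > 0, ∀ᶠ n in atTop, ∀ z, ‖Fn n z - F z‖ ≤ η * Real.exp (δ * ‖z‖ ^ 2)

variable {q : ℝ} {F : ℂ → ℂ}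

lemma isEntireOfMinimalType_of_mem_expGrowth (hq : q ∈ Ioo (0 : ℝ) 2) (hF : F ∈ expGrowth q) :
    IsEntireOfMinimalType F := by
  obtain ⟨hd, A, B, hA, -, hb⟩ := hF
  refine ⟨hd, fun δ hδ => ?_⟩
  obtain ⟨C, -, hC⟩ := exists_exp_mul_rpow_le hq B hδ
  refine ⟨A * C, fun z => (hb z).trans ?_⟩
  rw [mul_assoc]
  exact mul_le_mul_of_nonneg_left (hC B le_rfl _ (norm_nonneg z)) hA

lemma ConvergesExpGrowth.convergesMinimalType (hq : q ∈ Ioo (0 : ℝ) 2) {Fn : ℕ → ℂ → ℂ}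
    (h : ConvergesExpGrowth q Fn F) : ConvergesMinimalType Fn F := by
  obtain ⟨B, -, hlim⟩ := h
  intro δ hδ η hη
  obtain ⟨C, hC0, hC⟩ := exists_exp_mul_rpow_le hq B hδ
  filter_upwards [hlim.eventually_lt_const (ENNReal.ofReal_pos.2 (div_pos hη hC0))] with n hn z
  have hweighted : ‖Fn n z - F z‖ * Real.exp (-B * ‖z‖ ^ q) < η / C :=
    (ENNReal.ofReal_lt_ofReal_iff (div_pos hη hC0)).1
      ((le_iSup (fun z => ENNReal.ofReal (‖Fn n z - F z‖ * Real.exp (-B * ‖z‖ ^ q))) z).trans_lt hn)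
  rw [neg_mul, Real.exp_neg, ← div_eq_mul_inv, div_lt_iff₀ (Real.exp_pos _)] at hweighted
  calc ‖Fn n z - F z‖ ≤ η / C * Real.exp (B * ‖z‖ ^ q) := hweighted.le
    _ ≤ η / C * (C * Real.exp (δ * ‖z‖ ^ 2)) := by
        gcongr
        exact hC B le_rfl _ (norm_nonneg z)
    _ = η * Real.exp (δ * ‖z‖ ^ 2) := by
        field_simp

end EntireFunctions

section Domains

lemma isOpen_timeInterval (T : EReal) : IsOpen (timeInterval T) :=
  (isOpen_lt continuous_const continuous_id).inter
    (isOpen_lt continuous_coe_real_ereal continuous_const)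

lemma ordConnected_timeInterval (T : EReal) : (timeInterval T).OrdConnected :=
  ⟨fun _ hs _ ht _ hr => ⟨hs.1.trans_le hr.1, lt_of_le_of_lt (EReal.coe_le_coe_iff.2 hr.2) ht.2⟩⟩

lemma eventually_mem_timeInterval {T : EReal} (hT : 0 < T) :
    ∀ᶠ t : ℝ in 𝓝[>] 0, t ∈ timeInterval T := by
  have hlt : ∀ᶠ t : ℝ in 𝓝 0, (t : EReal) < T :=
    (isOpen_lt continuous_coe_real_ereal continuous_const).mem_nhds (by simpa using hT)
  filter_upwards [self_mem_nhdsWithin, nhdsWithin_le_nhds hlt] with t h0 hlt using ⟨h0, hlt⟩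

lemma isOpen_dotReal : IsOpen dotReal := isOpen_compl_singleton

lemma Iio_subset_dotReal : Iio 0 ⊆ dotReal := fun _ hx => ne_of_lt hx

lemma Ioi_subset_dotReal : Ioi 0 ⊆ dotReal := fun _ hx => ne_of_gt hx

lemma IsACDot.continuousOn {f : ℝ → ℂ} (h : IsACDot f) : ContinuousOn f dotReal := by
  intro x hx
  rcases lt_or_gt_of_ne (show x ≠ 0 from hx) with hx' | hx'
  · exact ((h.1.continuousOn isOpen_Iio ordConnected_Iio).continuousAt
      (isOpen_Iio.mem_nhds hx')).continuousWithinAt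
  · exact ((h.2.continuousOn isOpen_Ioi ordConnected_Ioi).continuousAt
      (isOpen_Ioi.mem_nhds hx')).continuousWithinAt

lemma IsACDot.ae_differentiableAt {f : ℝ → ℂ} (h : IsACDot f) :
    ∀ᵐ x : ℝ, x ∈ dotReal → DifferentiableAt ℝ f x := by
  filter_upwards [h.1.ae_differentiableAt isOpen_Iio ordConnected_Iio,
    h.2.ae_differentiableAt isOpen_Ioi ordConnected_Ioi] with x hneg hpos hx
  rcases lt_or_gt_of_ne (show x ≠ 0 from hx) with hx' | hx'
  exacts [hneg hx', hpos hx']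

end Domains

section Integrand

/-- The weight `e^{iθ} e^{-εz²} F(z)`, `z = e^{iθ} y`, of the integral over the line `e^{iθ} ℝ`.
It is set to `0` at the origin, which does not belong to the double sector. -/
noncomputable def contourWeight (F : ℂ → ℂ) (ε θ y : ℝ) : ℂ :=
  if y = 0 then 0 else Complex.exp (θ * Complex.I) *
    (Complex.exp (-(ε : ℂ) * ray 0 θ y ^ 2) * F (ray 0 θ y))

/-- The integrand `e^{-εz²} G(t,x,z) F(z) dz/dy` on the line `z = e^{iθ} y`. -/
noncomputable def contourIntegrand (Gext : ℝ → ℝ → ℂ → ℂ) (F : ℂ → ℂ) (ε θ t x y : ℝ) : ℂ :=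
  contourWeight F ε θ y * Gext t x (ray 0 θ y)

variable {Gext : ℝ → ℝ → ℂ → ℂ} {F : ℂ → ℂ}

lemma norm_ray_zero (θ y : ℝ) : ‖ray 0 θ y‖ = |y| := by
  simp [ray, Complex.norm_exp_ofReal_mul_I]

lemma ray_zero_angle (s y : ℝ) : ray s 0 y = s + y := by simp [ray]

lemma ray_zero_mem_doubleSector {α θ y : ℝ} (hα : α ∈ Ioo 0 (Real.pi / 2)) (hθ : θ ∈ Icc 0 α)
    (hy : y ≠ 0) : ray 0 θ y ∈ doubleSector α := by
  rcases lt_or_gt_of_ne hy with hy | hy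
  · have hmem := ray_mem_rightSector hα le_rfl (neg_pos.2 hy) hθ
    have hneg : ray 0 θ y = -ray 0 θ (-y) := by
      rw [← ray_neg, neg_zero, neg_neg]
    rw [hneg]
    exact neg_mem_doubleSector (rightSector_subset_doubleSector hα.1 hmem)
  · exact rightSector_subset_doubleSector hα.1 (ray_mem_rightSector hα le_rfl hy hθ)

lemma contourWeight_zero (ε θ : ℝ) : contourWeight F ε θ 0 = 0 := if_pos rfl

lemma contourIntegrand_zero (ε θ t x : ℝ) : contourIntegrand Gext F ε θ t x 0 = 0 := by
  rw [contourIntegrand, contourWeight_zero, zero_mul]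

lemma continuousOn_contourWeight (hF : Continuous F) (ε θ : ℝ) :
    ContinuousOn (contourWeight F ε θ) {0}ᶜ := by
  have hray := continuous_ray 0 θ
  refine ContinuousOn.congr (f := fun y => Complex.exp (θ * Complex.I) *
    (Complex.exp (-(ε : ℂ) * ray 0 θ y ^ 2) * F (ray 0 θ y))) ?_ fun y hy => if_neg hy
  exact Continuous.continuousOn (by fun_prop)

lemma deriv_contourIntegrand (ε θ t x y : ℝ) :
    deriv (fun ξ => contourIntegrand Gext F ε θ t ξ y) x
      = contourWeight F ε θ y * deriv (fun ξ => Gext t ξ (ray 0 θ y)) x :=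
  deriv_const_mul_field _

lemma deriv_deriv_contourIntegrand (ε θ t x y : ℝ) :
    deriv (deriv fun ξ => contourIntegrand Gext F ε θ t ξ y) x
      = contourWeight F ε θ y * deriv (deriv fun ξ => Gext t ξ (ray 0 θ y)) x := by
  rw [show deriv (fun ξ => contourIntegrand Gext F ε θ t ξ y) = _ from
    funext fun x => deriv_contourIntegrand ε θ t x y, deriv_const_mul_field]

lemma deriv_time_contourIntegrand (ε θ t x y : ℝ) :
    deriv (fun τ => contourIntegrand Gext F ε θ τ x y) t
      = contourWeight F ε θ y * deriv (fun τ => Gext τ x (ray 0 θ y)) t :=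
  deriv_const_mul_field _

end Integrand

section GreenDerivatives

variable {T : EReal} {V : ℝ → ℝ → ℂ} {M N : Matrix (Fin 2) (Fin 2) ℂ} {G : ℝ → ℝ → ℝ → ℂ}
  {α : ℝ} {Gext : ℝ → ℝ → ℂ → ℂ} {a : ℝ → ℝ} {Gt : ℝ → ℝ → ℂ → ℂ} {p : ℝ}
  {A B : Fin 3 → ℝ → ℝ → ℝ}

lemma hasDerivAt_exp_phase (c : ℝ) (z : ℂ) (x : ℝ) :
    HasDerivAt (fun ξ : ℝ => Complex.exp (Complex.I * (c : ℂ) * (z - ξ) ^ 2))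
      (Complex.exp (Complex.I * (c : ℂ) * (z - x) ^ 2) * (-2 * Complex.I * c * (z - x))) x := by
  have hsub : HasDerivAt (fun ξ : ℝ => z - (ξ : ℂ)) (-1) x := by
    simpa using (Complex.ofRealCLM.hasDerivAt (x := x)).const_sub z
  refine ((hsub.pow 2).const_mul (Complex.I * (c : ℂ))).cexp.congr_deriv ?_
  simp only [Pi.pow_apply]
  push_cast
  ring

lemma exp_neg_phase_mul (c : ℝ) (w : ℂ) :
    Complex.exp (Complex.I * ((-c : ℝ) : ℂ) * w) * Complex.exp (Complex.I * (c : ℂ) * w) = 1 := by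
  rw [← Complex.exp_add, Complex.ofReal_neg, mul_neg, neg_mul, neg_add_cancel, Complex.exp_zero]

lemma GreenAssumption.differentiableAt_factor (hG : GreenAssumption T V M N G α Gext a Gt p A B)
    {t x : ℝ} {z : ℂ} (ht : t ∈ timeInterval T) (hx : x ∈ dotReal) (hz : z ∈ doubleSector α) :
    DifferentiableAt ℝ (fun ξ => Gt t ξ z) x := by
  have hGext := (hG.mem z hz).differentiable t ht x hx
  refine ((hasDerivAt_exp_phase (-a t) z x).differentiableAt.mul hGext).congr_of_eventuallyEq ?_
  filter_upwards [isOpen_dotReal.mem_nhds hx] with ξ hξ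
  rw [Pi.mul_apply, hG.decomposition t ht ξ hξ z hz, ← mul_assoc, exp_neg_phase_mul, one_mul]

lemma GreenAssumption.deriv_eq (hG : GreenAssumption T V M N G α Gext a Gt p A B)
    {t x : ℝ} {z : ℂ} (ht : t ∈ timeInterval T) (hx : x ∈ dotReal) (hz : z ∈ doubleSector α) :
    deriv (fun ξ => Gext t ξ z) x = Complex.exp (Complex.I * (a t : ℂ) * (z - x) ^ 2) *
      (deriv (fun ξ => Gt t ξ z) x + -2 * Complex.I * a t * (z - x) * Gt t x z) := by
  have hprod := (hasDerivAt_exp_phase (a t) z x).mul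
    (hG.differentiableAt_factor ht hx hz).hasDerivAt
  have heq : (fun ξ => Gext t ξ z) =ᶠ[𝓝 x]
      (fun ξ : ℝ => Complex.exp (Complex.I * (a t : ℂ) * (z - ξ) ^ 2)) * fun ξ => Gt t ξ z := by
    filter_upwards [isOpen_dotReal.mem_nhds hx] with ξ hξ
    exact hG.decomposition t ht ξ hξ z hz
  rw [heq.deriv_eq, hprod.deriv]
  ring

lemma GreenAssumption.deriv_deriv_eq (hG : GreenAssumption T V M N G α Gext a Gt p A B)
    {t x : ℝ} {z : ℂ} (ht : t ∈ timeInterval T) (hx : x ∈ dotReal) (hz : z ∈ doubleSector α)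
    (hd : DifferentiableAt ℝ (deriv fun ξ => Gext t ξ z) x) :
    deriv (deriv fun ξ => Gext t ξ z) x = Complex.exp (Complex.I * (a t : ℂ) * (z - x) ^ 2) *
      (deriv (deriv fun ξ => Gt t ξ z) x
        + 2 * (-2 * Complex.I * a t * (z - x)) * deriv (fun ξ => Gt t ξ z) x
        + (-2 * Complex.I * a t * (z - x)) ^ 2 * Gt t x z + 2 * Complex.I * a t * Gt t x z) := by
  have hGt := hG.differentiableAt_factor ht hx hz
  have hlin : HasDerivAt (fun ξ : ℝ => -2 * Complex.I * a t * (z - ξ)) (2 * Complex.I * a t) x := by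
    have hsub : HasDerivAt (fun ξ : ℝ => z - (ξ : ℂ)) (-1) x := by
      simpa using (Complex.ofRealCLM.hasDerivAt (x := x)).const_sub z
    refine (hsub.const_mul (-2 * Complex.I * a t)).congr_deriv ?_
    ring
  have hd' : DifferentiableAt ℝ (deriv fun ξ => Gt t ξ z) x := by
    refine (((hasDerivAt_exp_phase (-a t) z x).differentiableAt.mul hd).sub
      (hlin.differentiableAt.mul hGt)).congr_of_eventuallyEq ?_
    filter_upwards [isOpen_dotReal.mem_nhds hx] with ξ hξ
    rw [Pi.sub_apply, Pi.mul_apply, Pi.mul_apply, hG.deriv_eq ht hξ hz, ← mul_assoc,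
      exp_neg_phase_mul]
    ring
  have heq : (deriv fun ξ => Gext t ξ z) =ᶠ[𝓝 x]
      (fun ξ : ℝ => Complex.exp (Complex.I * (a t : ℂ) * (z - ξ) ^ 2)) *
        ((deriv fun ξ => Gt t ξ z) + (fun ξ : ℝ => -2 * Complex.I * a t * (z - ξ)) *
          fun ξ => Gt t ξ z) := by
    filter_upwards [isOpen_dotReal.mem_nhds hx] with ξ hξ
    rw [hG.deriv_eq ht hξ hz]
    rfl
  have hprod := (hasDerivAt_exp_phase (a t) z x).mul
    (hd'.hasDerivAt.add (hlin.mul hGt.hasDerivAt))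
  rw [heq.deriv_eq, hprod.deriv]
  simp only [Pi.add_apply, Pi.mul_apply]
  ring

lemma GreenAssumption.deriv_time_eq (hG : GreenAssumption T V M N G α Gext a Gt p A B)
    {t x : ℝ} {z : ℂ} (ht : t ∈ timeInterval T) (hx : x ∈ dotReal) (hz : z ∈ doubleSector α)
    (hd : DifferentiableAt ℝ (fun τ => Gext τ x z) t) (ha : DifferentiableAt ℝ a t) :
    deriv (fun τ => Gext τ x z) t = Complex.exp (Complex.I * (a t : ℂ) * (z - x) ^ 2) *
      (deriv (fun τ => Gt τ x z) t
        + Complex.I * ((deriv a t : ℝ) : ℂ) * (z - x) ^ 2 * Gt t x z) := by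
  have hphase : ∀ s : ℂ, HasDerivAt (fun τ : ℝ => Complex.exp (s * (a τ : ℂ) * (z - x) ^ 2))
      (Complex.exp (s * (a t : ℂ) * (z - x) ^ 2) * (s * ((deriv a t : ℝ) : ℂ) * (z - x) ^ 2)) t :=
    fun s => ((ha.hasDerivAt.ofReal_comp.const_mul s).mul_const ((z - x) ^ 2)).cexp
  have hnear := (isOpen_timeInterval T).mem_nhds ht
  have hGt : DifferentiableAt ℝ (fun τ => Gt τ x z) t := by
    refine ((hphase (-Complex.I)).differentiableAt.mul hd).congr_of_eventuallyEq ?_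
    filter_upwards [hnear] with τ hτ
    rw [Pi.mul_apply, hG.decomposition τ hτ x hx z hz, ← mul_assoc, ← Complex.exp_add, neg_mul,
      neg_mul, neg_add_cancel, Complex.exp_zero, one_mul]
  have heq : (fun τ => Gext τ x z) =ᶠ[𝓝 t]
      (fun τ : ℝ => Complex.exp (Complex.I * (a τ : ℂ) * (z - x) ^ 2)) * fun τ => Gt τ x z := by
    filter_upwards [hnear] with τ hτ
    exact hG.decomposition τ hτ x hx z hz
  rw [heq.deriv_eq, ((hphase Complex.I).mul hGt.hasDerivAt).deriv]
  ring

end GreenDerivatives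

section IntegrandBounds

variable {T : EReal} {V : ℝ → ℝ → ℂ} {M N : Matrix (Fin 2) (Fin 2) ℂ} {G : ℝ → ℝ → ℝ → ℂ}
  {α : ℝ} {Gext : ℝ → ℝ → ℂ → ℂ} {a : ℝ → ℝ} {Gt : ℝ → ℝ → ℂ → ℂ} {p : ℝ}
  {A B : Fin 3 → ℝ → ℝ → ℝ} {m : Fin 3} {c K ε θ t x : ℝ}

/-- The parameters for which the integrand on the line `e^{iθ} ℝ` and its derivatives that involve
`A j`, `B j` with `j ≤ m` are bounded by a common Gaussian of rate `c / 2`: the Gaussian factors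
decay at least at the rate `c`, and the remaining data are bounded by `K`. -/
structure GaussianRegime (T : EReal) (α : ℝ) (a : ℝ → ℝ) (A B : Fin 3 → ℝ → ℝ → ℝ) (m : Fin 3)
    (c K ε θ t x : ℝ) : Prop where
  angle : θ ∈ Icc 0 α
  time : t ∈ timeInterval T
  space : x ∈ dotReal
  rate : c ≤ ε * Real.cos (2 * θ) + a t * Real.sin (2 * θ)
  abs_le : |x| ≤ K
  phase_le : a t ≤ K
  growth_le : ∀ j ≤ m, A j t x ≤ K ∧ B j t x ≤ K

lemma GaussianRegime.nonneg (hR : GaussianRegime T α a A B m c K ε θ t x) : 0 ≤ K :=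
  (abs_nonneg x).trans hR.abs_le

lemma GaussianRegime.norm_ray_sub_le (hR : GaussianRegime T α a A B m c K ε θ t x) (y : ℝ) :
    ‖ray 0 θ y - x‖ ≤ (1 + K) * (1 + |y|) := by
  have hnorm : ‖ray 0 θ y - x‖ ≤ |y| + K := by
    refine (norm_sub_le _ _).trans ?_
    rw [norm_ray_zero, Complex.norm_real, Real.norm_eq_abs]
    exact add_le_add_right hR.abs_le _
  linarith [mul_nonneg hR.nonneg (abs_nonneg y)]

lemma exp_phase_mul_sq_le (hc : 0 < c) (ha : 0 ≤ a t)
    (hR : GaussianRegime T α a A B m c K ε θ t x) (y : ℝ) :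
    Real.exp (-ε * (ray 0 θ y ^ 2).re + -a t * ((ray 0 θ y - x) ^ 2).im)
        * ((1 + |y|) ^ 2 * Real.exp (c / 8 * y ^ 2))
      ≤ Real.exp ((2 * K ^ 2 + 2) ^ 2 / c) * Real.exp (-(c / 2) * y ^ 2) := by
  have hphase := phase_exponent_ray_le (s := 0) (r := y) (ξ := x) (by simp) (by simp) ha hR.rate
  have hlin : 2 * a t * |0 - x| * |y| ≤ 2 * K ^ 2 * |y| := by
    have hax := mul_le_mul hR.phase_le hR.abs_le (abs_nonneg x) hR.nonneg
    rw [zero_sub, abs_neg]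
    exact mul_le_mul_of_nonneg_right (by linarith) (abs_nonneg y)
  have hpoly : (1 + |y|) ^ 2 ≤ Real.exp (2 * |y|) := by
    rw [two_mul, Real.exp_add, ← sq]
    exact pow_le_pow_left₀ (by positivity) ((add_comm _ _).trans_le (Real.add_one_le_exp _)) 2
  refine (mul_le_mul_of_nonneg_left (mul_le_mul_of_nonneg_right hpoly (Real.exp_pos _).le)
    (Real.exp_pos _).le).trans ?_
  rw [← Real.exp_add, ← Real.exp_add, ← Real.exp_add, Real.exp_le_exp]
  have hgauss := gaussian_exponent_le hc (2 * K ^ 2 + 2) 0 y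
  rw [abs_zero, zero_add, sq_abs] at hgauss
  linarith

lemma exists_norm_contourWeight_mul_le (hc : 0 < c) (K : ℝ) :
    ∃ C : ℝ, 0 ≤ C ∧ ∀ {F : ℂ → ℂ} {AF : ℝ}, (∀ z, ‖F z‖ ≤ AF * Real.exp (c / 16 * ‖z‖ ^ 2)) →
      ∀ {m : Fin 3} {ε θ t x : ℝ}, GaussianRegime T α a A B m c K ε θ t x → 0 ≤ a t →
      ∀ {k y : ℝ} {w : ℂ}, 0 ≤ k →
      (y ≠ 0 → ‖w‖ ≤ ‖Complex.exp (Complex.I * (a t : ℂ) * (ray 0 θ y - x) ^ 2)‖ *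
        (k * ((1 + |y|) ^ 2 * Real.exp (c / 16 * y ^ 2)))) →
      ‖contourWeight F ε θ y * w‖ ≤ AF * (C * k) * Real.exp (-(c / 2) * y ^ 2) := by
  refine ⟨Real.exp ((2 * K ^ 2 + 2) ^ 2 / c), (Real.exp_pos _).le,
    fun {F AF} hF m ε θ t x hR ha k y w hk hw => ?_⟩
  have hAF : 0 ≤ AF := nonneg_of_mul_nonneg_left ((norm_nonneg _).trans (hF 0)) (Real.exp_pos _)
  by_cases hy : y = 0
  · rw [hy, contourWeight_zero, zero_mul, norm_zero]
    positivity
  have hFz := hF (ray 0 θ y)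
  rw [norm_ray_zero, sq_abs] at hFz
  have hw := hw hy
  rw [norm_exp_I_mul_sq] at hw
  rw [contourWeight, if_neg hy, norm_mul, norm_mul, norm_mul, Complex.norm_exp_ofReal_mul_I,
    one_mul, norm_exp_neg_mul_sq]
  have hsq : Real.exp (c / 8 * y ^ 2)
      = Real.exp (c / 16 * y ^ 2) * Real.exp (c / 16 * y ^ 2) := by
    rw [← Real.exp_add]
    ring_nf
  calc Real.exp (-ε * (ray 0 θ y ^ 2).re) * ‖F (ray 0 θ y)‖ * ‖w‖
      ≤ Real.exp (-ε * (ray 0 θ y ^ 2).re) * (AF * Real.exp (c / 16 * y ^ 2)) *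
        (Real.exp (-a t * ((ray 0 θ y - x) ^ 2).im) *
          (k * ((1 + |y|) ^ 2 * Real.exp (c / 16 * y ^ 2)))) := by gcongr
    _ = AF * k * (Real.exp (-ε * (ray 0 θ y ^ 2).re + -a t * ((ray 0 θ y - x) ^ 2).im)
        * ((1 + |y|) ^ 2 * Real.exp (c / 8 * y ^ 2))) := by
        rw [hsq, Real.exp_add]
        ring
    _ ≤ AF * k * (Real.exp ((2 * K ^ 2 + 2) ^ 2 / c) * Real.exp (-(c / 2) * y ^ 2)) :=
        mul_le_mul_of_nonneg_left (exp_phase_mul_sq_le hc ha hR y) (mul_nonneg hAF hk)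
    _ = AF * (Real.exp ((2 * K ^ 2 + 2) ^ 2 / c) * k) * Real.exp (-(c / 2) * y ^ 2) := by ring

lemma GreenAssumption.exists_growth_le (hG : GreenAssumption T V M N G α Gext a Gt p A B)
    (hc : 0 < c) (K : ℝ) :
    ∃ D : ℝ, 0 ≤ D ∧ ∀ {m : Fin 3} {ε θ t x : ℝ}, GaussianRegime T α a A B m c K ε θ t x →
      ∀ j ≤ m, ∀ y, A j t x * Real.exp (B j t x * ‖ray 0 θ y‖ ^ p)
        ≤ D * Real.exp (c / 16 * y ^ 2) := by
  obtain ⟨C, hC0, hC⟩ := exists_exp_mul_rpow_le hG.order K (δ := c / 16) (by positivity)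
  refine ⟨|K| * C, by positivity, fun {m ε θ t x} hR j hj y => ?_⟩
  have hexp := hC (B j t x) (hR.growth_le j hj).2 |y| (abs_nonneg y)
  rw [sq_abs] at hexp
  rw [norm_ray_zero, mul_assoc]
  exact mul_le_mul ((hR.growth_le j hj).1.trans (le_abs_self K)) hexp (Real.exp_pos _).le
    (abs_nonneg K)

lemma GreenAssumption.exists_norm_integrand_le (hG : GreenAssumption T V M N G α Gext a Gt p A B)
    (hc : 0 < c) (K : ℝ) :
    ∃ C : ℝ, 0 ≤ C ∧ ∀ {F : ℂ → ℂ} {AF : ℝ}, (∀ z, ‖F z‖ ≤ AF * Real.exp (c / 16 * ‖z‖ ^ 2)) →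
      ∀ {m : Fin 3} {ε θ t x : ℝ}, GaussianRegime T α a A B m c K ε θ t x →
      ∀ y, ‖contourIntegrand Gext F ε θ t x y‖ ≤ AF * C * Real.exp (-(c / 2) * y ^ 2) := by
  obtain ⟨C, hC0, hC⟩ := exists_norm_contourWeight_mul_le (T := T) (α := α) (a := a) (A := A)
    (B := B) hc K
  obtain ⟨D, hD0, hD⟩ := hG.exists_growth_le hc K
  refine ⟨C * D, by positivity, fun hF m ε θ t x hR y =>
    hC hF hR (hG.a_pos t hR.time).le hD0 fun hy => ?_⟩
  have hz := ray_zero_mem_doubleSector hG.angle hR.angle hy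
  have hone : (1 : ℝ) ≤ (1 + |y|) ^ 2 := one_le_pow₀ (by linarith [abs_nonneg y])
  rw [hG.decomposition t hR.time x hR.space _ hz, norm_mul]
  refine mul_le_mul_of_nonneg_left ?_ (norm_nonneg _)
  refine ((hG.bound t hR.time x hR.space _ hz).trans (hD hR 0 (Fin.zero_le m) y)).trans ?_
  exact mul_le_mul_of_nonneg_left (le_mul_of_one_le_left (Real.exp_pos _).le hone) hD0

lemma GaussianRegime.norm_phase_deriv_le (hR : GaussianRegime T α a A B m c K ε θ t x)
    (ha : 0 ≤ a t) (y : ℝ) :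
    ‖-2 * Complex.I * a t * (ray 0 θ y - x)‖ ≤ 2 * K * (1 + K) * (1 + |y|) := by
  have hnorm : ‖-2 * Complex.I * (a t : ℂ)‖ = 2 * a t := by simp [abs_of_nonneg ha]
  rw [norm_mul, hnorm, mul_assoc (2 * K)]
  exact mul_le_mul (by linarith [hR.phase_le]) (hR.norm_ray_sub_le y) (norm_nonneg _)
    (by linarith [hR.nonneg])

lemma norm_deriv_factor_le {g dg w : ℂ} {E L u : ℝ} (hg : ‖g‖ ≤ E) (hdg : ‖dg‖ ≤ E)
    (hw : ‖w‖ ≤ L * u) (hL : 0 ≤ L) (hu : 1 ≤ u) :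
    ‖dg + w * g‖ ≤ (1 + L) * (u ^ 2 * E) := by
  have hE : 0 ≤ E := (norm_nonneg _).trans hg
  have husq : u ≤ u ^ 2 := le_self_pow₀ hu two_ne_zero
  calc ‖dg + w * g‖ ≤ E + L * u * E := norm_add_le_of_le hdg (norm_mul_le_of_le hw hg)
    _ ≤ u ^ 2 * E + L * u ^ 2 * E := by
        gcongr
        exact le_mul_of_one_le_left hE (hu.trans husq)
    _ = (1 + L) * (u ^ 2 * E) := by ring

lemma norm_deriv_deriv_factor_le {g dg ddg w b : ℂ} {E L K u : ℝ} (hg : ‖g‖ ≤ E)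
    (hdg : ‖dg‖ ≤ E) (hddg : ‖ddg‖ ≤ E) (hw : ‖w‖ ≤ L * u) (hb : ‖b‖ ≤ K) (hL : 0 ≤ L)
    (hu : 1 ≤ u) :
    ‖ddg + 2 * w * dg + w ^ 2 * g + b * g‖ ≤ ((1 + L) ^ 2 + K) * (u ^ 2 * E) := by
  have hE : 0 ≤ E := (norm_nonneg _).trans hg
  have hK : 0 ≤ K := (norm_nonneg _).trans hb
  have husq : u ≤ u ^ 2 := le_self_pow₀ hu two_ne_zero
  have honesq : 1 ≤ u ^ 2 := hu.trans husq
  have htwo : ‖2 * w‖ ≤ 2 * (L * u) := norm_mul_le_of_le (by simp) hw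
  have hsq : ‖w ^ 2‖ ≤ (L * u) ^ 2 := by
    rw [norm_pow]
    exact pow_le_pow_left₀ (norm_nonneg _) hw 2
  calc ‖ddg + 2 * w * dg + w ^ 2 * g + b * g‖
      ≤ E + 2 * (L * u) * E + (L * u) ^ 2 * E + K * E :=
        norm_add_le_of_le (norm_add_le_of_le (norm_add_le_of_le hddg (norm_mul_le_of_le htwo hdg))
          (norm_mul_le_of_le hsq hg)) (norm_mul_le_of_le hb hg)
    _ ≤ u ^ 2 * E + 2 * (L * u ^ 2) * E + (L * u) ^ 2 * E + K * (u ^ 2 * E) := by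
        gcongr <;> exact le_mul_of_one_le_left hE honesq
    _ = ((1 + L) ^ 2 + K) * (u ^ 2 * E) := by ring

lemma GreenAssumption.exists_norm_deriv_integrand_le
    (hG : GreenAssumption T V M N G α Gext a Gt p A B) (hc : 0 < c) (K : ℝ) :
    ∃ C : ℝ, 0 ≤ C ∧ ∀ {F : ℂ → ℂ} {AF : ℝ}, (∀ z, ‖F z‖ ≤ AF * Real.exp (c / 16 * ‖z‖ ^ 2)) →
      ∀ {m : Fin 3} {ε θ t x : ℝ}, 1 ≤ m → GaussianRegime T α a A B m c K ε θ t x →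
      ∀ y, ‖deriv (fun ξ => contourIntegrand Gext F ε θ t ξ y) x‖
        ≤ AF * C * Real.exp (-(c / 2) * y ^ 2) := by
  obtain ⟨C, hC0, hC⟩ := exists_norm_contourWeight_mul_le (T := T) (α := α) (a := a) (A := A)
    (B := B) hc K
  obtain ⟨D, hD0, hD⟩ := hG.exists_growth_le hc K
  refine ⟨C * |(1 + 2 * K * (1 + K)) * D|, by positivity, fun hF m ε θ t x hm hR y => ?_⟩
  rw [deriv_contourIntegrand]
  refine hC hF hR (hG.a_pos t hR.time).le (abs_nonneg _) fun hy => ?_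
  have hz := ray_zero_mem_doubleSector hG.angle hR.angle hy
  have hval := (hG.bound t hR.time x hR.space _ hz).trans (hD hR 0 (Fin.zero_le m) y)
  have hdx := (hG.bound_x t hR.time x hR.space _ hz).trans (hD hR 1 hm y)
  have hK := hR.nonneg
  have ha := (hG.a_pos t hR.time).le
  rw [hG.deriv_eq hR.time hR.space hz, norm_mul]
  refine mul_le_mul_of_nonneg_left ?_ (norm_nonneg _)
  refine (norm_deriv_factor_le hval hdx (hR.norm_phase_deriv_le ha y) (by positivity)
    (by linarith [abs_nonneg y])).trans_eq ?_
  have hk : 0 ≤ (1 + 2 * K * (1 + K)) * D := by positivity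
  rw [abs_of_nonneg hk]
  ring

lemma GreenAssumption.exists_norm_deriv_deriv_integrand_le
    (hG : GreenAssumption T V M N G α Gext a Gt p A B) (hc : 0 < c) (K : ℝ) :
    ∃ C : ℝ, 0 ≤ C ∧ ∀ {F : ℂ → ℂ} {AF : ℝ}, (∀ z, ‖F z‖ ≤ AF * Real.exp (c / 16 * ‖z‖ ^ 2)) →
      ∀ {ε θ t x y : ℝ}, GaussianRegime T α a A B 2 c K ε θ t x →
      (y ≠ 0 → DifferentiableAt ℝ (deriv fun ξ => Gext t ξ (ray 0 θ y)) x ∧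
        ‖deriv (deriv fun ξ => Gt t ξ (ray 0 θ y)) x‖
          ≤ A 2 t x * Real.exp (B 2 t x * ‖ray 0 θ y‖ ^ p)) →
      ‖deriv (deriv fun ξ => contourIntegrand Gext F ε θ t ξ y) x‖
        ≤ AF * C * Real.exp (-(c / 2) * y ^ 2) := by
  obtain ⟨C, hC0, hC⟩ := exists_norm_contourWeight_mul_le (T := T) (α := α) (a := a) (A := A)
    (B := B) hc K
  obtain ⟨D, hD0, hD⟩ := hG.exists_growth_le hc K
  refine ⟨C * |((1 + 2 * K * (1 + K)) ^ 2 + 2 * K) * D|, by positivity,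
    fun hF ε θ t x y hR hreg => ?_⟩
  rw [deriv_deriv_contourIntegrand]
  refine hC hF hR (hG.a_pos t hR.time).le (abs_nonneg _) fun hy => ?_
  have hz := ray_zero_mem_doubleSector hG.angle hR.angle hy
  have hval := (hG.bound t hR.time x hR.space _ hz).trans (hD hR 0 (Fin.zero_le 2) y)
  have hdx := (hG.bound_x t hR.time x hR.space _ hz).trans (hD hR 1 (by decide) y)
  have hdxx := (hreg hy).2.trans (hD hR 2 le_rfl y)
  have hK := hR.nonneg
  have ha := (hG.a_pos t hR.time).le
  have hphase : ‖2 * Complex.I * (a t : ℂ)‖ ≤ 2 * K := by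
    simpa [abs_of_nonneg ha] using hR.phase_le
  rw [hG.deriv_deriv_eq hR.time hR.space hz (hreg hy).1, norm_mul]
  refine mul_le_mul_of_nonneg_left ?_ (norm_nonneg _)
  refine (norm_deriv_deriv_factor_le hval hdx hdxx (hR.norm_phase_deriv_le ha y) hphase
    (by positivity) (by linarith [abs_nonneg y])).trans_eq ?_
  have hk : 0 ≤ ((1 + 2 * K * (1 + K)) ^ 2 + 2 * K) * D := by positivity
  rw [abs_of_nonneg hk]
  ring

lemma GreenAssumption.exists_norm_deriv_time_integrand_le
    (hG : GreenAssumption T V M N G α Gext a Gt p A B) (hc : 0 < c) (K : ℝ) :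
    ∃ C : ℝ, 0 ≤ C ∧ ∀ {F : ℂ → ℂ} {AF : ℝ}, (∀ z, ‖F z‖ ≤ AF * Real.exp (c / 16 * ‖z‖ ^ 2)) →
      ∀ {ε θ t x y : ℝ}, GaussianRegime T α a A B 2 c K ε θ t x → DifferentiableAt ℝ a t →
      (y ≠ 0 → DifferentiableAt ℝ (fun τ => Gext τ x (ray 0 θ y)) t ∧
        ‖deriv (fun τ => Gt τ x (ray 0 θ y)) t‖
          ≤ A 2 t x * Real.exp (B 2 t x * ‖ray 0 θ y‖ ^ p)) →
      ‖deriv (fun τ => contourIntegrand Gext F ε θ τ x y) t‖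
        ≤ (1 + |deriv a t|) * (AF * C * Real.exp (-(c / 2) * y ^ 2)) := by
  obtain ⟨C, hC0, hC⟩ := exists_norm_contourWeight_mul_le (T := T) (α := α) (a := a) (A := A)
    (B := B) hc K
  obtain ⟨D, hD0, hD⟩ := hG.exists_growth_le hc K
  refine ⟨C * ((1 + K) ^ 2 * D), by positivity, fun {F AF} hF ε θ t x y hR hda hreg => ?_⟩
  have hk : 0 ≤ (1 + |deriv a t|) * ((1 + K) ^ 2 * D) := by positivity
  rw [deriv_time_contourIntegrand]
  refine (hC hF hR (hG.a_pos t hR.time).le hk fun hy => ?_).trans_eq (by ring)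
  have hz := ray_zero_mem_doubleSector hG.angle hR.angle hy
  have hval := (hG.bound t hR.time x hR.space _ hz).trans (hD hR 0 (Fin.zero_le 2) y)
  have hdt := (hreg hy).2.trans (hD hR 2 le_rfl y)
  have hphase : ‖Complex.I * ((deriv a t : ℝ) : ℂ) * (ray 0 θ y - x) ^ 2‖
      ≤ |deriv a t| * ((1 + K) * (1 + |y|)) ^ 2 := by
    rw [norm_mul, norm_mul, Complex.norm_I, one_mul, Complex.norm_real, Real.norm_eq_abs, norm_pow]
    gcongr
    exact hR.norm_ray_sub_le y
  have hone : 1 ≤ (1 + K) ^ 2 * (1 + |y|) ^ 2 := by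
    rw [← mul_pow]
    exact one_le_pow₀ (one_le_mul_of_one_le_of_one_le (by linarith [hR.nonneg])
      (by linarith [abs_nonneg y]))
  rw [hG.deriv_time_eq hR.time hR.space hz (hreg hy).1 hda, norm_mul]
  refine mul_le_mul_of_nonneg_left ?_ (norm_nonneg _)
  have hE : 0 ≤ D * Real.exp (c / 16 * y ^ 2) := by positivity
  calc _ ≤ D * Real.exp (c / 16 * y ^ 2) + |deriv a t| * ((1 + K) * (1 + |y|)) ^ 2 *
        (D * Real.exp (c / 16 * y ^ 2)) := norm_add_le_of_le hdt (norm_mul_le_of_le hphase hval)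
    _ ≤ (1 + K) ^ 2 * (1 + |y|) ^ 2 * (D * Real.exp (c / 16 * y ^ 2)) +
        |deriv a t| * ((1 + K) * (1 + |y|)) ^ 2 * (D * Real.exp (c / 16 * y ^ 2)) := by
        exact add_le_add_left (le_mul_of_one_le_left hE hone) _
    _ = (1 + |deriv a t|) * ((1 + K) ^ 2 * D) * ((1 + |y|) ^ 2 * Real.exp (c / 16 * y ^ 2)) := by
        ring

end IntegrandBounds

section ContourIntegral

variable {T : EReal} {V : ℝ → ℝ → ℂ} {M N : Matrix (Fin 2) (Fin 2) ℂ} {G : ℝ → ℝ → ℝ → ℂ}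
  {α : ℝ} {Gext : ℝ → ℝ → ℂ → ℂ} {a : ℝ → ℝ} {Gt : ℝ → ℝ → ℂ → ℂ} {p : ℝ}
  {A B : Fin 3 → ℝ → ℝ → ℝ} {F : ℂ → ℂ} {ε θ t x : ℝ}

lemma GreenAssumption.exists_gaussianRegime (hG : GreenAssumption T V M N G α Gext a Gt p A B)
    {S : Set (ℝ × ℝ)} (hS : IsCompact S) (hSD : S ⊆ timeInterval T ×ˢ dotReal) :
    ∃ K : ℝ, ∀ {m : Fin 3} {c ε θ t x : ℝ}, (t, x) ∈ S → θ ∈ Icc 0 α →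
      c ≤ ε * Real.cos (2 * θ) + a t * Real.sin (2 * θ) →
      GaussianRegime T α a A B m c K ε θ t x := by
  have ha : ContinuousOn (fun P : ℝ × ℝ => a P.1) S :=
    (hG.a_ac.continuousOn (isOpen_timeInterval T) (ordConnected_timeInterval T)).comp
      continuousOn_fst fun P hP => (hSD hP).1
  have hcont : ContinuousOn (fun P : ℝ × ℝ =>
      |P.2| + |a P.1| + ∑ j, (|A j P.1 P.2| + |B j P.1 P.2|)) S :=
    (continuousOn_snd.abs.add ha.abs).add <| continuousOn_finsetSum _ fun j _ =>
      ((hG.A_continuous j).mono hSD).abs.add ((hG.B_continuous j).mono hSD).abs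
  obtain ⟨K, hK⟩ := hS.bddAbove_image hcont
  refine ⟨K, fun {m c ε θ t x} hP hθ hrate => ?_⟩
  have hle : |x| + |a t| + ∑ j, (|A j t x| + |B j t x|) ≤ K := hK (mem_image_of_mem _ hP)
  have hterm : ∀ j, |A j t x| + |B j t x| ≤ ∑ j, (|A j t x| + |B j t x|) := fun j =>
    Finset.single_le_sum (f := fun j => |A j t x| + |B j t x|) (fun i _ => by positivity)
      (Finset.mem_univ j)
  have hsum : 0 ≤ ∑ j, (|A j t x| + |B j t x|) := Finset.sum_nonneg fun i _ => by positivity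
  have hx := abs_nonneg x
  have ha := abs_nonneg (a t)
  refine ⟨hθ, (hSD hP).1, (hSD hP).2, hrate, by linarith, by linarith [le_abs_self (a t)],
    fun j _ => ⟨?_, ?_⟩⟩
  · linarith [hterm j, le_abs_self (A j t x), abs_nonneg (B j t x)]
  · linarith [hterm j, le_abs_self (B j t x), abs_nonneg (A j t x)]

lemma integrable_const_mul_gaussian (C : ℝ) {c : ℝ} (hc : 0 < c) :
    Integrable fun y : ℝ => C * Real.exp (-(c / 2) * y ^ 2) :=
  (integrable_exp_neg_mul_sq (half_pos hc)).const_mul C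

lemma GreenAssumption.continuousOn_contourIntegrand
    (hG : GreenAssumption T V M N G α Gext a Gt p A B) (hF : Continuous F) (ε : ℝ)
    (hθ : θ ∈ Icc 0 α) (ht : t ∈ timeInterval T) (hx : x ∈ dotReal) :
    ContinuousOn (contourIntegrand Gext F ε θ t x) {0}ᶜ :=
  (continuousOn_contourWeight hF ε θ).mul ((hG.continuousOn t ht x hx).comp
    (continuous_ray 0 θ).continuousOn fun _ hy => ray_zero_mem_doubleSector hG.angle hθ hy)

lemma GreenAssumption.stronglyMeasurable_contourIntegrand
    (hG : GreenAssumption T V M N G α Gext a Gt p A B) (hF : Continuous F) (ε : ℝ)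
    (hθ : θ ∈ Icc 0 α) (ht : t ∈ timeInterval T) (hx : x ∈ dotReal) :
    StronglyMeasurable (contourIntegrand Gext F ε θ t x) :=
  (measurable_of_continuousOn_compl_singleton 0
    (hG.continuousOn_contourIntegrand hF ε hθ ht hx)).stronglyMeasurable

lemma GreenAssumption.differentiableAt_contourIntegrand
    (hG : GreenAssumption T V M N G α Gext a Gt p A B) (ε : ℝ) (hθ : θ ∈ Icc 0 α)
    (ht : t ∈ timeInterval T) (hx : x ∈ dotReal) (y : ℝ) :
    DifferentiableAt ℝ (fun ξ => contourIntegrand Gext F ε θ t ξ y) x := by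
  by_cases hy : y = 0
  · simp only [hy, contourIntegrand_zero, differentiableAt_const]
  · exact ((hG.mem _ (ray_zero_mem_doubleSector hG.angle hθ hy)).differentiable t ht x hx).const_mul
      (contourWeight F ε θ y)

lemma GreenAssumption.continuousOn_contourIntegrand_space
    (hG : GreenAssumption T V M N G α Gext a Gt p A B) (ε : ℝ) (hθ : θ ∈ Icc 0 α)
    (ht : t ∈ timeInterval T) (y : ℝ) :
    ContinuousOn (fun ξ => contourIntegrand Gext F ε θ t ξ y) dotReal :=
  fun _ hx => (hG.differentiableAt_contourIntegrand ε hθ ht hx y).continuousAt.continuousWithinAt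

lemma GreenAssumption.stronglyMeasurable_deriv_contourIntegrand
    (hG : GreenAssumption T V M N G α Gext a Gt p A B) (hF : Continuous F) (ε : ℝ)
    (hθ : θ ∈ Icc 0 α) (ht : t ∈ timeInterval T) (hx : x ∈ dotReal) :
    StronglyMeasurable fun y => deriv (fun ξ => contourIntegrand Gext F ε θ t ξ y) x :=
  stronglyMeasurable_deriv_of_continuousOn (f := fun y ξ => contourIntegrand Gext F ε θ t ξ y)
    isOpen_dotReal (fun _ hs => hG.stronglyMeasurable_contourIntegrand hF ε hθ ht hs)
    (hG.continuousOn_contourIntegrand_space ε hθ ht) hx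

lemma GreenAssumption.isAC_contourIntegrand_time
    (hG : GreenAssumption T V M N G α Gext a Gt p A B) (ε : ℝ) (hθ : θ ∈ Icc 0 α)
    (hx : x ∈ dotReal) (y : ℝ) :
    IsAC (fun τ => contourIntegrand Gext F ε θ τ x y) (timeInterval T) := by
  by_cases hy : y = 0
  · simp only [hy, contourIntegrand_zero, isAC_const]
  · exact ((hG.mem _ (ray_zero_mem_doubleSector hG.angle hθ hy)).time x hx).const_mul _

lemma GreenAssumption.isACDot_deriv_contourIntegrand
    (hG : GreenAssumption T V M N G α Gext a Gt p A B) (ε : ℝ) (hθ : θ ∈ Icc 0 α)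
    (ht : t ∈ timeInterval T) (y : ℝ) :
    IsACDot (deriv fun ξ => contourIntegrand Gext F ε θ t ξ y) := by
  by_cases hy : y = 0
  · simp only [hy, contourIntegrand_zero, deriv_const', IsACDot, isAC_const, and_self]
  · obtain ⟨hneg, hpos⟩ :=
      (hG.mem _ (ray_zero_mem_doubleSector hG.angle hθ hy)).space_deriv t ht
    have heq : (deriv fun ξ => contourIntegrand Gext F ε θ t ξ y) = _ :=
      funext fun x => deriv_contourIntegrand ε θ t x y
    rw [heq]
    exact ⟨hneg.const_mul _, hpos.const_mul _⟩

lemma GreenAssumption.integrable_contourIntegrand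
    (hG : GreenAssumption T V M N G α Gext a Gt p A B) (hF : IsEntireOfMinimalType F)
    (hθ : θ ∈ Icc 0 α) (ht : t ∈ timeInterval T) (hx : x ∈ dotReal)
    (hc : 0 < ε * Real.cos (2 * θ) + a t * Real.sin (2 * θ)) :
    Integrable (contourIntegrand Gext F ε θ t x) := by
  obtain ⟨K, hK⟩ := hG.exists_gaussianRegime (isCompact_singleton (x := (t, x)))
    (singleton_subset_iff.2 ⟨ht, hx⟩)
  obtain ⟨C, -, hC⟩ := hG.exists_norm_integrand_le hc K
  obtain ⟨AF, hAF⟩ := hF.bound _ (div_pos hc (by norm_num : (0 : ℝ) < 16))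
  exact (integrable_const_mul_gaussian _ hc).mono'
    (hG.stronglyMeasurable_contourIntegrand hF.differentiable.continuous ε hθ ht
      hx).aestronglyMeasurable
    (Eventually.of_forall (hC hAF (hK (m := 0) rfl hθ le_rfl)))

lemma GreenAssumption.hasDerivAt_integral_contourIntegrand
    (hG : GreenAssumption T V M N G α Gext a Gt p A B) (hF : IsEntireOfMinimalType F)
    (hθ : θ ∈ Icc 0 α) (ht : t ∈ timeInterval T) (hx : x ∈ dotReal)
    (hc : 0 < ε * Real.cos (2 * θ) + a t * Real.sin (2 * θ)) :
    Integrable (fun y => deriv (fun ξ => contourIntegrand Gext F ε θ t ξ y) x) ∧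
    HasDerivAt (fun ξ => ∫ y, contourIntegrand Gext F ε θ t ξ y)
      (∫ y, deriv (fun ξ => contourIntegrand Gext F ε θ t ξ y) x) x := by
  obtain ⟨δ, hδ, hball⟩ := Metric.nhds_basis_closedBall.mem_iff.1 (isOpen_dotReal.mem_nhds hx)
  obtain ⟨K, hK⟩ := hG.exists_gaussianRegime (isCompact_singleton.prod (isCompact_closedBall x δ))
    (prod_mono (singleton_subset_iff.2 ht) hball)
  obtain ⟨C, -, hC⟩ := hG.exists_norm_deriv_integrand_le hc K
  obtain ⟨AF, hAF⟩ := hF.bound _ (div_pos hc (by norm_num : (0 : ℝ) < 16))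
  have hFc := hF.differentiable.continuous
  refine hasDerivAt_integral_of_dominated_loc_of_deriv_le
    (F := fun ξ y => contourIntegrand Gext F ε θ t ξ y)
    (F' := fun x y => deriv (fun ξ => contourIntegrand Gext F ε θ t ξ y) x)
    (Metric.closedBall_mem_nhds x hδ) ?_ (hG.integrable_contourIntegrand hF hθ ht hx hc)
    (hG.stronglyMeasurable_deriv_contourIntegrand hFc ε hθ ht hx).aestronglyMeasurable
    (Eventually.of_forall fun y ξ hξ => hC hAF (m := 1) le_rfl (hK ⟨rfl, hξ⟩ hθ le_rfl) y)
    (integrable_const_mul_gaussian _ hc) (Eventually.of_forall fun y ξ hξ =>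
      (hG.differentiableAt_contourIntegrand ε hθ ht (hball hξ) y).hasDerivAt)
  filter_upwards [isOpen_dotReal.mem_nhds hx] with ξ hξ
  exact (hG.stronglyMeasurable_contourIntegrand hFc ε hθ ht hξ).aestronglyMeasurable

lemma GreenAssumption.isAC_integral_deriv_contourIntegrand
    (hG : GreenAssumption T V M N G α Gext a Gt p A B) (hF : IsEntireOfMinimalType F)
    (hθ : θ ∈ Icc 0 α) (ht : t ∈ timeInterval T)
    (hc : 0 < ε * Real.cos (2 * θ) + a t * Real.sin (2 * θ)) {I : Set ℝ} (hI : IsOpen I)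
    (hI' : I.OrdConnected) (hsub : I ⊆ dotReal)
    (hAC : ∀ y, IsAC (deriv fun ξ => contourIntegrand Gext F ε θ t ξ y) I) :
    IsAC (fun x => ∫ y, deriv (fun ξ => contourIntegrand Gext F ε θ t ξ y) x) I ∧
      ∀ᵐ x : ℝ, x ∈ I →
      Integrable (fun y => deriv (deriv fun ξ => contourIntegrand Gext F ε θ t ξ y) x) ∧
      HasDerivAt (fun x => ∫ y, deriv (fun ξ => contourIntegrand Gext F ε θ t ξ y) x)
        (∫ y, deriv (deriv fun ξ => contourIntegrand Gext F ε θ t ξ y) x) x := by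
  refine isAC_integral hI hI' (f := fun y => deriv fun ξ => contourIntegrand Gext F ε θ t ξ y)
    (fun s hs => hG.stronglyMeasurable_deriv_contourIntegrand hF.differentiable.continuous ε hθ ht
      (hsub hs)) hAC
    (fun s hs => (hG.hasDerivAt_integral_contourIntegrand hF hθ ht (hsub hs) hc).1)
    fun S hSI hS => ?_
  obtain ⟨K, hK⟩ := hG.exists_gaussianRegime (isCompact_singleton.prod hS)
    (prod_mono (singleton_subset_iff.2 ht) (hSI.trans hsub))
  obtain ⟨C, -, hC⟩ := hG.exists_norm_deriv_deriv_integrand_le hc K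
  obtain ⟨AF, hAF⟩ := hF.bound _ (div_pos hc (by norm_num : (0 : ℝ) < 16))
  refine ⟨fun _ => 1, _, integrableOn_const hS.measure_lt_top.ne,
    integrable_const_mul_gaussian (AF * C) hc, fun y => ?_⟩
  have hreg : ∀ᵐ x, x ∈ dotReal → y ≠ 0 →
      DifferentiableAt ℝ (deriv fun ξ => Gext t ξ (ray 0 θ y)) x ∧
        ‖deriv (deriv fun ξ => Gt t ξ (ray 0 θ y)) x‖
          ≤ A 2 t x * Real.exp (B 2 t x * ‖ray 0 θ y‖ ^ p) := by
    by_cases hy : y = 0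
    · exact Eventually.of_forall fun _ _ hy' => absurd hy hy'
    · have hz := ray_zero_mem_doubleSector hG.angle hθ hy
      filter_upwards [((hG.mem _ hz).space_deriv t ht).ae_differentiableAt,
        hG.bound_xx t ht _ hz] with x hdiff hbound hx _ using ⟨hdiff hx, hbound hx⟩
  filter_upwards [hreg] with x hx hxS
  rw [one_mul]
  exact hC hAF (hK ⟨rfl, hxS⟩ hθ le_rfl) (hx (hsub (hSI hxS)))

lemma GreenAssumption.isACDot_deriv_integral
    (hG : GreenAssumption T V M N G α Gext a Gt p A B) (hF : IsEntireOfMinimalType F)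
    (hθ : θ ∈ Icc 0 α) (ht : t ∈ timeInterval T)
    (hc : 0 < ε * Real.cos (2 * θ) + a t * Real.sin (2 * θ)) :
    IsACDot (deriv fun ξ => ∫ y, contourIntegrand Gext F ε θ t ξ y) ∧ ∀ᵐ x : ℝ, x ∈ dotReal →
      Integrable (fun y => deriv (deriv fun ξ => contourIntegrand Gext F ε θ t ξ y) x) ∧
      deriv (deriv fun ξ => ∫ y, contourIntegrand Gext F ε θ t ξ y) x
        = ∫ y, deriv (deriv fun ξ => contourIntegrand Gext F ε θ t ξ y) x := by
  have hderiv : EqOn (fun x => ∫ y, deriv (fun ξ => contourIntegrand Gext F ε θ t ξ y) x)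
      (deriv fun ξ => ∫ y, contourIntegrand Gext F ε θ t ξ y) dotReal := fun x hx =>
    (hG.hasDerivAt_integral_contourIntegrand hF hθ ht hx hc).2.deriv.symm
  obtain ⟨hneg, hneg'⟩ := hG.isAC_integral_deriv_contourIntegrand hF hθ ht hc isOpen_Iio
    ordConnected_Iio Iio_subset_dotReal fun y => (hG.isACDot_deriv_contourIntegrand ε hθ ht y).1
  obtain ⟨hpos, hpos'⟩ := hG.isAC_integral_deriv_contourIntegrand hF hθ ht hc isOpen_Ioi
    ordConnected_Ioi Ioi_subset_dotReal fun y => (hG.isACDot_deriv_contourIntegrand ε hθ ht y).2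
  refine ⟨⟨hneg.congr (hderiv.mono Iio_subset_dotReal), hpos.congr (hderiv.mono
    Ioi_subset_dotReal)⟩, ?_⟩
  filter_upwards [hneg', hpos'] with x hxneg hxpos hx
  have heq : (fun x => ∫ y, deriv (fun ξ => contourIntegrand Gext F ε θ t ξ y) x) =ᶠ[𝓝 x]
      deriv fun ξ => ∫ y, contourIntegrand Gext F ε θ t ξ y :=
    hderiv.eventuallyEq_of_mem (isOpen_dotReal.mem_nhds hx)
  rw [← heq.deriv_eq]
  rcases lt_or_gt_of_ne (show x ≠ 0 from hx) with hx' | hx'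
  · exact ⟨(hxneg hx').1, (hxneg hx').2.deriv⟩
  · exact ⟨(hxpos hx').1, (hxpos hx').2.deriv⟩

lemma GreenAssumption.rate_pos (hG : GreenAssumption T V M N G α Gext a Gt p A B)
    (hsin : 0 < Real.sin (2 * θ)) (ht : t ∈ timeInterval T) :
    0 < 0 * Real.cos (2 * θ) + a t * Real.sin (2 * θ) := by
  rw [zero_mul, zero_add]
  exact mul_pos (hG.a_pos t ht) hsin

lemma GreenAssumption.isAC_integral_time
    (hG : GreenAssumption T V M N G α Gext a Gt p A B) (hF : IsEntireOfMinimalType F)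
    (hθ : θ ∈ Icc 0 α) (hsin : 0 < Real.sin (2 * θ)) (hx : x ∈ dotReal) :
    IsAC (fun t => ∫ y, contourIntegrand Gext F 0 θ t x y) (timeInterval T) ∧
      ∀ᵐ t : ℝ, t ∈ timeInterval T →
      Integrable (fun y => deriv (fun τ => contourIntegrand Gext F 0 θ τ x y) t) ∧
      HasDerivAt (fun τ => ∫ y, contourIntegrand Gext F 0 θ τ x y)
        (∫ y, deriv (fun τ => contourIntegrand Gext F 0 θ τ x y) t) t := by
  have hI := isOpen_timeInterval T
  have hI' := ordConnected_timeInterval T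
  refine isAC_integral hI hI' (f := fun y τ => contourIntegrand Gext F 0 θ τ x y)
    (fun s hs => hG.stronglyMeasurable_contourIntegrand hF.differentiable.continuous 0 hθ hs hx)
    (fun y => hG.isAC_contourIntegrand_time 0 hθ hx y)
    (fun s hs => hG.integrable_contourIntegrand hF hθ hs hx (hG.rate_pos hsin hs))
    fun S hSI hS => ?_
  obtain ⟨c, hc, hmin⟩ := hS.exists_forall_le'
    (continuousOn_const.add (((hG.a_ac.continuousOn hI hI').mono hSI).mul continuousOn_const))
    fun s hs => hG.rate_pos hsin (hSI hs)
  obtain ⟨K, hK⟩ := hG.exists_gaussianRegime (hS.prod isCompact_singleton)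
    (prod_mono hSI (singleton_subset_iff.2 hx))
  obtain ⟨C, -, hC⟩ := hG.exists_norm_deriv_time_integrand_le hc K
  obtain ⟨AF, hAF⟩ := hF.bound _ (div_pos hc (by norm_num : (0 : ℝ) < 16))
  refine ⟨fun t => 1 + |deriv a t|, _, ?_, integrable_const_mul_gaussian (AF * C) hc, fun y => ?_⟩
  · exact (integrableOn_const hS.measure_lt_top.ne).add
      ((hG.a_ac.locallyIntegrableOn_deriv hI hI').integrableOn_compact_subset hSI hS).norm
  have hreg : ∀ᵐ t, t ∈ timeInterval T → y ≠ 0 →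
      DifferentiableAt ℝ (fun τ => Gext τ x (ray 0 θ y)) t ∧
        ‖deriv (fun τ => Gt τ x (ray 0 θ y)) t‖
          ≤ A 2 t x * Real.exp (B 2 t x * ‖ray 0 θ y‖ ^ p) := by
    by_cases hy : y = 0
    · exact Eventually.of_forall fun _ _ hy' => absurd hy hy'
    · have hz := ray_zero_mem_doubleSector hG.angle hθ hy
      filter_upwards [((hG.mem _ hz).time x hx).ae_differentiableAt hI hI',
        hG.bound_t x hx _ hz] with t hdiff hbound ht _ using ⟨hdiff ht, hbound ht⟩
  filter_upwards [hreg, hG.a_ac.ae_differentiableAt hI hI'] with t ht hdiff htS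
  exact hC hAF (hK ⟨htS, rfl⟩ hθ (hmin t htS)) (hdiff (hSI htS)) (ht (hSI htS))

lemma isAC_of_continuousOn_deriv {E : Type*} [NormedAddCommGroup E] [NormedSpace ℝ E]
    [CompleteSpace E] {f : ℝ → E} {I : Set ℝ} (hI : MeasurableSet I) (hI' : I.OrdConnected)
    (hf : ∀ x ∈ I, DifferentiableAt ℝ f x) (hf' : ContinuousOn (deriv f) I) : IsAC f I :=
  ⟨deriv f, hf'.locallyIntegrableOn hI, fun _ hx _ hy =>
    have hsub := hI'.uIcc_subset hx hy
    (intervalIntegral.integral_eq_sub_of_hasDerivAt (fun s hs => (hf s (hsub hs)).hasDerivAt)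
      (hf'.mono hsub).intervalIntegrable).symm⟩

theorem GreenAssumption.memAC12_integral
    (hG : GreenAssumption T V M N G α Gext a Gt p A B) (hF : IsEntireOfMinimalType F)
    (hθ : θ ∈ Icc 0 α) (hsin : 0 < Real.sin (2 * θ)) :
    MemAC12 T fun t x => ∫ y, contourIntegrand Gext F 0 θ t x y := by
  have hdiff : ∀ t ∈ timeInterval T, ∀ x ∈ dotReal,
      DifferentiableAt ℝ (fun x => ∫ y, contourIntegrand Gext F 0 θ t x y) x := fun t ht x hx =>
    (hG.hasDerivAt_integral_contourIntegrand hF hθ ht hx (hG.rate_pos hsin ht)).2.differentiableAt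
  have hderiv := fun t (ht : t ∈ timeInterval T) =>
    (hG.isACDot_deriv_integral hF hθ ht (hG.rate_pos hsin ht)).1
  refine ⟨fun x hx => (hG.isAC_integral_time hF hθ hsin hx).1, fun t ht => ⟨?_, ?_⟩, hdiff, hderiv⟩
  · exact isAC_of_continuousOn_deriv measurableSet_Iio ordConnected_Iio
      (fun x hx => hdiff t ht x (Iio_subset_dotReal hx))
      ((hderiv t ht).continuousOn.mono Iio_subset_dotReal)
  · exact isAC_of_continuousOn_deriv measurableSet_Ioi ordConnected_Ioi
      (fun x hx => hdiff t ht x (Ioi_subset_dotReal hx))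
      ((hderiv t ht).continuousOn.mono Ioi_subset_dotReal)

end ContourIntegral

section MeasurableFamilies

variable {Q : Type*} [MeasurableSpace Q] {k : Q → ℝ → ℝ → ℂ} {U W : Set ℝ}

/-- A measurably parametrised family of separately continuous functions on `U × W`, with continuous
first derivative in the second variable. For such families the partial derivatives are jointly
measurable, which allows the exchange of null sets in partial differential equations. -/
structure MeasurableFamily (k : Q → ℝ → ℝ → ℂ) (U W : Set ℝ) : Prop where
  measurable : ∀ t ∈ U, ∀ x ∈ W, StronglyMeasurable fun s => k s t x
  continuousOn_fst : ∀ s, ∀ x ∈ W, ContinuousOn (fun t => k s t x) U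
  continuousOn_snd : ∀ s, ∀ t ∈ U, ContinuousOn (k s t) W
  continuousOn_deriv : ∀ s, ∀ t ∈ U, ContinuousOn (deriv (k s t)) W

lemma indicator_apply_comm (g : ℝ → ℝ → ℂ) (t x : ℝ) :
    U.indicator g t x = U.indicator (fun t => g t x) t := by
  by_cases ht : t ∈ U <;> simp [indicator, ht]

lemma continuousOn_indicator_apply {g : ℝ → ℝ → ℂ} (hg : ∀ t ∈ U, ContinuousOn (g t) W) (t : ℝ) :
    ContinuousOn (U.indicator g t) W := by
  by_cases ht : t ∈ U
  · rw [indicator_of_mem ht]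
    exact hg t ht
  · rw [indicator_of_notMem ht]
    exact continuousOn_const

lemma deriv_indicator_apply (g : ℝ → ℝ → ℂ) (t : ℝ) :
    deriv (U.indicator g t) = U.indicator (fun t => deriv (g t)) t := by
  by_cases ht : t ∈ U
  · rw [indicator_of_mem ht, indicator_of_mem ht]
  · rw [indicator_of_notMem ht, indicator_of_notMem ht]
    exact deriv_const' 0

lemma indicator_prod_eq_indicator_indicator (g : ℝ → ℝ → ℂ) (P : ℝ × ℝ) :
    (U ×ˢ W).indicator (fun P => g P.1 P.2) P = W.indicator (U.indicator g P.1) P.2 := by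
  by_cases hU : P.1 ∈ U <;> by_cases hW : P.2 ∈ W <;> simp [indicator, hU, hW]

namespace MeasurableFamily

lemma stronglyMeasurable_cutoff (hk : MeasurableFamily k U W) (hU : IsOpen U) {x : ℝ}
    (hx : x ∈ W) : StronglyMeasurable fun r : Q × ℝ => U.indicator (k r.1) r.2 x := by
  simp only [indicator_apply_comm]
  exact stronglyMeasurable_indicator_of_continuousOn (f := fun s t => k s t x) hU
    (fun t ht => hk.measurable t ht x hx) fun s => hk.continuousOn_fst s x hx

lemma stronglyMeasurable (hk : MeasurableFamily k U W) (hU : IsOpen U) (hW : IsOpen W) :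
    StronglyMeasurable fun r : Q × ℝ × ℝ =>
      (U ×ˢ W).indicator (fun P => k r.1 P.1 P.2) r.2 := by
  simp only [indicator_prod_eq_indicator_indicator]
  exact (stronglyMeasurable_indicator_of_continuousOn
    (f := fun r : Q × ℝ => U.indicator (k r.1) r.2) hW
    (fun x hx => hk.stronglyMeasurable_cutoff hU hx)
    fun r => continuousOn_indicator_apply (hk.continuousOn_snd r.1) r.2).comp_measurable
    (g := fun r : Q × ℝ × ℝ => ((r.1, r.2.1), r.2.2)) (by fun_prop)

lemma stronglyMeasurable_deriv_fst (hk : MeasurableFamily k U W) (hU : IsOpen U)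
    (hW : IsOpen W) : StronglyMeasurable fun r : Q × ℝ × ℝ =>
      (U ×ˢ W).indicator (fun P => deriv (fun t => k r.1 t P.2) P.1) r.2 := by
  have hcut : ∀ t ∈ U, StronglyMeasurable fun r : Q × ℝ =>
      W.indicator (fun x t => k r.1 t x) r.2 t := fun t ht => by
    simp only [indicator_apply_comm]
    exact stronglyMeasurable_indicator_of_continuousOn (f := fun s x => k s t x) hW
      (hk.measurable t ht) fun s => hk.continuousOn_snd s t ht
  convert (stronglyMeasurable_indicator_deriv
    (f := fun r : Q × ℝ => W.indicator (fun x t => k r.1 t x) r.2) hU hcut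
    fun r => continuousOn_indicator_apply (hk.continuousOn_fst r.1) r.2).comp_measurable
    (g := fun r : Q × ℝ × ℝ => ((r.1, r.2.2), r.2.1)) (by fun_prop) using 1
  funext r
  by_cases ht : r.2.1 ∈ U <;> by_cases hx : r.2.2 ∈ W <;>
    simp [indicator, ht, hx]

lemma stronglyMeasurable_deriv_deriv_snd (hk : MeasurableFamily k U W) (hU : IsOpen U)
    (hW : IsOpen W) : StronglyMeasurable fun r : Q × ℝ × ℝ =>
      (U ×ˢ W).indicator (fun P => deriv (deriv (k r.1 P.1)) P.2) r.2 := by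
  have hcont := fun r : Q × ℝ => continuousOn_indicator_apply (hk.continuousOn_snd r.1) r.2
  have hcut : ∀ r : Q × ℝ × ℝ,
      (U ×ˢ W).indicator (fun P => deriv (deriv (k r.1 P.1)) P.2) r.2
        = W.indicator (deriv (deriv (U.indicator (k r.1) r.2.1))) r.2.2 := fun r => by
    rw [deriv_indicator_apply, deriv_indicator_apply]
    exact indicator_prod_eq_indicator_indicator (fun t => deriv (deriv (k r.1 t))) r.2
  simp only [hcut]
  refine (stronglyMeasurable_indicator_deriv
    (f := fun r : Q × ℝ => deriv (U.indicator (k r.1) r.2)) hW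
    (fun x hx => stronglyMeasurable_deriv_of_continuousOn hW
      (fun x hx => hk.stronglyMeasurable_cutoff hU hx) hcont hx)
    fun r => ?_).comp_measurable (g := fun r : Q × ℝ × ℝ => ((r.1, r.2.1), r.2.2)) (by fun_prop)
  rw [deriv_indicator_apply]
  exact continuousOn_indicator_apply (hk.continuousOn_deriv r.1) r.2

end MeasurableFamily

end MeasurableFamilies

section NullSets

variable {Y P : Type*} [MeasurableSpace Y] [MeasurableSpace P] {μ : Measure Y} {ν : Measure P}
  [SFinite μ] [SFinite ν]

/- The multiplier `v` need not be measurable. It is eliminated by cross-multiplication, which turns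
the equations at `y` and at the points of a countable family into a measurable condition. -/
lemma ae_ae_eq_mul_of_forall_ae {ι : Type*} [Countable ι] {H K : Y → P → ℂ}
    (hH : Measurable (Function.uncurry H)) (hK : Measurable (Function.uncurry K)) {v : P → ℂ}
    (h : ∀ y, ∀ᵐ P ∂ν, H y P = v P * K y P) (d : ι → Y)
    (hd : ∀ P, (∀ i, K (d i) P = 0) → ∀ y, K y P = 0) :
    ∀ᵐ P ∂ν, ∀ᵐ y ∂μ, H y P = v P * K y P := by
  have hfamily : ∀ᵐ P ∂ν, ∀ i, H (d i) P = v P * K (d i) P := ae_all_iff.2 fun i => h (d i)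
  have hmeas : MeasurableSet {r : Y × P |
      (∀ i, H r.1 r.2 * K (d i) r.2 = H (d i) r.2 * K r.1 r.2) ∧
      (K r.1 r.2 ≠ 0 ∨ H r.1 r.2 = 0)} := by
    have hHd : ∀ i, Measurable fun r : Y × P => H (d i) r.2 := fun i =>
      hH.comp (measurable_const.prodMk measurable_snd)
    have hKd : ∀ i, Measurable fun r : Y × P => K (d i) r.2 := fun i =>
      hK.comp (measurable_const.prodMk measurable_snd)
    simp only [ofPred_and, ofPred_forall, ofPred_or]
    exact (MeasurableSet.iInter fun i => measurableSet_eq_fun (hH.mul (hKd i))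
      ((hHd i).mul hK)).inter ((measurableSet_eq_fun hK measurable_const).compl.union
        (measurableSet_eq_fun hH measurable_const))
  have hcross := (Measure.ae_ae_comm (μ := μ) (ν := ν) (p := fun y P =>
    (∀ i, H y P * K (d i) P = H (d i) P * K y P) ∧ (K y P ≠ 0 ∨ H y P = 0)) hmeas).1 <|
      Eventually.of_forall fun y => by
        filter_upwards [hfamily, h y] with P hfamily hy
        refine ⟨fun i => by rw [hfamily i, hy]; ring, ?_⟩
        rw [hy, ← imp_iff_not_or]
        exact fun hKy => by rw [hKy, mul_zero]
  filter_upwards [hfamily, hcross] with P hfamily hcross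
  filter_upwards [hcross] with y ⟨hmul, hzero⟩
  by_cases hK0 : ∃ i, K (d i) P ≠ 0
  · obtain ⟨i, hi⟩ := hK0
    refine mul_right_cancel₀ hi ?_
    rw [hmul i, hfamily i]
    ring
  · have hKy := hd P (not_exists_not.1 hK0) y
    rw [hzero.resolve_left (not_not.2 hKy), hKy, mul_zero]

end NullSets

section DifferentiationUnderIntegral

variable {Y : Type*} [MeasurableSpace Y] {μ : Measure Y} [SFinite μ] {k : Y → ℝ → ℝ → ℂ}
  {U W : Set ℝ} {Φ : ℝ → ℝ → ℂ}

lemma measurableSet_integrable_and_eq_integral {P : Type*} [MeasurableSpace P] {Ω : Set P}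
    {D : Y → P → ℂ} {φ : P → ℂ} (hΩ : MeasurableSet Ω)
    (hD : StronglyMeasurable fun r : Y × P => Ω.indicator (D r.1) r.2)
    (hφ : StronglyMeasurable (Ω.indicator φ)) :
    MeasurableSet {P | P ∈ Ω → Integrable (D · P) μ ∧ φ P = ∫ y, D y P ∂μ} := by
  have hD' : StronglyMeasurable (Function.uncurry fun P y => Ω.indicator (D y) P) :=
    hD.comp_measurable measurable_swap
  have heq : {P | P ∈ Ω → Integrable (D · P) μ ∧ φ P = ∫ y, D y P ∂μ}
      = Ωᶜ ∪ ({P | Integrable (fun y => Ω.indicator (D y) P) μ} ∩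
        {P | Ω.indicator φ P = ∫ y, Ω.indicator (D y) P ∂μ}) := by
    ext P
    by_cases hP : P ∈ Ω <;> simp [hP]
  rw [heq]
  exact hΩ.compl.union ((measurableSet_integrable hD').inter
    (hφ.measurableSet_eq_fun hD'.integral_prod_right))

namespace MeasurableFamily

lemma ae_deriv_fst_eq_integral (hk : MeasurableFamily k U W)
    (hΦ : MeasurableFamily (fun _ : Unit => Φ) U W) (hU : IsOpen U) (hW : IsOpen W)
    (h : ∀ x ∈ W, ∀ᵐ t, t ∈ U → Integrable (fun y => deriv (fun t => k y t x) t) μ ∧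
      deriv (fun t => Φ t x) t = ∫ y, deriv (fun t => k y t x) t ∂μ) :
    ∀ᵐ P : ℝ × ℝ, P ∈ U ×ˢ W → Integrable (fun y => deriv (fun t => k y t P.2) P.1) μ ∧
      deriv (fun t => Φ t P.2) P.1 = ∫ y, deriv (fun t => k y t P.2) P.1 ∂μ := by
  have hmeas := measurableSet_integrable_and_eq_integral (μ := μ)
    (D := fun y P => deriv (fun t => k y t P.2) P.1)
    (hU.prod hW).measurableSet (hk.stronglyMeasurable_deriv_fst hU hW)
    ((hΦ.stronglyMeasurable_deriv_fst hU hW).comp_measurable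
      (measurable_prodMk_left (x := ())))
  refine (Measure.ae_prod_mem_iff_ae_ae_mem hmeas).2 ((Measure.ae_ae_comm hmeas).2 ?_)
  refine Eventually.of_forall fun x => ?_
  by_cases hx : x ∈ W
  · filter_upwards [h x hx] with t ht hP using ht hP.1
  · exact Eventually.of_forall fun t hP => absurd hP.2 hx

lemma ae_deriv_deriv_snd_eq_integral (hk : MeasurableFamily k U W)
    (hΦ : MeasurableFamily (fun _ : Unit => Φ) U W) (hU : IsOpen U) (hW : IsOpen W)
    (h : ∀ t ∈ U, ∀ᵐ x, x ∈ W → Integrable (fun y => deriv (deriv (k y t)) x) μ ∧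
      deriv (deriv (Φ t)) x = ∫ y, deriv (deriv (k y t)) x ∂μ) :
    ∀ᵐ P : ℝ × ℝ, P ∈ U ×ˢ W → Integrable (fun y => deriv (deriv (k y P.1)) P.2) μ ∧
      deriv (deriv (Φ P.1)) P.2 = ∫ y, deriv (deriv (k y P.1)) P.2 ∂μ := by
  have hmeas := measurableSet_integrable_and_eq_integral (μ := μ)
    (D := fun y P => deriv (deriv (k y P.1)) P.2)
    (hU.prod hW).measurableSet (hk.stronglyMeasurable_deriv_deriv_snd hU hW)
    ((hΦ.stronglyMeasurable_deriv_deriv_snd hU hW).comp_measurable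
      (measurable_prodMk_left (x := ())))
  refine (Measure.ae_prod_mem_iff_ae_ae_mem hmeas).2 (Eventually.of_forall fun t => ?_)
  by_cases ht : t ∈ U
  · filter_upwards [h t ht] with x hx hP using hx hP.2
  · exact Eventually.of_forall fun x hP => absurd hP.1 ht

lemma ae_ae_schroedinger (hk : MeasurableFamily k U W) (hU : IsOpen U) (hW : IsOpen W)
    {V : ℝ → ℝ → ℂ} {ι : Type*} [Countable ι] (d : ι → Y)
    (hd : ∀ t ∈ U, ∀ x ∈ W, (∀ i, k (d i) t x = 0) → ∀ y, k y t x = 0)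
    (h : ∀ y, ∀ᵐ P : ℝ × ℝ, P ∈ U ×ˢ W →
      Complex.I * deriv (fun t => k y t P.2) P.1 + deriv (deriv (k y P.1)) P.2
        = V P.1 P.2 * k y P.1 P.2) :
    ∀ᵐ P : ℝ × ℝ, P ∈ U ×ˢ W → ∀ᵐ y ∂μ,
      Complex.I * deriv (fun t => k y t P.2) P.1 + deriv (deriv (k y P.1)) P.2
        = V P.1 P.2 * k y P.1 P.2 := by
  have hae := ae_ae_eq_mul_of_forall_ae (μ := μ) (ν := (volume : Measure (ℝ × ℝ)))
    (H := fun y => Complex.I • (U ×ˢ W).indicator (fun P => deriv (fun t => k y t P.2) P.1)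
      + (U ×ˢ W).indicator fun P => deriv (deriv (k y P.1)) P.2)
    (K := fun y => (U ×ˢ W).indicator fun P => k y P.1 P.2)
    (((hk.stronglyMeasurable_deriv_fst hU hW).const_smul Complex.I).add
      (hk.stronglyMeasurable_deriv_deriv_snd hU hW)).measurable
    (hk.stronglyMeasurable hU hW).measurable (v := fun P => V P.1 P.2) (fun y => ?_) d
    fun P hP y => ?_
  · filter_upwards [hae] with P hP hPΩ
    simpa only [Pi.add_apply, Pi.smul_apply, smul_eq_mul, indicator_of_mem hPΩ] using hP
  · filter_upwards [h y] with P hP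
    by_cases hPΩ : P ∈ U ×ˢ W
    · simpa only [Pi.add_apply, Pi.smul_apply, smul_eq_mul, indicator_of_mem hPΩ] using hP hPΩ
    · simp only [Pi.add_apply, Pi.smul_apply, indicator_of_notMem hPΩ, smul_zero, mul_zero,
        add_zero]
  · by_cases hPΩ : P ∈ U ×ˢ W
    · simp only [indicator_of_mem hPΩ] at hP ⊢
      exact hd _ hPΩ.1 _ hPΩ.2 hP y
    · exact indicator_of_notMem hPΩ _

end MeasurableFamily

end DifferentiationUnderIntegral

section Schroedinger

variable {T : EReal} {V : ℝ → ℝ → ℂ} {M N : Matrix (Fin 2) (Fin 2) ℂ} {G : ℝ → ℝ → ℝ → ℂ}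
  {α : ℝ} {Gext : ℝ → ℝ → ℂ → ℂ} {a : ℝ → ℝ} {Gt : ℝ → ℝ → ℂ → ℂ} {p : ℝ}
  {A B : Fin 3 → ℝ → ℝ → ℝ} {F : ℂ → ℂ} {θ : ℝ}

lemma eq_zero_of_forall_rat_eq_zero {f : ℝ → ℂ} (hf : ContinuousOn f {0}ᶜ) (hf0 : f 0 = 0)
    (h : ∀ r : ℚ, f r = 0) (y : ℝ) : f y = 0 := by
  by_cases hy : y = 0
  · rw [hy, hf0]
  have hmem : y ∈ closure ({0}ᶜ ∩ range ((↑) : ℚ → ℝ)) :=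
    Rat.denseRange_cast.open_subset_closure_inter isOpen_compl_singleton hy
  have himage : f '' ({0}ᶜ ∩ range ((↑) : ℚ → ℝ)) ⊆ {0} := by
    rintro _ ⟨_, ⟨_, r, rfl⟩, rfl⟩
    exact h r
  exact closure_minimal himage isClosed_singleton
    (((hf y hy).mono inter_subset_left).mem_closure_image hmem)

lemma MemAC12.measurableFamily {Ψ : ℝ → ℝ → ℂ} (h : MemAC12 T Ψ) :
    MeasurableFamily (fun _ : Unit => Ψ) (timeInterval T) dotReal where
  measurable _ _ _ _ := stronglyMeasurable_const
  continuousOn_fst _ x hx :=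
    (h.time x hx).continuousOn (isOpen_timeInterval T) (ordConnected_timeInterval T)
  continuousOn_snd _ t ht := (h.space t ht).continuousOn
  continuousOn_deriv _ t ht := (h.space_deriv t ht).continuousOn

lemma GreenAssumption.measurableFamily (hG : GreenAssumption T V M N G α Gext a Gt p A B)
    (hF : Continuous F) (hθ : θ ∈ Icc 0 α) :
    MeasurableFamily (fun y t x => contourIntegrand Gext F 0 θ t x y) (timeInterval T) dotReal where
  measurable _ ht _ hx := hG.stronglyMeasurable_contourIntegrand hF 0 hθ ht hx
  continuousOn_fst y _ hx := (hG.isAC_contourIntegrand_time 0 hθ hx y).continuousOn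
    (isOpen_timeInterval T) (ordConnected_timeInterval T)
  continuousOn_snd y _ ht := hG.continuousOn_contourIntegrand_space 0 hθ ht y
  continuousOn_deriv y _ ht := (hG.isACDot_deriv_contourIntegrand 0 hθ ht y).continuousOn

lemma GreenAssumption.ae_schroedinger_contourIntegrand
    (hG : GreenAssumption T V M N G α Gext a Gt p A B) (ε : ℝ) (hθ : θ ∈ Icc 0 α) (y : ℝ) :
    ∀ᵐ P : ℝ × ℝ, P ∈ timeInterval T ×ˢ dotReal →
      Complex.I * deriv (fun t => contourIntegrand Gext F ε θ t P.2 y) P.1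
        + deriv (deriv fun x => contourIntegrand Gext F ε θ P.1 x y) P.2
      = V P.1 P.2 * contourIntegrand Gext F ε θ P.1 P.2 y := by
  by_cases hy : y = 0
  · simp only [hy, contourIntegrand_zero, deriv_const', mul_zero, add_zero, implies_true,
      Eventually.of_forall]
  · filter_upwards [hG.schroedinger _ (ray_zero_mem_doubleSector hG.angle hθ hy)] with P hP hPΩ
    rw [deriv_time_contourIntegrand, deriv_deriv_contourIntegrand, contourIntegrand]
    linear_combination contourWeight F ε θ y * hP hPΩ.1 hPΩ.2

theorem GreenAssumption.schroedinger_integral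
    (hG : GreenAssumption T V M N G α Gext a Gt p A B) (hF : IsEntireOfMinimalType F)
    (hθ : θ ∈ Icc 0 α) (hsin : 0 < Real.sin (2 * θ)) :
    SatisfiesSchroedinger T V fun t x => ∫ y, contourIntegrand Gext F 0 θ t x y := by
  have hFc := hF.differentiable.continuous
  have hI := isOpen_timeInterval T
  have hk := hG.measurableFamily hFc hθ
  have hΦ := (hG.memAC12_integral hF hθ hsin).measurableFamily
  have hpde := hk.ae_ae_schroedinger (μ := volume) hI isOpen_dotReal ((↑) : ℚ → ℝ)
    (fun t ht x hx => eq_zero_of_forall_rat_eq_zero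
      (hG.continuousOn_contourIntegrand hFc 0 hθ ht hx) (contourIntegrand_zero 0 θ t x))
    (hG.ae_schroedinger_contourIntegrand 0 hθ)
  have htime := hk.ae_deriv_fst_eq_integral (μ := volume) hΦ hI isOpen_dotReal fun x hx => by
    filter_upwards [(hG.isAC_integral_time hF hθ hsin hx).2] with t h ht
      using ⟨(h ht).1, (h ht).2.deriv⟩
  have hspace := hk.ae_deriv_deriv_snd_eq_integral (μ := volume) hΦ hI isOpen_dotReal
    fun t ht => (hG.isACDot_deriv_integral hF hθ ht (hG.rate_pos hsin ht)).2
  filter_upwards [hpde, htime, hspace] with P hpde htime hspace ht hx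
  obtain ⟨hint, heq⟩ := htime ⟨ht, hx⟩
  obtain ⟨hint', heq'⟩ := hspace ⟨ht, hx⟩
  have hsum := integral_congr_ae (hpde ⟨ht, hx⟩)
  rw [integral_add (hint.const_mul _) hint', integral_const_mul, integral_const_mul, ← heq,
    ← heq'] at hsum
  linear_combination hsum

end Schroedinger

section Representation

variable {T : EReal} {V : ℝ → ℝ → ℂ} {M N : Matrix (Fin 2) (Fin 2) ℂ} {G : ℝ → ℝ → ℝ → ℂ}
  {α : ℝ} {Gext : ℝ → ℝ → ℂ → ℂ} {a : ℝ → ℝ} {Gt : ℝ → ℝ → ℂ → ℂ} {p : ℝ}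
  {A B : Fin 3 → ℝ → ℝ → ℝ} {F : ℂ → ℂ} {ε θ t x s : ℝ}

lemma integral_eq_interval_add_tails {f : ℝ → ℂ} (hf : Integrable f) (s : ℝ) :
    ∫ y, f y = (∫ y in (-s)..s, f y) + ((∫ r in Ioi (0 : ℝ), f (s + r))
      + ∫ r in Ioi (0 : ℝ), f (-(s + r))) := by
  have hshift : ∀ g : ℝ → ℂ, ∫ y in Ioi s, g y = ∫ r in Ioi (0 : ℝ), g (s + r) := fun g => by
    rw [← (measurePreserving_add_left volume s).setIntegral_preimage_emb
      (measurableEmbedding_addLeft s) g (Ioi s), preimage_const_add_Ioi, sub_self]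
  rw [← hshift f, ← hshift fun y => f (-y), integral_comp_neg_Ioi, ← add_assoc,
    intervalIntegral.integral_interval_add_Ioi hf.integrableOn hf.integrableOn, add_comm,
    intervalIntegral.integral_Iic_add_Ioi hf.integrableOn hf.integrableOn]

lemma GreenAssumption.exists_norm_mul_le (hG : GreenAssumption T V M N G α Gext a Gt p A B)
    (hF : IsEntireOfMinimalType F) (K : ℝ) {δ : ℝ} (hδ : 0 < δ) :
    ∃ C : ℝ, ∀ {t x : ℝ}, t ∈ timeInterval T → x ∈ dotReal → B 0 t x ≤ K → ∀ z ∈ doubleSector α,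
      ‖Gext t x z * F z‖ ≤ A 0 t x * C * Real.exp (-a t * ((z - x) ^ 2).im + δ * ‖z‖ ^ 2) := by
  obtain ⟨C, hC, hCexp⟩ := exists_exp_mul_rpow_le hG.order K (half_pos hδ)
  obtain ⟨AF, hAF⟩ := hF.bound (δ / 2) (half_pos hδ)
  refine ⟨C * AF, fun {t x} ht hx hK z hz => ?_⟩
  have hA := hG.A_nonneg 0 t ht x hx
  rw [hG.decomposition t ht x hx z hz, norm_mul, norm_mul, norm_exp_I_mul_sq]
  calc _ ≤ Real.exp (-a t * ((z - x) ^ 2).im) * (A 0 t x * (C * Real.exp (δ / 2 * ‖z‖ ^ 2)))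
        * (AF * Real.exp (δ / 2 * ‖z‖ ^ 2)) := by
        gcongr
        · exact (hG.bound t ht x hx z hz).trans
            (mul_le_mul_of_nonneg_left (hCexp _ hK _ (norm_nonneg z)) hA)
        · exact hAF z
    _ = A 0 t x * (C * AF) * Real.exp (-a t * ((z - x) ^ 2).im + δ * ‖z‖ ^ 2) := by
        rw [← add_halves δ, add_mul, Real.exp_add, Real.exp_add, add_halves]
        ring

lemma GreenAssumption.exists_norm_mul_le_rightSector
    (hG : GreenAssumption T V M N G α Gext a Gt p A B) (hF : IsEntireOfMinimalType F) (K : ℝ)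
    {δ : ℝ} (hδ : 0 < δ) :
    ∃ C : ℝ, ∀ {t x : ℝ}, t ∈ timeInterval T → x ∈ dotReal → B 0 t x ≤ K → ∀ z ∈ rightSector α,
      ‖Gext t x z * F z‖ ≤ A 0 t x * C * Real.exp (-a t * ((z - x) ^ 2).im + δ * ‖z‖ ^ 2) ∧
      ‖Gext t x (-z) * F (-z)‖
        ≤ A 0 t x * C * Real.exp (-a t * ((z - (-x : ℝ)) ^ 2).im + δ * ‖z‖ ^ 2) := by
  obtain ⟨C, hC⟩ := hG.exists_norm_mul_le hF K hδ
  refine ⟨C, fun {t x} ht hx hK z hz => ?_⟩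
  have hmem := rightSector_subset_doubleSector hG.angle.1 hz
  have hneg := hC ht hx hK (-z) (neg_mem_doubleSector hmem)
  rw [norm_neg, ← neg_add', neg_sq] at hneg
  refine ⟨hC ht hx hK z hmem, ?_⟩
  rwa [Complex.ofReal_neg, sub_neg_eq_add]

lemma GreenAssumption.sectorGaussian_right
    (hG : GreenAssumption T V M N G α Gext a Gt p A B) (hF : IsEntireOfMinimalType F)
    (ht : t ∈ timeInterval T) (hx : x ∈ dotReal) :
    SectorGaussian α (fun z => Gext t x z * F z) (a t) x where
  continuousOn := ((hG.continuousOn t ht x hx).mono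
    (rightSector_subset_doubleSector hG.angle.1)).mul hF.differentiable.continuous.continuousOn
  differentiableOn := ((hG.holomorphic t ht x hx).mono
    (openRightSector_subset_interior_doubleSector hG.angle.1)).mul
      hF.differentiable.differentiableOn
  bound δ hδ := by
    obtain ⟨C, hC⟩ := hG.exists_norm_mul_le_rightSector hF (B 0 t x) hδ
    exact ⟨A 0 t x * C, fun z hz => (hC ht hx le_rfl z hz).1⟩

lemma GreenAssumption.sectorGaussian_left
    (hG : GreenAssumption T V M N G α Gext a Gt p A B) (hF : IsEntireOfMinimalType F)
    (ht : t ∈ timeInterval T) (hx : x ∈ dotReal) :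
    SectorGaussian α (fun z => Gext t x (-z) * F (-z)) (a t) (-x) where
  continuousOn := ((hG.continuousOn t ht x hx).comp continuous_neg.continuousOn fun _ hz =>
    neg_mem_doubleSector (rightSector_subset_doubleSector hG.angle.1 hz)).mul
      (hF.differentiable.continuous.comp continuous_neg).continuousOn
  differentiableOn := ((hG.holomorphic t ht x hx).comp differentiable_neg.differentiableOn
    fun _ hz => neg_mem_interior_doubleSector
      (openRightSector_subset_interior_doubleSector hG.angle.1 hz)).mul
      (hF.differentiable.comp differentiable_neg).differentiableOn
  bound δ hδ := by
    obtain ⟨C, hC⟩ := hG.exists_norm_mul_le_rightSector hF (B 0 t x) hδ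
    exact ⟨A 0 t x * C, fun z hz => (hC ht hx le_rfl z hz).2⟩

lemma contourIntegrand_zero_angle (Gext : ℝ → ℝ → ℂ → ℂ) (F : ℂ → ℂ) (ε t x : ℝ) {y : ℝ}
    (hy : y ≠ 0) : contourIntegrand Gext F ε 0 t x y
      = Complex.exp (-(ε : ℂ) * (y : ℂ) ^ 2) * (Gext t x y * F y) := by
  rw [contourIntegrand, contourWeight, if_neg hy, ray_zero_angle]
  simp only [Complex.ofReal_zero, zero_mul, Complex.exp_zero, one_mul, zero_add]
  ring

lemma half_mem_Icc (hα : α ∈ Ioo 0 (Real.pi / 2)) : α / 2 ∈ Icc 0 α :=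
  ⟨(half_pos hα.1).le, half_le_self hα.1.le⟩

lemma sin_two_mul_half_pos (hα : α ∈ Ioo 0 (Real.pi / 2)) : 0 < Real.sin (2 * (α / 2)) := by
  rw [mul_div_cancel₀ _ two_ne_zero]
  exact Real.sin_pos_of_pos_of_lt_pi hα.1 (by linarith [hα.2, Real.pi_pos])

lemma GreenAssumption.regularized_rate_pos (hG : GreenAssumption T V M N G α Gext a Gt p A B)
    (hε : 0 < ε) (hθ : θ ∈ Icc 0 (α / 2)) (ht : t ∈ timeInterval T) :
    0 < ε * Real.cos (2 * θ) + a t * Real.sin (2 * θ) := by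
  have hcos : 0 < Real.cos (2 * θ) := Real.cos_pos_of_mem_Ioo
    ⟨by linarith [hθ.1, Real.pi_pos], by linarith [hθ.2, hG.angle.2]⟩
  have hsin : 0 ≤ Real.sin (2 * θ) := Real.sin_nonneg_of_nonneg_of_le_pi (by linarith [hθ.1])
    (by linarith [hG.angle.2, Real.pi_pos, hθ.2])
  have ha := hG.a_pos t ht
  positivity

lemma GreenAssumption.integrable_contourIntegrand_regularized
    (hG : GreenAssumption T V M N G α Gext a Gt p A B) (hF : IsEntireOfMinimalType F)
    (hε : 0 < ε) (hθ : θ ∈ Icc 0 (α / 2)) (ht : t ∈ timeInterval T) (hx : x ∈ dotReal) :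
    Integrable (contourIntegrand Gext F ε θ t x) :=
  hG.integrable_contourIntegrand hF ⟨hθ.1, hθ.2.trans (half_le_self hG.angle.1.le)⟩ ht hx
    (hG.regularized_rate_pos hε hθ ht)

lemma GreenAssumption.regIntegrand_ae_eq (hG : GreenAssumption T V M N G α Gext a Gt p A B)
    (F : ℂ → ℂ) (ε : ℝ) (ht : t ∈ timeInterval T) (hx : x ∈ dotReal) :
    regIntegrand G F t x ε =ᵐ[volume] contourIntegrand Gext F ε 0 t x := by
  filter_upwards [Measure.ae_ne volume (0 : ℝ)] with y hy
  rw [contourIntegrand_zero_angle _ _ _ _ _ hy, regIntegrand, hG.extends_G t ht x hx y hy]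
  push_cast
  ring

lemma GreenAssumption.integral_contourIntegrand_real
    (hG : GreenAssumption T V M N G α Gext a Gt p A B) (hF : IsEntireOfMinimalType F)
    (hε : 0 < ε) (hs : 0 ≤ s) (ht : t ∈ timeInterval T) (hx : x ∈ dotReal) :
    ∫ y, contourIntegrand Gext F ε 0 t x y = (∫ y in (-s)..s, contourIntegrand Gext F ε 0 t x y)
      + (rayIntegral (fun z => Complex.exp (-(ε : ℂ) * z ^ 2) * (Gext t x z * F z)) s 0
      + rayIntegral (fun z => Complex.exp (-(ε : ℂ) * z ^ 2) * (Gext t x (-z) * F (-z))) s 0) := by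
  rw [integral_eq_interval_add_tails (hG.integrable_contourIntegrand_regularized hF hε
    ⟨le_rfl, (half_pos hG.angle.1).le⟩ ht hx) s, rayIntegral_zero_angle, rayIntegral_zero_angle]
  congr 2
  · refine setIntegral_congr_fun measurableSet_Ioi fun r (hr : 0 < r) => ?_
    simp only [contourIntegrand_zero_angle Gext F ε t x (show s + r ≠ 0 by positivity),
      Complex.ofReal_add]
  · refine setIntegral_congr_fun measurableSet_Ioi fun r (hr : 0 < r) => ?_
    simp only [contourIntegrand_zero_angle Gext F ε t x
      (show -(s + r) ≠ 0 from neg_ne_zero.2 (by positivity)), Complex.ofReal_neg,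
      Complex.ofReal_add, neg_sq]

lemma integral_contourIntegrand_eq_rayIntegral
    (hint : Integrable (contourIntegrand Gext F ε θ t x)) :
    ∫ y, contourIntegrand Gext F ε θ t x y =
      rayIntegral (fun z => Complex.exp (-(ε : ℂ) * z ^ 2) * (Gext t x z * F z)) 0 θ
      + rayIntegral (fun z => Complex.exp (-(ε : ℂ) * z ^ 2) * (Gext t x (-z) * F (-z))) 0 θ := by
  rw [integral_eq_interval_add_tails hint 0, neg_zero, intervalIntegral.integral_same, zero_add]
  congr 1
  · refine setIntegral_congr_fun measurableSet_Ioi fun r (hr : 0 < r) => ?_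
    simp only [zero_add, contourIntegrand, contourWeight, if_neg hr.ne']
    ring
  · refine setIntegral_congr_fun measurableSet_Ioi fun r (hr : 0 < r) => ?_
    have hneg : ray 0 θ (-r) = -ray 0 θ r := by rw [← ray_neg, neg_zero]
    simp only [zero_add, contourIntegrand, contourWeight, if_neg (neg_ne_zero.2 hr.ne'),
      hneg, neg_sq]
    ring

lemma GreenAssumption.integral_contourIntegrand_rotate
    (hG : GreenAssumption T V M N G α Gext a Gt p A B) (hF : IsEntireOfMinimalType F)
    (hε : 0 < ε) (ht : t ∈ timeInterval T) (hx : x ∈ dotReal) :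
    ∫ y, contourIntegrand Gext F ε 0 t x y = ∫ y, contourIntegrand Gext F ε (α / 2) t x y := by
  have hα := hG.angle
  have ha := (hG.a_pos t ht).le
  have hint := fun {θ} (hθ : θ ∈ Icc 0 (α / 2)) =>
    hG.integrable_contourIntegrand_regularized hF hε hθ ht hx
  rw [integral_contourIntegrand_eq_rayIntegral (hint ⟨le_rfl, (half_pos hα.1).le⟩),
    integral_contourIntegrand_eq_rayIntegral (hint ⟨(half_pos hα.1).le, le_rfl⟩),
    (hG.sectorGaussian_right hF ht hx).rayIntegral_eq hα ha le_rfl hε,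
    (hG.sectorGaussian_left hF ht hx).rayIntegral_eq hα ha le_rfl hε]

lemma GreenAssumption.tendsto_intervalIntegral_contourIntegrand
    (hG : GreenAssumption T V M N G α Gext a Gt p A B) (hF : IsEntireOfMinimalType F)
    (hs : 0 ≤ s) (ht : t ∈ timeInterval T) (hx : x ∈ dotReal) :
    Tendsto (fun ε => ∫ y in (-s)..s, contourIntegrand Gext F ε 0 t x y) (𝓝[>] 0)
      (𝓝 (∫ y in (-s)..s, G t x y * F y)) := by
  have hα := hG.angle
  have hne := Measure.ae_ne volume (0 : ℝ)
  refine intervalIntegral.tendsto_integral_filter_of_dominated_convergence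
    (fun y => Real.exp (s ^ 2) * ‖contourIntegrand Gext F 1 0 t x y‖) ?_ ?_ ?_ ?_
  · exact Eventually.of_forall fun ε => (hG.stronglyMeasurable_contourIntegrand
      hF.differentiable.continuous ε ⟨le_rfl, hα.1.le⟩ ht hx).aestronglyMeasurable
  · filter_upwards [self_mem_nhdsWithin] with ε (hε : 0 < ε)
    filter_upwards [hne] with y hy hys
    rw [uIoc_of_le (by linarith)] at hys
    have hsq : y ^ 2 ≤ s ^ 2 := sq_le_sq' hys.1.le hys.2
    have hre : ((y : ℂ) ^ 2).re = y ^ 2 := by rw [← Complex.ofReal_pow, Complex.ofReal_re]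
    rw [contourIntegrand_zero_angle _ _ _ _ _ hy, contourIntegrand_zero_angle _ _ _ _ _ hy,
      norm_mul, norm_mul (Complex.exp _), norm_exp_neg_mul_sq, norm_exp_neg_mul_sq, hre,
      ← mul_assoc, ← Real.exp_add]
    gcongr
    nlinarith [mul_nonneg hε.le (sq_nonneg y)]
  · exact ((hG.integrable_contourIntegrand_regularized hF one_pos
      ⟨le_rfl, (half_pos hα.1).le⟩ ht hx).norm.const_mul _).intervalIntegrable
  · filter_upwards [hne] with y hy _
    simp only [contourIntegrand_zero_angle _ _ _ _ _ hy, ← hG.extends_G t ht x hx y hy]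
    refine Tendsto.mono_left (Continuous.tendsto' (by fun_prop) _ _ ?_) nhdsWithin_le_nhds
    simp

lemma GreenAssumption.tendsto_integral_split
    (hG : GreenAssumption T V M N G α Gext a Gt p A B) (hF : IsEntireOfMinimalType F)
    (hs : 0 ≤ s) (ht : t ∈ timeInterval T) (hx : x ∈ dotReal) :
    Tendsto (fun ε => ∫ y, regIntegrand G F t x ε y) (𝓝[>] 0)
      (𝓝 ((∫ y in (-s)..s, G t x y * F y) + (rayIntegral (fun z => Gext t x z * F z) s (α / 2)
        + rayIntegral (fun z => Gext t x (-z) * F (-z)) s (α / 2)))) := by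
  have ha := hG.a_pos t ht
  refine Tendsto.congr' ?_ ((hG.tendsto_intervalIntegral_contourIntegrand hF hs ht hx).add
    (((hG.sectorGaussian_right hF ht hx).tendsto_rayIntegral hG.angle ha hs).add
      ((hG.sectorGaussian_left hF ht hx).tendsto_rayIntegral hG.angle ha hs)))
  filter_upwards [self_mem_nhdsWithin] with ε (hε : 0 < ε)
  rw [integral_congr_ae (hG.regIntegrand_ae_eq F ε ht hx),
    hG.integral_contourIntegrand_real hF hε hs ht hx]

lemma GreenAssumption.waveFunction_eq_split
    (hG : GreenAssumption T V M N G α Gext a Gt p A B) (hF : IsEntireOfMinimalType F)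
    (hs : 0 ≤ s) (ht : t ∈ timeInterval T) (hx : x ∈ dotReal) :
    waveFunction G F t x = (∫ y in (-s)..s, G t x y * F y)
      + (rayIntegral (fun z => Gext t x z * F z) s (α / 2)
        + rayIntegral (fun z => Gext t x (-z) * F (-z)) s (α / 2)) :=
  (hG.tendsto_integral_split hF hs ht hx).limUnder_eq

lemma GreenAssumption.waveFunction_eq_integral
    (hG : GreenAssumption T V M N G α Gext a Gt p A B) (hF : IsEntireOfMinimalType F)
    (ht : t ∈ timeInterval T) (hx : x ∈ dotReal) :
    waveFunction G F t x = ∫ y, contourIntegrand Gext F 0 (α / 2) t x y := by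
  rw [hG.waveFunction_eq_split hF le_rfl ht hx, integral_contourIntegrand_eq_rayIntegral
    (hG.integrable_contourIntegrand hF (half_mem_Icc hG.angle) ht hx
      (hG.rate_pos (sin_two_mul_half_pos hG.angle) ht))]
  simp only [neg_zero, intervalIntegral.integral_same, zero_add, Complex.ofReal_zero, zero_mul,
    Complex.exp_zero, one_mul]

lemma GreenAssumption.tendsto_integral_regIntegrand
    (hG : GreenAssumption T V M N G α Gext a Gt p A B) (hF : IsEntireOfMinimalType F)
    (ht : t ∈ timeInterval T) (hx : x ∈ dotReal) :
    Tendsto (fun ε => ∫ y, regIntegrand G F t x ε y) (𝓝[>] 0) (𝓝 (waveFunction G F t x)) :=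
  tendsto_nhds_limUnder ⟨_, hG.tendsto_integral_split hF le_rfl ht hx⟩

lemma GreenAssumption.integrable_regIntegrand
    (hG : GreenAssumption T V M N G α Gext a Gt p A B) (hF : IsEntireOfMinimalType F)
    (hε : 0 < ε) (ht : t ∈ timeInterval T) (hx : x ∈ dotReal) :
    Integrable (regIntegrand G F t x ε) :=
  (hG.integrable_contourIntegrand_regularized hF hε ⟨le_rfl, (half_pos hG.angle.1).le⟩ ht
    hx).congr (hG.regIntegrand_ae_eq F ε ht hx).symm

end Representation

section DominatedFamilies

variable {ι κ X : Type*} [MeasurableSpace X] {μ : Measure X} {l : Filter ι} {k : Filter κ}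
  {f : ι → X → ℂ}

/-- A family of functions that eventually satisfies the hypotheses of the dominated convergence
theorem along the filter `l`. -/
def DominatedAlong (μ : Measure X) (l : Filter ι) (f : ι → X → ℂ) : Prop :=
  ∃ b : X → ℝ, Integrable b μ ∧ ∀ᶠ i in l, Integrable (f i) μ ∧ ∀ y, ‖f i y‖ ≤ b y

lemma DominatedAlong.integrable_and_tendsto [l.NeBot] [l.IsCountablyGenerated]
    (hf : DominatedAlong μ l f) {g : X → ℂ} (hlim : ∀ y, Tendsto (fun i => f i y) l (𝓝 (g y))) :
    Integrable g μ ∧ Tendsto (fun i => ∫ y, f i y ∂μ) l (𝓝 (∫ y, g y ∂μ)) := by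
  obtain ⟨b, hb, hfb⟩ := hf
  refine ⟨?_, tendsto_integral_filter_of_dominated_convergence b
    (hfb.mono fun i hi => hi.1.aestronglyMeasurable)
    (hfb.mono fun i hi => Eventually.of_forall hi.2) hb (Eventually.of_forall hlim)⟩
  obtain ⟨i, hil, hi⟩ := exists_seq_forall_of_frequently hfb.frequently
  refine hb.mono' (aestronglyMeasurable_of_tendsto_ae atTop
    (fun n => (hi n).1.aestronglyMeasurable) (Eventually.of_forall fun y => (hlim y).comp hil)) ?_
  exact Eventually.of_forall fun y => le_of_tendsto (hlim y).norm (hfb.mono fun i hi => hi.2 y)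

lemma DominatedAlong.tendstoUniformlyOnFilter_integral_mul [k.IsCountablyGenerated]
    (hf : DominatedAlong μ l f) {φ : κ → X → ℂ} (hφ : ∀ j, AEStronglyMeasurable (φ j) μ)
    (hφ_le : ∀ᶠ j in k, ∀ y, ‖φ j y‖ ≤ 1) (hφ_lim : ∀ y, Tendsto (fun j => φ j y) k (𝓝 1)) :
    TendstoUniformlyOnFilter (fun j i => ∫ y, φ j y * f i y ∂μ) (fun i => ∫ y, f i y ∂μ) k l := by
  obtain ⟨b, hb, hfb⟩ := hf
  have hsub_le : ∀ᶠ j in k, ∀ y, ‖(1 - φ j y) * (b y : ℂ)‖ ≤ 2 * ‖b y‖ := by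
    filter_upwards [hφ_le] with j hj y
    rw [norm_mul, Complex.norm_real]
    gcongr
    refine (norm_sub_le _ _).trans ?_
    rw [norm_one]
    linarith [hj y]
  have hsub_meas : ∀ j, AEStronglyMeasurable (fun y => (1 - φ j y) * (b y : ℂ)) μ := fun j =>
    (aestronglyMeasurable_const.sub (hφ j)).mul hb.ofReal.aestronglyMeasurable
  have herror : Tendsto (fun j => ∫ y, ‖(1 - φ j y) * (b y : ℂ)‖ ∂μ) k (𝓝 0) := by
    rw [← integral_zero X ℝ (μ := μ)]
    refine tendsto_integral_filter_of_dominated_convergence _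
      (Eventually.of_forall fun j => (hsub_meas j).norm) ?_ (hb.norm.const_mul 2) ?_
    · filter_upwards [hsub_le] with j hj
      exact Eventually.of_forall fun y => by simpa only [norm_norm] using hj y
    · refine Eventually.of_forall fun y => ?_
      simpa using (((hφ_lim y).const_sub 1).mul_const (b y : ℂ)).norm
  rw [Metric.tendstoUniformlyOnFilter_iff]
  intro ε hε
  filter_upwards [((herror.eventually_lt_const hε).and (hφ_le.and hsub_le)).prod_mk hfb]
    with ⟨j, i⟩ ⟨⟨hj, hφj, hsubj⟩, hfi, hfi_le⟩
  have hmul : Integrable (fun y => φ j y * f i y) μ :=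
    hfi.bdd_mul (hφ j) (Eventually.of_forall hφj)
  rw [dist_eq_norm, ← integral_sub hfi hmul]
  refine lt_of_le_of_lt (norm_integral_le_of_norm_le
    ((hb.norm.const_mul 2).mono' (hsub_meas j).norm
      (Eventually.of_forall fun y => by simpa only [norm_norm] using hsubj y))
    (Eventually.of_forall fun y => ?_)) hj
  rw [← one_sub_mul, norm_mul, norm_mul, Complex.norm_real]
  exact mul_le_mul_of_nonneg_left ((hfi_le y).trans (le_abs_self _)) (norm_nonneg _)

lemma exists_tendsto_of_tendstoUniformlyOnFilter {Y : Type*} [UniformSpace Y] [CompleteSpace Y]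
    [l.NeBot] [k.NeBot] {F : κ → ι → Y} {g : ι → Y} {L : κ → Y}
    (hunif : TendstoUniformlyOnFilter F g k l) (hlim : ∀ᶠ j in k, Tendsto (F j) l (𝓝 (L j))) :
    ∃ c, Tendsto g l (𝓝 c) ∧ Tendsto L k (𝓝 c) := by
  have hcauchy : Cauchy (map L k) := by
    refine cauchy_map_iff'.2 (uniformity_hasBasis_closed.tendsto_right_iff.2 fun U hU => ?_)
    filter_upwards [(hunif.uniformCauchySeqOnFilter U hU.1).curry, hlim.prod_mk hlim]
      with ⟨i, j⟩ hclose ⟨hi, hj⟩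
    exact hU.2.mem_of_tendsto (hi.prodMk_nhds hj) hclose
  obtain ⟨c, hc⟩ := cauchy_map_iff_exists_tendsto.1 hcauchy
  exact ⟨c, hunif.tendsto_of_eventually_tendsto hlim hc, hc⟩

end DominatedFamilies

section RegularizedIntegrals

variable {F : ℂ → ℂ} {u v : ℝ → ℂ} {b c : ℂ}

/-- `c` is the regularised integral `lim_{ε → 0⁺} ∫ e^{-εy²} u(y) F(y) dy`, and the integrals with
`ε > 0` are absolutely convergent. -/
structure HasRegularizedIntegral (F : ℂ → ℂ) (u : ℝ → ℂ) (c : ℂ) : Prop where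
  integrable : ∀ ε > 0, Integrable fun y => contourWeight F ε 0 y * u y
  tendsto : Tendsto (fun ε => ∫ y, contourWeight F ε 0 y * u y) (𝓝[>] 0) (𝓝 c)

lemma hasRegularizedIntegral_zero : HasRegularizedIntegral F (fun _ => 0) 0 :=
  ⟨by simp, by simp⟩

lemma HasRegularizedIntegral.const_mul (hu : HasRegularizedIntegral F u c) (r : ℂ) :
    HasRegularizedIntegral F (fun y => r * u y) (r * c) := by
  refine ⟨fun ε hε => ?_, ?_⟩
  · simpa only [mul_left_comm _ r] using (hu.integrable ε hε).const_mul r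
  · simpa only [mul_left_comm _ r, integral_const_mul] using hu.tendsto.const_mul r

lemma HasRegularizedIntegral.add (hu : HasRegularizedIntegral F u b)
    (hv : HasRegularizedIntegral F v c) :
    HasRegularizedIntegral F (fun y => u y + v y) (b + c) := by
  refine ⟨fun ε hε => ?_, (hu.tendsto.add hv.tendsto).congr' ?_⟩
  · simp only [mul_add]
    exact (hu.integrable ε hε).add (hv.integrable ε hε)
  · filter_upwards [self_mem_nhdsWithin] with ε hε
    simp only [mul_add, integral_add (hu.integrable ε hε) (hv.integrable ε hε)]

lemma HasRegularizedIntegral.unique (hu : HasRegularizedIntegral F u b)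
    (hv : HasRegularizedIntegral F v c) (huv : EqOn u v dotReal) : b = c := by
  refine tendsto_nhds_unique hu.tendsto (hv.tendsto.congr fun ε => integral_congr_ae ?_)
  filter_upwards [Measure.ae_ne volume (0 : ℝ)] with y hy using by rw [huv hy]

lemma mulVec_eq_of_hasRegularizedIntegral {M N : Matrix (Fin 2) (Fin 2) ℂ} {up um dp dm : ℝ → ℂ}
    {cup cum cdp cdm : ℂ} (hup : HasRegularizedIntegral F up cup)
    (hum : HasRegularizedIntegral F um cum) (hdp : HasRegularizedIntegral F dp cdp)
    (hdm : HasRegularizedIntegral F dm cdm)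
    (h : ∀ y ∈ dotReal, M.mulVec ![up y, um y] = N.mulVec ![dp y, -dm y]) :
    M.mulVec ![cup, cum] = N.mulVec ![cdp, -cdm] := by
  funext i
  have hrow := ((hup.const_mul (M i 0)).add (hum.const_mul (M i 1))).unique
    ((hdp.const_mul (N i 0)).add (hdm.const_mul (-N i 1))) fun y hy => by
      simpa [Matrix.mulVec, dotProduct, Fin.sum_univ_two] using congrFun (h y hy) i
  simpa [Matrix.mulVec, dotProduct, Fin.sum_univ_two] using hrow

lemma contourWeight_eq_exp_mul (F : ℂ → ℂ) (ε θ y : ℝ) :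
    contourWeight F ε θ y
      = Complex.exp (-(ε : ℂ) * ray 0 θ y ^ 2) * contourWeight F 0 θ y := by
  unfold contourWeight
  split_ifs with hy
  · rw [mul_zero]
  · simp only [Complex.ofReal_zero, neg_zero, zero_mul, Complex.exp_zero, one_mul]
    ring

lemma norm_exp_neg_mul_ray_sq_le_one {ε θ : ℝ} (hε : 0 ≤ ε) (hθ : 0 ≤ Real.cos (2 * θ)) (y : ℝ) :
    ‖Complex.exp (-(ε : ℂ) * ray 0 θ y ^ 2)‖ ≤ 1 := by
  rw [norm_exp_neg_mul_sq, Real.exp_le_one_iff, sq_ray_re, neg_mul, neg_nonpos]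
  simp only [ne_eq, OfNat.ofNat_ne_zero, not_false_eq_true, zero_pow, mul_zero, zero_mul, zero_add]
  positivity

lemma exists_tendsto_hasRegularizedIntegral {l : Filter ℝ} [l.NeBot] [l.IsCountablyGenerated]
    {θ : ℝ} (hθ : 0 ≤ Real.cos (2 * θ)) {D : ℝ → ℝ → ℝ → ℂ}
    (hreal : ∀ ε > 0, DominatedAlong volume l fun x y => contourWeight F ε 0 y * D 0 x y)
    (hcontour : DominatedAlong volume l fun x y => contourWeight F 0 θ y * D θ x y)
    (hrotate : ∀ ε > 0, ∀ᶠ x in l, ∫ y, contourWeight F ε 0 y * D 0 x y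
      = ∫ y, contourWeight F ε θ y * D θ x y)
    (hlim : ∀ y ∈ dotReal, Tendsto (fun x => D 0 x y) l (𝓝 (u y))) :
    ∃ c, Tendsto (fun x => ∫ y, contourWeight F 0 θ y * D θ x y) l (𝓝 c) ∧
      HasRegularizedIntegral F u c := by
  have hpos : ∀ᶠ ε : ℝ in 𝓝[>] 0, 0 < ε := self_mem_nhdsWithin
  have hlim_weight : ∀ ε y, Tendsto (fun x => contourWeight F ε 0 y * D 0 x y) l
      (𝓝 (contourWeight F ε 0 y * u y)) := fun ε y => by
    by_cases hy : y = 0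
    · simp only [hy, contourWeight_zero, zero_mul, tendsto_const_nhds]
    · exact (hlim y hy).const_mul _
  have hlim_real := fun ε (hε : 0 < ε) => (hreal ε hε).integrable_and_tendsto (hlim_weight ε)
  have hunif := hcontour.tendstoUniformlyOnFilter_integral_mul (k := 𝓝[>] (0 : ℝ))
    (φ := fun ε y => Complex.exp (-(ε : ℂ) * ray 0 θ y ^ 2))
    (fun ε => by have := continuous_ray 0 θ; fun_prop)
    (hpos.mono fun ε hε => norm_exp_neg_mul_ray_sq_le_one hε.le hθ)
    (fun y => (Continuous.tendsto' (by fun_prop) _ _ (by simp)).mono_left nhdsWithin_le_nhds)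
  simp only [← mul_assoc, ← contourWeight_eq_exp_mul] at hunif
  obtain ⟨c, hc, hcu⟩ :=
    exists_tendsto_of_tendstoUniformlyOnFilter hunif
      (hpos.mono fun ε hε => (hlim_real ε hε).2.congr' (hrotate ε hε))
  exact ⟨c, hc, fun ε hε => (hlim_real ε hε).1, hcu⟩

end RegularizedIntegrals

section Transmission

variable {T : EReal} {V : ℝ → ℝ → ℂ} {M N : Matrix (Fin 2) (Fin 2) ℂ} {G : ℝ → ℝ → ℝ → ℂ}
  {α : ℝ} {Gext : ℝ → ℝ → ℂ → ℂ} {a : ℝ → ℝ} {Gt : ℝ → ℝ → ℂ → ℂ} {p : ℝ}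
  {A B : Fin 3 → ℝ → ℝ → ℝ} {F : ℂ → ℂ} {ε θ t : ℝ} {l : Filter ℝ} {u : ℝ → ℂ}

lemma GreenAssumption.eventually_gaussianRegime
    (hG : GreenAssumption T V M N G α Gext a Gt p A B) (ht : t ∈ timeInterval T) {m : Fin 3}
    (hb : ∀ j ≤ m, IsBoundedUnder (· ≤ ·) (𝓝[≠] 0) (A j t) ∧
      IsBoundedUnder (· ≤ ·) (𝓝[≠] 0) (B j t)) :
    ∃ K : ℝ, ∀ᶠ x in 𝓝[≠] 0, ∀ {c ε θ : ℝ}, θ ∈ Icc 0 α →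
      c ≤ ε * Real.cos (2 * θ) + a t * Real.sin (2 * θ) →
      GaussianRegime T α a A B m c K ε θ t x := by
  have hbound : ∀ j, ∃ Kj : ℝ, ∀ᶠ x in 𝓝[≠] 0, j ≤ m → A j t x ≤ Kj ∧ B j t x ≤ Kj := fun j => by
    by_cases hj : j ≤ m
    · obtain ⟨⟨KA, hKA⟩, KB, hKB⟩ := hb j hj
      rw [eventually_map] at hKA hKB
      refine ⟨max KA KB, ?_⟩
      filter_upwards [hKA, hKB] with x hA hB _ using ⟨le_max_of_le_left hA, le_max_of_le_right hB⟩
    · exact ⟨0, Eventually.of_forall fun x h => absurd h hj⟩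
  choose K hK using hbound
  refine ⟨1 + a t + ∑ j, |K j|, ?_⟩
  filter_upwards [eventually_all.2 hK, self_mem_nhdsWithin,
    nhdsWithin_le_nhds (Metric.ball_mem_nhds (0 : ℝ) one_pos)] with x hx hx0 hx1 c ε θ hθ hrate
  have ha := hG.a_pos t ht
  have hle : ∀ j, K j ≤ ∑ j, |K j| := fun j => (le_abs_self _).trans
    (Finset.single_le_sum (f := fun j => |K j|) (fun i _ => abs_nonneg _) (Finset.mem_univ j))
  have hsum : 0 ≤ ∑ j, |K j| := Finset.sum_nonneg fun i _ => abs_nonneg _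
  rw [Metric.mem_ball, Real.dist_0_eq_abs] at hx1
  refine ⟨hθ, ht, hx0, hrate, by linarith, by linarith, fun j hj => ?_⟩
  constructor <;> linarith [hle j, (hx j hj).1, (hx j hj).2]

lemma GreenAssumption.bounded_near_zero (hG : GreenAssumption T V M N G α Gext a Gt p A B)
    (hMN : M ≠ 0 ∨ N ≠ 0) (ht : t ∈ timeInterval T) : ∀ j ≤ (0 : Fin 3),
      IsBoundedUnder (· ≤ ·) (𝓝[≠] 0) (A j t) ∧ IsBoundedUnder (· ≤ ·) (𝓝[≠] 0) (B j t) := by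
  intro j hj
  obtain rfl : j = 0 := Fin.le_zero_iff.1 hj
  exact hG.bounded_zero hMN t ht

lemma GreenAssumption.bounded_near_zero_deriv
    (hG : GreenAssumption T V M N G α Gext a Gt p A B) (hN : N ≠ 0) (ht : t ∈ timeInterval T) :
    ∀ j ≤ (1 : Fin 3),
      IsBoundedUnder (· ≤ ·) (𝓝[≠] 0) (A j t) ∧ IsBoundedUnder (· ≤ ·) (𝓝[≠] 0) (B j t) := by
  intro j hj
  fin_cases j
  · exact hG.bounded_zero (Or.inr hN) t ht
  · exact hG.bounded_zero_x hN t ht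
  · exact absurd hj (by decide)

lemma GreenAssumption.dominatedAlong_contourIntegrand
    (hG : GreenAssumption T V M N G α Gext a Gt p A B) (hF : IsEntireOfMinimalType F)
    (hMN : M ≠ 0 ∨ N ≠ 0) (hθ : θ ∈ Icc 0 α) (ht : t ∈ timeInterval T)
    (hc : 0 < ε * Real.cos (2 * θ) + a t * Real.sin (2 * θ)) (hl : l ≤ 𝓝[≠] 0) :
    DominatedAlong volume l (contourIntegrand Gext F ε θ t) := by
  obtain ⟨K, hK⟩ := hG.eventually_gaussianRegime ht (hG.bounded_near_zero hMN ht)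
  obtain ⟨C, -, hC⟩ := hG.exists_norm_integrand_le hc K
  obtain ⟨AF, hAF⟩ := hF.bound _ (div_pos hc (by norm_num : (0 : ℝ) < 16))
  refine ⟨_, integrable_const_mul_gaussian (AF * C) hc, hl ?_⟩
  filter_upwards [hK, self_mem_nhdsWithin] with x hx hx0
  exact ⟨hG.integrable_contourIntegrand hF hθ ht hx0 hc, hC hAF (hx hθ le_rfl)⟩

lemma GreenAssumption.dominatedAlong_deriv_contourIntegrand
    (hG : GreenAssumption T V M N G α Gext a Gt p A B) (hF : IsEntireOfMinimalType F)
    (hN : N ≠ 0) (hθ : θ ∈ Icc 0 α) (ht : t ∈ timeInterval T)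
    (hc : 0 < ε * Real.cos (2 * θ) + a t * Real.sin (2 * θ)) (hl : l ≤ 𝓝[≠] 0) :
    DominatedAlong volume l fun x y => deriv (fun ξ => contourIntegrand Gext F ε θ t ξ y) x := by
  obtain ⟨K, hK⟩ := hG.eventually_gaussianRegime ht (hG.bounded_near_zero_deriv hN ht)
  obtain ⟨C, -, hC⟩ := hG.exists_norm_deriv_integrand_le hc K
  obtain ⟨AF, hAF⟩ := hF.bound _ (div_pos hc (by norm_num : (0 : ℝ) < 16))
  refine ⟨_, integrable_const_mul_gaussian (AF * C) hc, hl ?_⟩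
  filter_upwards [hK, self_mem_nhdsWithin] with x hx hx0
  exact ⟨(hG.hasDerivAt_integral_contourIntegrand hF hθ ht hx0 hc).1,
    hC hAF le_rfl (hx hθ le_rfl)⟩

lemma GreenAssumption.integral_deriv_contourIntegrand_rotate
    (hG : GreenAssumption T V M N G α Gext a Gt p A B) (hF : IsEntireOfMinimalType F)
    (hε : 0 < ε) (ht : t ∈ timeInterval T) {x : ℝ} (hx : x ∈ dotReal) :
    ∫ y, deriv (fun ξ => contourIntegrand Gext F ε 0 t ξ y) x
      = ∫ y, deriv (fun ξ => contourIntegrand Gext F ε (α / 2) t ξ y) x := by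
  have hderiv := fun {θ} (hθ : θ ∈ Icc 0 (α / 2)) => (hG.hasDerivAt_integral_contourIntegrand hF
    ⟨hθ.1, hθ.2.trans (half_le_self hG.angle.1.le)⟩ ht hx (hG.regularized_rate_pos hε hθ ht)).2
  have hα := half_pos hG.angle.1
  refine (hderiv ⟨le_rfl, hα.le⟩).unique ((hderiv ⟨hα.le, le_rfl⟩).congr_of_eventuallyEq ?_)
  filter_upwards [isOpen_dotReal.mem_nhds hx] with ξ hξ
  exact hG.integral_contourIntegrand_rotate hF hε ht hξ

lemma cos_two_mul_half_nonneg (hα : α ∈ Ioo 0 (Real.pi / 2)) : 0 ≤ Real.cos (2 * (α / 2)) := by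
  rw [mul_div_cancel₀ _ two_ne_zero]
  exact Real.cos_nonneg_of_mem_Icc ⟨by linarith [hα.1, Real.pi_pos], hα.2.le⟩

lemma GreenAssumption.exists_boundary_value [l.NeBot] [l.IsCountablyGenerated]
    (hG : GreenAssumption T V M N G α Gext a Gt p A B) (hF : IsEntireOfMinimalType F)
    (hMN : M ≠ 0 ∨ N ≠ 0) (ht : t ∈ timeInterval T) (hl : l ≤ 𝓝[≠] 0)
    (hu : ∀ y ∈ dotReal, Tendsto (fun x => G t x y) l (𝓝 (u y))) :
    ∃ c, Tendsto (fun x => ∫ y, contourIntegrand Gext F 0 (α / 2) t x y) l (𝓝 c) ∧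
      HasRegularizedIntegral F u c := by
  have hα := hG.angle
  have hdot : ∀ᶠ x in l, x ∈ dotReal := hl self_mem_nhdsWithin
  refine exists_tendsto_hasRegularizedIntegral (D := fun θ x y => Gext t x (ray 0 θ y))
    (cos_two_mul_half_nonneg hα) (fun ε hε => ?_) ?_ (fun ε hε => ?_) fun y hy => ?_
  · exact hG.dominatedAlong_contourIntegrand hF hMN ⟨le_rfl, hα.1.le⟩ ht
      (hG.regularized_rate_pos hε ⟨le_rfl, (half_pos hα.1).le⟩ ht) hl
  · exact hG.dominatedAlong_contourIntegrand hF hMN (half_mem_Icc hα) ht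
      (hG.rate_pos (sin_two_mul_half_pos hα) ht) hl
  · exact hdot.mono fun x hx => hG.integral_contourIntegrand_rotate hF hε ht hx
  · refine (hu y hy).congr' (hdot.mono fun x hx => ?_)
    simp only [ray_zero_angle, Complex.ofReal_zero, zero_add, hG.extends_G t ht x hx y hy]

lemma GreenAssumption.exists_boundary_deriv [l.NeBot] [l.IsCountablyGenerated]
    (hG : GreenAssumption T V M N G α Gext a Gt p A B) (hF : IsEntireOfMinimalType F)
    (hN : N ≠ 0) (ht : t ∈ timeInterval T) (hl : l ≤ 𝓝[≠] 0)
    (hu : ∀ y ∈ dotReal, Tendsto (deriv fun x => G t x y) l (𝓝 (u y))) :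
    ∃ c, Tendsto (deriv fun x => ∫ y, contourIntegrand Gext F 0 (α / 2) t x y) l (𝓝 c) ∧
      HasRegularizedIntegral F u c := by
  have hα := hG.angle
  have hrate := hG.rate_pos (sin_two_mul_half_pos hα) ht
  have hdot : ∀ᶠ x in l, x ∈ dotReal := hl self_mem_nhdsWithin
  have hderiv : ∀ᶠ x in l, deriv (fun ξ => ∫ y, contourIntegrand Gext F 0 (α / 2) t ξ y) x
      = ∫ y, contourWeight F 0 (α / 2) y * deriv (fun ξ => Gext t ξ (ray 0 (α / 2) y)) x :=
    hdot.mono fun x hx => by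
      simp only [deriv_contourIntegrand,
        (hG.hasDerivAt_integral_contourIntegrand hF (half_mem_Icc hα) ht hx hrate).2.deriv]
  simp only [tendsto_congr' hderiv]
  refine exists_tendsto_hasRegularizedIntegral
    (D := fun θ x y => deriv (fun ξ => Gext t ξ (ray 0 θ y)) x) (cos_two_mul_half_nonneg hα)
    (fun ε hε => ?_) ?_ (fun ε hε => ?_) fun y hy => ?_
  · simpa only [deriv_contourIntegrand] using hG.dominatedAlong_deriv_contourIntegrand hF hN
      ⟨le_rfl, hα.1.le⟩ ht (hG.regularized_rate_pos hε ⟨le_rfl, (half_pos hα.1).le⟩ ht) hl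
  · simpa only [deriv_contourIntegrand] using
      hG.dominatedAlong_deriv_contourIntegrand hF hN (half_mem_Icc hα) ht hrate hl
  · refine hdot.mono fun x hx => ?_
    simpa only [deriv_contourIntegrand] using
      hG.integral_deriv_contourIntegrand_rotate hF hε ht hx
  · refine (hu y hy).congr' (hdot.mono fun x hx => EventuallyEq.deriv_eq ?_)
    filter_upwards [isOpen_dotReal.mem_nhds hx] with ξ hξ
    rw [ray_zero_angle, Complex.ofReal_zero, zero_add, hG.extends_G t ht ξ hξ y hy]

lemma GreenAssumption.transmission_integral (hG : GreenAssumption T V M N G α Gext a Gt p A B)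
    (hF : IsEntireOfMinimalType F) (ht : t ∈ timeInterval T) :
    SatisfiesTransmission M N fun x => ∫ y, contourIntegrand Gext F 0 (α / 2) t x y := by
  by_cases hMN : M ≠ 0 ∨ N ≠ 0
  swap
  · obtain ⟨hM, hN⟩ := not_or.1 hMN
    exact ⟨0, 0, 0, 0, fun h => absurd h hMN, fun h => absurd h hN, by
      rw [not_not.1 hM, not_not.1 hN, Matrix.zero_mulVec, Matrix.zero_mulVec]⟩
  have htransmission := fun y (hy : y ∈ dotReal) => hG.transmission y hy t ht
  choose! up um dp dm hvalue hderiv hmulVec using htransmission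
  have hright : 𝓝[>] (0 : ℝ) ≤ 𝓝[≠] 0 := nhdsWithin_mono _ Ioi_subset_dotReal
  have hleft : 𝓝[<] (0 : ℝ) ≤ 𝓝[≠] 0 := nhdsWithin_mono _ Iio_subset_dotReal
  obtain ⟨cup, hcup, hup⟩ := hG.exists_boundary_value hF hMN ht hright
    fun y hy => (hvalue y hy hMN).1
  obtain ⟨cum, hcum, hum⟩ := hG.exists_boundary_value hF hMN ht hleft
    fun y hy => (hvalue y hy hMN).2
  by_cases hN : N = 0
  · refine ⟨cup, cum, 0, 0, fun _ => ⟨hcup, hcum⟩, fun h => absurd hN h, ?_⟩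
    refine mulVec_eq_of_hasRegularizedIntegral hup hum hasRegularizedIntegral_zero
      hasRegularizedIntegral_zero fun y hy => ?_
    rw [hmulVec y hy, hN, Matrix.zero_mulVec, Matrix.zero_mulVec]
  · obtain ⟨cdp, hcdp, hdp⟩ := hG.exists_boundary_deriv hF hN ht hright
      fun y hy => (hderiv y hy hN).1
    obtain ⟨cdm, hcdm, hdm⟩ := hG.exists_boundary_deriv hF hN ht hleft
      fun y hy => (hderiv y hy hN).2
    exact ⟨cup, cum, cdp, cdm, fun _ => ⟨hcup, hcum⟩, fun _ => ⟨hcdp, hcdm⟩,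
      mulVec_eq_of_hasRegularizedIntegral hup hum hdp hdm hmulVec⟩

end Transmission

section InitialCondition

variable {T : EReal} {V : ℝ → ℝ → ℂ} {M N : Matrix (Fin 2) (Fin 2) ℂ} {G : ℝ → ℝ → ℝ → ℂ}
  {α : ℝ} {Gext : ℝ → ℝ → ℂ → ℂ} {a : ℝ → ℝ} {Gt : ℝ → ℝ → ℂ → ℂ} {p : ℝ}
  {A B : Fin 3 → ℝ → ℝ → ℝ} {F : ℂ → ℂ} {x : ℝ}

lemma norm_rayIntegral_le {f : ℂ → ℂ} {b C s ξ : ℝ} (hα : α ∈ Ioo 0 (Real.pi / 2)) (hs : 0 ≤ s)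
    (hξ : ξ < s) (hb : 1 ≤ b) (hf : ∀ z ∈ rightSector α,
      ‖f z‖ ≤ C * Real.exp (-b * ((z - ξ) ^ 2).im + Real.sin α / 2 * ‖z‖ ^ 2)) :
    ‖rayIntegral f s (α / 2)‖
      ≤ C * Real.exp (Real.sin α * s ^ 2) / (b * (2 * (s - ξ) * Real.sin (α / 2))) := by
  have hsin : 0 ≤ Real.sin α :=
    Real.sin_nonneg_of_nonneg_of_le_pi hα.1.le (by linarith [hα.2, Real.pi_pos])
  have hhalf : 0 < Real.sin (α / 2) :=
    Real.sin_pos_of_pos_of_lt_pi (half_pos hα.1) (by linarith [hα.1, hα.2, Real.pi_pos])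
  set k := 2 * (s - ξ) * Real.sin (α / 2) with hk
  have hk0 : 0 < k := mul_pos (mul_pos two_pos (sub_pos.2 hξ)) hhalf
  have hrate : -(b * k) < 0 := neg_neg_of_pos (mul_pos (zero_lt_one.trans_le hb) hk0)
  have hpoint : ∀ r ∈ Ioi (0 : ℝ), ‖Complex.exp ((α / 2 : ℝ) * Complex.I) * f (ray s (α / 2) r)‖
      ≤ C * Real.exp (Real.sin α * s ^ 2) * Real.exp (-(b * k) * r) := fun r (hr : 0 < r) => by
    have hz := hf _ (ray_mem_rightSector hα hs hr (half_mem_Icc hα))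
    have hC : 0 ≤ C := nonneg_of_mul_nonneg_left ((norm_nonneg _).trans hz) (Real.exp_pos _)
    have hnorm : ‖ray s (α / 2) r‖ ^ 2 ≤ 2 * (s ^ 2 + r ^ 2) := by
      refine (pow_le_pow_left₀ (norm_nonneg _) (norm_ray_le s _ r) 2).trans ?_
      simpa only [sq_abs] using add_sq_le (a := |s|) (b := |r|)
    rw [norm_mul, Complex.norm_exp_ofReal_mul_I, one_mul, mul_assoc, ← Real.exp_add]
    refine hz.trans (mul_le_mul_of_nonneg_left (Real.exp_le_exp.2 ?_) hC)
    have hsq : Real.sin α * r ^ 2 ≤ b * (Real.sin α * r ^ 2) :=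
      le_mul_of_one_le_left (by positivity) hb
    rw [sq_ray_sub_im, mul_div_cancel₀ _ two_ne_zero,
      show 2 * (s - ξ) * r * Real.sin (α / 2) = k * r by rw [hk]; ring]
    linarith [mul_le_mul_of_nonneg_left hnorm (div_nonneg hsin two_pos.le)]
  calc ‖rayIntegral f s (α / 2)‖
      ≤ ∫ r in Ioi 0, C * Real.exp (Real.sin α * s ^ 2) * Real.exp (-(b * k) * r) :=
        norm_integral_le_of_norm_le ((integrableOn_exp_mul_Ioi hrate 0).const_mul _)
          (ae_restrict_of_forall_mem measurableSet_Ioi hpoint)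
    _ = C * Real.exp (Real.sin α * s ^ 2) / (b * k) := by
        rw [integral_const_mul, integral_exp_mul_Ioi hrate, mul_zero, Real.exp_zero, neg_div_neg_eq,
          mul_one_div]

lemma tendsto_rayIntegral_zero {ι : Type*} {l : Filter ι} {f : ι → ℂ → ℂ} {b C : ι → ℝ} {s ξ : ℝ}
    (hα : α ∈ Ioo 0 (Real.pi / 2)) (hs : 0 ≤ s) (hξ : ξ < s) (hb : Tendsto b l atTop)
    (hC : Tendsto (fun i => C i / b i) l (𝓝 0)) (hf : ∀ᶠ i in l, ∀ z ∈ rightSector α,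
      ‖f i z‖ ≤ C i * Real.exp (-b i * ((z - ξ) ^ 2).im + Real.sin α / 2 * ‖z‖ ^ 2)) :
    Tendsto (fun i => rayIntegral (f i) s (α / 2)) l (𝓝 0) := by
  have hlim := hC.mul_const (Real.exp (Real.sin α * s ^ 2) / (2 * (s - ξ) * Real.sin (α / 2)))
  rw [zero_mul] at hlim
  refine squeeze_zero_norm' ?_ hlim
  filter_upwards [hf, hb.eventually_ge_atTop 1] with i hfi hbi
  exact (norm_rayIntegral_le hα hs hξ hbi hfi).trans_eq (mul_div_mul_comm _ _ _ _)

lemma GreenAssumption.tendsto_div_a (hG : GreenAssumption T V M N G α Gext a Gt p A B)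
    (hT : 0 < T) (hx : x ∈ dotReal) : Tendsto (fun t => A 0 t x / a t) (𝓝[>] 0) (𝓝 0) := by
  have hbounded : IsBoundedUnder (· ≤ ·) (𝓝[>] 0) (norm ∘ fun t => A 0 t x / √(a t)) := by
    refine (hG.A_bounded_time x hx).mono_le ?_
    filter_upwards [eventually_mem_timeInterval hT] with t ht
    exact (Real.norm_of_nonneg (div_nonneg (hG.A_nonneg 0 t ht x hx) (Real.sqrt_nonneg _))).le
  refine ((Real.tendsto_sqrt_atTop.comp hG.a_lim).inv_tendsto_atTop.zero_mul_isBoundedUnder_le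
    hbounded).congr' ?_
  filter_upwards [eventually_mem_timeInterval hT] with t ht
  rw [Pi.inv_apply, Function.comp_apply, ← div_eq_inv_mul, div_div,
    Real.mul_self_sqrt (hG.a_pos t ht).le]

lemma GreenAssumption.tendsto_waveFunction (hG : GreenAssumption T V M N G α Gext a Gt p A B)
    (hT : 0 < T) (hF : IsEntireOfMinimalType F) (hx : x ∈ dotReal) :
    Tendsto (fun t => waveFunction G F t x) (𝓝[>] 0) (𝓝 (F x)) := by
  have hα := hG.angle
  obtain ⟨s, hxs, hinner⟩ := hG.initial x hx
  have hs : 0 ≤ s := (abs_nonneg x).trans hxs.le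
  obtain ⟨K, hK⟩ := hG.B_bounded_time x hx
  rw [eventually_map] at hK
  have hsin : 0 < Real.sin α :=
    Real.sin_pos_of_pos_of_lt_pi hα.1 (by linarith [hα.2, Real.pi_pos])
  obtain ⟨C, hC⟩ := hG.exists_norm_mul_le_rightSector hF K (half_pos hsin)
  have htime := eventually_mem_timeInterval hT
  have hCa : Tendsto (fun t => A 0 t x * C / a t) (𝓝[>] 0) (𝓝 0) := by
    simpa only [zero_mul, div_mul_eq_mul_div] using (hG.tendsto_div_a hT hx).mul_const C
  have hright : Tendsto (fun t => rayIntegral (fun z => Gext t x z * F z) s (α / 2))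
      (𝓝[>] 0) (𝓝 0) := by
    refine tendsto_rayIntegral_zero hα hs ((le_abs_self x).trans_lt hxs) hG.a_lim hCa ?_
    filter_upwards [htime, hK] with t ht hB z hz using (hC ht hx hB z hz).1
  have hleft : Tendsto (fun t => rayIntegral (fun z => Gext t x (-z) * F (-z)) s (α / 2))
      (𝓝[>] 0) (𝓝 0) := by
    refine tendsto_rayIntegral_zero hα hs ((neg_le_abs x).trans_lt hxs) hG.a_lim hCa ?_
    filter_upwards [htime, hK] with t ht hB z hz using (hC ht hx hB z hz).2
  have hsmooth : ContDiff ℝ ∞ fun y : ℝ => F y :=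
    (hF.differentiable.contDiff.restrict_scalars ℝ).comp Complex.ofRealCLM.contDiff
  have hlim := (hinner (fun y : ℝ => F y) hsmooth.contDiffOn).add (hright.add hleft)
  rw [add_zero, add_zero] at hlim
  exact hlim.congr' (htime.mono fun t ht => (hG.waveFunction_eq_split hF hs ht hx).symm)

end InitialCondition

section Congruence

variable {T : EReal} {V Φ Ψ : ℝ → ℝ → ℂ} {M N : Matrix (Fin 2) (Fin 2) ℂ} {u v : ℝ → ℂ}

lemma IsACDot.congr (hu : IsACDot u) (h : EqOn u v dotReal) : IsACDot v :=
  ⟨hu.1.congr (h.mono Iio_subset_dotReal), hu.2.congr (h.mono Ioi_subset_dotReal)⟩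

lemma MemAC12.congr (hΦ : MemAC12 T Φ) (h : ∀ t ∈ timeInterval T, EqOn (Φ t) (Ψ t) dotReal) :
    MemAC12 T Ψ where
  time x hx := (hΦ.time x hx).congr fun t ht => h t ht hx
  space t ht := (hΦ.space t ht).congr (h t ht)
  differentiable t ht x hx := (hΦ.differentiable t ht x hx).congr_of_eventuallyEq
    ((h t ht).eventuallyEq_of_mem (isOpen_dotReal.mem_nhds hx)).symm
  space_deriv t ht := (hΦ.space_deriv t ht).congr ((h t ht).deriv isOpen_dotReal)

lemma SatisfiesSchroedinger.congr (hΦ : SatisfiesSchroedinger T V Φ)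
    (h : ∀ t ∈ timeInterval T, EqOn (Φ t) (Ψ t) dotReal) : SatisfiesSchroedinger T V Ψ := by
  filter_upwards [hΦ] with P hP ht hx
  have htime : EqOn (fun t => Φ t P.2) (fun t => Ψ t P.2) (timeInterval T) := fun t ht => h t ht hx
  rw [← htime.deriv (isOpen_timeInterval T) ht, ← h P.1 ht hx,
    ← ((h P.1 ht).deriv isOpen_dotReal).deriv isOpen_dotReal hx]
  exact hP ht hx

lemma SatisfiesTransmission.congr (hu : SatisfiesTransmission M N u) (h : EqOn u v dotReal) :
    SatisfiesTransmission M N v := by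
  obtain ⟨up, um, dp, dm, hvalue, hderiv, hmulVec⟩ := hu
  have hright : ∀ {f g : ℝ → ℂ}, EqOn f g dotReal → f =ᶠ[𝓝[>] 0] g := fun h =>
    h.eventuallyEq_of_mem (mem_of_superset self_mem_nhdsWithin Ioi_subset_dotReal)
  have hleft : ∀ {f g : ℝ → ℂ}, EqOn f g dotReal → f =ᶠ[𝓝[<] 0] g := fun h =>
    h.eventuallyEq_of_mem (mem_of_superset self_mem_nhdsWithin Iio_subset_dotReal)
  have hd := h.deriv isOpen_dotReal
  exact ⟨up, um, dp, dm,
    fun hMN => ⟨(hvalue hMN).1.congr' (hright h), (hvalue hMN).2.congr' (hleft h)⟩,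
    fun hN => ⟨(hderiv hN).1.congr' (hright hd), (hderiv hN).2.congr' (hleft hd)⟩, hmulVec⟩

end Congruence

section CauchyProblem

variable {T : EReal} {V : ℝ → ℝ → ℂ} {M N : Matrix (Fin 2) (Fin 2) ℂ} {G : ℝ → ℝ → ℝ → ℂ}
  {α : ℝ} {Gext : ℝ → ℝ → ℂ → ℂ} {a : ℝ → ℝ} {Gt : ℝ → ℝ → ℂ → ℂ} {p : ℝ}
  {A B : Fin 3 → ℝ → ℝ → ℝ} {F : ℂ → ℂ}

theorem GreenAssumption.isCauchySolution_waveFunction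
    (hG : GreenAssumption T V M N G α Gext a Gt p A B) (hT : 0 < T)
    (hF : IsEntireOfMinimalType F) :
    IsCauchySolution T V M N (fun x : ℝ => F x) (waveFunction G F) := by
  have hhalf := half_mem_Icc hG.angle
  have hsin := sin_two_mul_half_pos hG.angle
  have heq : ∀ t ∈ timeInterval T,
      EqOn (fun x => ∫ y, contourIntegrand Gext F 0 (α / 2) t x y) (waveFunction G F t) dotReal :=
    fun t ht x hx => (hG.waveFunction_eq_integral hF ht hx).symm
  exact ⟨(hG.memAC12_integral hF hhalf hsin).congr heq,
    (hG.schroedinger_integral hF hhalf hsin).congr heq,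
    fun t ht => (hG.transmission_integral hF ht).congr (heq t ht),
    fun x hx => hG.tendsto_waveFunction hT hF hx⟩

lemma contourIntegrand_sub (Gext : ℝ → ℝ → ℂ → ℂ) (F₁ F₂ : ℂ → ℂ) (ε θ t x y : ℝ) :
    contourIntegrand Gext F₁ ε θ t x y - contourIntegrand Gext F₂ ε θ t x y
      = contourIntegrand Gext (F₁ - F₂) ε θ t x y := by
  simp only [contourIntegrand, contourWeight]
  split_ifs
  · ring
  · rw [Pi.sub_apply]
    ring

lemma GreenAssumption.waveFunction_sub (hG : GreenAssumption T V M N G α Gext a Gt p A B)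
    {F₁ F₂ : ℂ → ℂ} (hF₁ : IsEntireOfMinimalType F₁) (hF₂ : IsEntireOfMinimalType F₂) {t x : ℝ}
    (ht : t ∈ timeInterval T) (hx : x ∈ dotReal) :
    waveFunction G F₁ t x - waveFunction G F₂ t x
      = ∫ y, contourIntegrand Gext (F₁ - F₂) 0 (α / 2) t x y := by
  have hint := fun {F} (hF : IsEntireOfMinimalType F) => hG.integrable_contourIntegrand hF
    (half_mem_Icc hG.angle) ht hx (hG.rate_pos (sin_two_mul_half_pos hG.angle) ht)
  rw [hG.waveFunction_eq_integral hF₁ ht hx, hG.waveFunction_eq_integral hF₂ ht hx,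
    ← integral_sub (hint hF₁) (hint hF₂)]
  simp only [contourIntegrand_sub]

theorem GreenAssumption.tendstoUniformlyOn_waveFunction
    (hG : GreenAssumption T V M N G α Gext a Gt p A B) (hF : IsEntireOfMinimalType F)
    {Fn : ℕ → ℂ → ℂ} (hFn : ∀ n, IsEntireOfMinimalType (Fn n))
    (hconv : ConvergesMinimalType Fn F) {t : ℝ} (ht : t ∈ timeInterval T) {S : Set ℝ}
    (hS : IsCompact S) (hSd : S ⊆ dotReal) :
    TendstoUniformlyOn (fun n x => waveFunction G (Fn n) t x) (waveFunction G F t) atTop S := by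
  have hrate := hG.rate_pos (sin_two_mul_half_pos hG.angle) ht
  set c := 0 * Real.cos (2 * (α / 2)) + a t * Real.sin (2 * (α / 2))
  obtain ⟨K, hK⟩ := hG.exists_gaussianRegime (isCompact_singleton.prod hS)
    (prod_mono (singleton_subset_iff.2 ht) hSd)
  obtain ⟨C, hC0, hC⟩ := hG.exists_norm_integrand_le hrate K
  set J : ℝ := ∫ y : ℝ, C * Real.exp (-(c / 2) * y ^ 2) with hJ
  have hJ0 : 0 ≤ J := integral_nonneg fun y => by positivity
  rw [Metric.tendstoUniformlyOn_iff]
  intro e he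
  have hJ1 : 0 < J + 1 := add_pos_of_nonneg_of_pos hJ0 one_pos
  filter_upwards [hconv (c / 16) (by positivity) _ (div_pos he hJ1)] with n hn x hx
  rw [dist_comm, dist_eq_norm, hG.waveFunction_sub (hFn n) hF ht (hSd hx)]
  have hregime := hK (m := 0) (c := c) (ε := 0) (mk_mem_prod rfl hx) (half_mem_Icc hG.angle) le_rfl
  calc ‖∫ y, contourIntegrand Gext (Fn n - F) 0 (α / 2) t x y‖
      ≤ ∫ y, e / (J + 1) * C * Real.exp (-(c / 2) * y ^ 2) :=
        norm_integral_le_of_norm_le (integrable_const_mul_gaussian _ hrate)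
          (Eventually.of_forall (hC hn hregime))
    _ = e / (J + 1) * J := by
        simp only [hJ, mul_assoc, integral_const_mul]
    _ < e := by
        rw [div_mul_eq_mul_div, div_lt_iff₀ hJ1]
        linarith

end CauchyProblem

end GreenSchroedinger

open GreenSchroedinger in
theorem theorem3p3_general {T : EReal} {V : ℝ → ℝ → ℂ} {M N : Matrix (Fin 2) (Fin 2) ℂ}
    {G : ℝ → ℝ → ℝ → ℂ} {α : ℝ} {Gext : ℝ → ℝ → ℂ → ℂ} {a : ℝ → ℝ} {Gt : ℝ → ℝ → ℂ → ℂ} {p : ℝ}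
    {A B : Fin 3 → ℝ → ℝ → ℝ} {F : ℂ → ℂ}
    (hG : GreenAssumption T V M N G α Gext a Gt p A B) (hT : 0 < T) (hF : IsEntireOfMinimalType F) :
    (∀ t ∈ timeInterval T, ∀ x ∈ dotReal,
      (∀ ε : ℝ, 0 < ε → Integrable (regIntegrand G F t x ε)) ∧
      Tendsto (fun ε : ℝ => ∫ y : ℝ, regIntegrand G F t x ε y)
        (𝓝[>] 0) (𝓝 (waveFunction G F t x))) ∧
    IsCauchySolution T V M N (fun x : ℝ => F x) (waveFunction G F) ∧
    (∀ Fn : ℕ → ℂ → ℂ, (∀ n, IsEntireOfMinimalType (Fn n)) → ConvergesMinimalType Fn F →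
      ∀ t ∈ timeInterval T, ∀ K : Set ℝ, IsCompact K → K ⊆ dotReal →
        TendstoUniformlyOn (fun n x => waveFunction G (Fn n) t x) (waveFunction G F t) atTop K) :=
  ⟨fun _ ht _ hx => ⟨fun _ hε => hG.integrable_regIntegrand hF hε ht hx,
      hG.tendsto_integral_regIntegrand hF ht hx⟩,
    hG.isCauchySolution_waveFunction hT hF,
    fun _ hFn hconv _ ht _ hK hKd => hG.tendstoUniformlyOn_waveFunction hF hFn hconv ht hK hKd⟩

theorem theorem3p3 (T : EReal) (hT : 0 < T) (V : ℝ → ℝ → ℂ) (M N : Matrix (Fin 2) (Fin 2) ℂ)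
    (G : ℝ → ℝ → ℝ → ℂ) (α : ℝ) (Gext : ℝ → ℝ → ℂ → ℂ) (a : ℝ → ℝ) (Gt : ℝ → ℝ → ℂ → ℂ)
    (p : ℝ) (A B : Fin 3 → ℝ → ℝ → ℝ)
    (hG : GreenSchroedinger.GreenAssumption T V M N G α Gext a Gt p A B)
    (q : ℝ) (hq : q ∈ Set.Ioo (0 : ℝ) 2) (F : ℂ → ℂ) (hF : F ∈ GreenSchroedinger.expGrowth q) :
    (∀ t ∈ GreenSchroedinger.timeInterval T, ∀ x ∈ GreenSchroedinger.dotReal,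
      (∀ ε : ℝ, 0 < ε → Integrable (GreenSchroedinger.regIntegrand G F t x ε)) ∧
      Tendsto (fun ε : ℝ => ∫ y : ℝ, GreenSchroedinger.regIntegrand G F t x ε y)
        (𝓝[>] 0) (𝓝 (GreenSchroedinger.waveFunction G F t x))) ∧
    GreenSchroedinger.IsCauchySolution T V M N (fun x : ℝ => F (x : ℂ))
      (GreenSchroedinger.waveFunction G F) ∧
    (∀ Fn : ℕ → ℂ → ℂ, (∀ n, Fn n ∈ GreenSchroedinger.expGrowth q) →
      GreenSchroedinger.ConvergesExpGrowth q Fn F →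
      ∀ t ∈ GreenSchroedinger.timeInterval T, ∀ K : Set ℝ, IsCompact K →
        K ⊆ GreenSchroedinger.dotReal →
        TendstoUniformlyOn (fun n x => GreenSchroedinger.waveFunction G (Fn n) t x)
          (GreenSchroedinger.waveFunction G F t) atTop K) := by
  obtain ⟨hreg, hsol, hcont⟩ := theorem3p3_general hG hT
    (GreenSchroedinger.isEntireOfMinimalType_of_mem_expGrowth hq hF)
  exact ⟨hreg, hsol, fun Fn hFn hconv => hcont Fn
    (fun n => GreenSchroedinger.isEntireOfMinimalType_of_mem_expGrowth hq (hFn n))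
    (hconv.convergesMinimalType hq)⟩
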